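/- Fix a field $K$. A *tropical curve* $C$ in $\mathbb{R}^n$ is a finite piecewise linear graph embedded in $\mathbb{R}^n$ whose edges $e$ are (bounded or unbounded) with an integer direction and a positive integer weight $w_e$, such that at every vertex $v$ the balancing condition $\sum_{e\ni v} w_e u_e=0$ holds, where $u_e$ is the primitive integer direction of $e$ pointing away from $v$. Its *degree* is $\sum_e w_e\max\{0,u_{e,1},\dots,u_{e,n}\}$, where $e$ ranges over the unbounded edges and $u_e=(u_{e,1},\dots,u_{e,n})$ is the primitive integer direction of $e$ pointing towards infinity. Its *genus* is its first Betti number $\dim_K H_1(C;K)$. A *tropical plane* in $\mathbb{R}^n$ is a tropical surface of degree $1$ in $\mathbb{R}^n$, that is, a finite rational polyhedral complex of pure dimension $2$ in $\mathbb{R}^n$, with positive integer weights on its 2-dimensional faces, balanced along its 1-dimensional faces, and whose stable intersection number with a generic translate of the standard fan tropical linear space of dimension $n-2$ (the union of the cones generated by $n-2$ of the $n+1$ directions $(-1,0,\dots,0),\dots,(0,\dots,0,-1),(1,\dots,1)$) is $1$. A tropical curve is *planar* if it is contained in a tropical plane. **Theorem.** For any integers $d\ge 1$ and $n\ge 2$,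 there exists a planar tropical curve of degree $d$ in $\mathbb{R}^n$ with genus $$(n-1)\cdot\frac{(d-1)(d-2)}{2}.$$ In particular: - for every integer $g\ge 0$ there exist $n\ge 2$ and a planar tropical curve of degree $3$ and genus $g$ in $\mathbb{R}^n$; - for every $d\ge 3$, the genus of the planar tropical curves of degree $d$ in $\mathbb{R}^n$, $n\ge 2$, is not bounded from above by any constant depending only on $d$ (such as $\frac{(d-1)(d-2)}{2}$), which disproves a conjecture of T. Yu. -/

import Mathlib

noncomputable section

namespace Tropical

/-! Tropical curves -/

/-- The ray or segment `{p + t u : t ∈ T}` issued from `p` in the integer direction `u`. -/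
def lineImage {n : ℕ} (p : Fin n → ℝ) (u : Fin n → ℤ) (T : Set ℝ) : Set (Fin n → ℝ) :=
  (fun t : ℝ => fun j => p j + t * (u j : ℝ)) '' T

/-- The relatively open cells of a graph in `ℝⁿ`: its vertices, its bounded edges without their
endpoints, and its unbounded edges without their endpoint. -/
def openCell {n : ℕ} {V E R : Type} (pos : V → Fin n → ℝ)
    (src : E → V) (dir : E → Fin n → ℤ) (len : E → ℝ)
    (base : R → V) (rdir : R → Fin n → ℤ) : V ⊕ E ⊕ R → Set (Fin n → ℝ)
  | Sum.inl v => {pos v}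
  | Sum.inr (Sum.inl e) => lineImage (pos (src e)) (dir e) (Set.Ioo 0 (len e))
  | Sum.inr (Sum.inr r) => lineImage (pos (base r)) (rdir r) (Set.Ioi 0)

open Classical in
/-- A tropical curve in `ℝⁿ`: a finite piecewise linear graph embedded in `ℝⁿ` whose edges have
integer directions and positive integer weights, and which is balanced at every vertex.
(An edge that is a full line is written as two unbounded edges issued from a 2-valent vertex.) -/
structure TropicalCurve (n : ℕ) where
  /-- vertices -/
  V : Type
  /-- bounded edges, each with an arbitrary orientation -/
  E : Type
  /-- unbounded edges -/
  R : Type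
  [finV : Fintype V]
  [finE : Fintype E]
  [finR : Fintype R]
  /-- position of the vertices -/
  pos : V → Fin n → ℝ
  /-- endpoints of a bounded edge -/
  src : E → V
  tgt : E → V
  /-- primitive integer direction of a bounded edge, from its source to its target -/
  dir : E → Fin n → ℤ
  dir_primitive : ∀ e, Finset.univ.gcd (dir e) = 1
  /-- lattice length of a bounded edge -/
  len : E → ℝ
  len_pos : ∀ e, 0 < len e
  tgt_eq : ∀ e j, pos (tgt e) j = pos (src e) j + len e * (dir e j : ℝ)
  /-- the endpoint of an unbounded edge -/
  base : R → V
  /-- primitive integer direction of an unbounded edge, pointing towards infinity -/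
  rdir : R → Fin n → ℤ
  rdir_primitive : ∀ r, Finset.univ.gcd (rdir r) = 1
  /-- weights -/
  weight : E → ℕ
  weight_pos : ∀ e, 0 < weight e
  rweight : R → ℕ
  rweight_pos : ∀ r, 0 < rweight r
  /-- the graph is embedded: distinct open cells are disjoint -/
  embedded : Pairwise fun a b =>
    Disjoint (openCell pos src dir len base rdir a) (openCell pos src dir len base rdir b)
  /-- there are no isolated vertices -/
  not_isolated : ∀ v, (∃ e, src e = v) ∨ (∃ e, tgt e = v) ∨ (∃ r, base r = v)
  /-- the balancing condition -/
  balanced : ∀ v, (∑ e with src e = v, (weight e : ℤ) • dir e)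
    + (∑ e with tgt e = v, (weight e : ℤ) • (-dir e))
    + (∑ r with base r = v, (rweight r : ℤ) • rdir r) = 0

attribute [instance] TropicalCurve.finV TropicalCurve.finE TropicalCurve.finR

namespace TropicalCurve

variable {n : ℕ}

/-- The underlying set of points of a tropical curve. -/
def support (C : TropicalCurve n) : Set (Fin n → ℝ) :=
  ⋃ a, openCell C.pos C.src C.dir C.len C.base C.rdir a

/-- The degree `∑ₑ wₑ max {0, uₑ₁, …, uₑₙ}`, over the unbounded edges `e`. -/
def degree (C : TropicalCurve n) : ℕ :=
  ∑ r, C.rweight r * Finset.univ.sup fun j => (C.rdir r j).toNat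

open Classical in
/-- The boundary map `∂ e = tgt e - src e` of the cellular chain complex, with coefficients in `K`,
of the union of the vertices and of the bounded edges. The curve deformation retracts onto this
finite graph, since every unbounded edge retracts onto its endpoint. -/
def boundary (C : TropicalCurve n) (K : Type*) [Field K] : (C.E → K) →ₗ[K] (C.V → K) where
  toFun c v := (∑ e with C.tgt e = v, c e) - ∑ e with C.src e = v, c e
  map_add' c c' := by
    ext v
    simp only [Pi.add_apply, Finset.sum_add_distrib]
    ring
  map_smul' a c := by
    ext v
    simp only [Pi.smul_apply, smul_eq_mul, RingHom.id_apply, mul_sub, Finset.mul_sum]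

/-- The genus: the first Betti number, that is, the dimension of the first homology group with
coefficients in `K`. As there are no 2-cells, this group is the kernel of the boundary map. -/
def genus (C : TropicalCurve n) (K : Type*) [Field K] : ℕ :=
  Module.finrank K (LinearMap.ker (C.boundary K))

end TropicalCurve

/-! Tropical varieties -/

/-- The inclusion of `ℤⁿ` in `ℝⁿ`. -/
def intCast {n : ℕ} (z : Fin n → ℤ) : Fin n → ℝ := fun j => (z j : ℝ)

/-- The lattice `W ∩ ℤⁿ` of integer points of a linear subspace `W` of `ℝⁿ`. -/
def latticeOf {n : ℕ} (W : Submodule ℝ (Fin n → ℝ)) : AddSubgroup (Fin n → ℤ) :=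
  W.toAddSubgroup.comap (Int.castAddHom ℝ |>.compLeft (Fin n))

/-- A nonempty polyhedron whose faces have directions defined over `ℤ`. -/
def IsRationalPolyhedron {n : ℕ} (F : Set (Fin n → ℝ)) : Prop :=
  F.Nonempty ∧ ∃ (k : ℕ) (a : Fin k → Fin n → ℤ) (b : Fin k → ℝ),
    F = {x | ∀ i, ∑ j, (a i j : ℝ) * x j ≤ b i}

/-- The direction of a polyhedron: the linear subspace generated by the differences of its points,
that is, the linear space parallel to its affine span. -/
def cellSpan {n : ℕ} (F : Set (Fin n → ℝ)) : Submodule ℝ (Fin n → ℝ) :=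
  Submodule.span ℝ {w | ∃ x ∈ F, ∃ y ∈ F, w = x - y}

/-- The dimension of a polyhedron. -/
def cellDim {n : ℕ} (F : Set (Fin n → ℝ)) : ℕ := Module.finrank ℝ (cellSpan F)

/-- `z` is a primitive integer vector of `F` relative to its facet `G`: it points from `G` into `F`
and, modulo the lattice of `G`, it generates the lattice of `F`. -/
def IsPrimitiveNormal {n : ℕ} (G F : Set (Fin n → ℝ)) (z : Fin n → ℤ) : Prop :=
  intCast z ∉ cellSpan G ∧
  latticeOf (cellSpan F) = latticeOf (cellSpan G) ⊔ AddSubgroup.zmultiples z ∧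
  ∃ x ∈ G, ∃ t : ℝ, 0 < t ∧ x + t • intCast z ∈ F

open Classical in
/-- A tropical variety of pure dimension `m` in `ℝⁿ`: a finite rational polyhedral complex, with
positive integer weights on its facets, which is balanced at every face of codimension 1. -/
structure TropicalVariety (n m : ℕ) where
  cells : Finset (Set (Fin n → ℝ))
  polyhedron : ∀ F ∈ cells, IsRationalPolyhedron F
  /-- every nonempty face of a cell is a cell -/
  face_mem : ∀ F ∈ cells, ∀ G : Set (Fin n → ℝ), IsExposed ℝ F G → G.Nonempty → G ∈ cells
  /-- two cells meet along a common (possibly empty) face -/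
  inter_face : ∀ F ∈ cells, ∀ G ∈ cells, IsExposed ℝ F (F ∩ G)
  /-- every face is contained in a facet, and all facets have dimension `m` -/
  pure : ∀ F ∈ cells, ∃ G ∈ cells, F ⊆ G ∧ cellDim G = m
  weight : Set (Fin n → ℝ) → ℕ
  weight_pos : ∀ F ∈ cells, cellDim F = m → 0 < weight F
  /-- the balancing condition -/
  balanced : ∀ G ∈ cells, cellDim G + 1 = m → ∃ z : Set (Fin n → ℝ) → Fin n → ℤ,
    (∀ F ∈ cells, cellDim F = m → G ⊆ F → IsPrimitiveNormal G F (z F)) ∧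
    intCast (∑ F ∈ cells with cellDim F = m ∧ G ⊆ F, (weight F : ℤ) • z F) ∈ cellSpan G

/-- The directions `(1, …, 1), (-1, 0, …, 0), …, (0, …, 0, -1)` of the rays of the standard fan
tropical linear spaces of `ℝⁿ`. -/
def stdRay {n : ℕ} : Fin (n + 1) → Fin n → ℤ :=
  Fin.cons (fun _ => 1) fun i => -Pi.single i 1

/-- The cone generated by the rays of the directions in `I`. The standard fan tropical linear space
of dimension `k` in `ℝⁿ` is the union of these cones for `|I| = k`, each with weight `1`. -/
def stdCone {n : ℕ} (I : Finset (Fin (n + 1))) : Set (Fin n → ℝ) :=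
  {x | ∃ a : Fin (n + 1) → ℝ, (∀ i, 0 ≤ a i) ∧ x = ∑ i ∈ I, a i • intCast (stdRay i)}

/-- The linear span of `stdCone I`. -/
def stdSpan {n : ℕ} (I : Finset (Fin (n + 1))) : Submodule ℝ (Fin n → ℝ) :=
  Submodule.span ℝ ((fun i => intCast (stdRay i)) '' (I : Set (Fin (n + 1))))

namespace TropicalVariety

variable {n m : ℕ}

/-- The underlying set of points of a tropical variety. -/
def support (X : TropicalVariety n m) : Set (Fin n → ℝ) := {x | ∃ F ∈ X.cells, x ∈ F}

/-- The cell `F` meets the translate by `v` of the cone `stdCone I`. -/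
def Meets (F : Set (Fin n → ℝ)) (v : Fin n → ℝ) (I : Finset (Fin (n + 1))) : Prop :=
  ∃ y ∈ stdCone I, v + y ∈ F

/-- The translate by `v` of the standard fan tropical linear space of dimension `n - m` is in
general position with respect to `X`: the two complexes meet only along pairs of facets, and these
are transverse. -/
def IsGeneric (X : TropicalVariety n m) (v : Fin n → ℝ) : Prop :=
  ∀ F ∈ X.cells, ∀ I : Finset (Fin (n + 1)), I.card + m ≤ n → Meets F v I →
    cellDim F = m ∧ I.card + m = n ∧ IsCompl (cellSpan F) (stdSpan I)

open Classical in
/-- The number of intersection points of `X` with the translate by `v` of the standard fan tropical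
linear space of dimension `n - m`, an intersection point of two facets being counted with the
product of their weights and the index in `ℤⁿ` of the sum of their lattices. -/
def intersectionNumber (X : TropicalVariety n m) (v : Fin n → ℝ) : ℕ :=
  ∑ F ∈ X.cells with cellDim F = m,
    ∑ I : Finset (Fin (n + 1)) with I.card + m = n ∧ Meets F v I,
      X.weight F * (latticeOf (cellSpan F) ⊔ latticeOf (stdSpan I)).index

/-- `X` has degree `d`: its stable intersection number with a generic translate of the standard fan
tropical linear space of dimension `n - m` is `d`. -/
def HasDegree (X : TropicalVariety n m) (d : ℕ) : Prop :=
  ∀ v, X.IsGeneric v → X.intersectionNumber v = d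

end TropicalVariety

/-- A tropical plane in `ℝⁿ` is a tropical surface of degree `1`; a tropical curve is planar if it
is contained in a tropical plane. -/
def TropicalCurve.IsPlanar {n : ℕ} (C : TropicalCurve n) : Prop :=
  ∃ L : TropicalVariety n 2, L.HasDegree 1 ∧ C.support ⊆ L.support

end Tropical

end

open Filter Topology

noncomputable section

namespace Tropical

variable {n : ℕ} {B : ℕ}

/-! The genus of a planar curve can grow with `n` because a tropical plane in `ℝⁿ` may contain many
large flat regions. The plane `planeSet`, attached to a caterpillar tree with leaves `0, …, n`, has
one such region for each of the `n - 1` inner vertices of the tree (`mem_planeSet`). In suitable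
coordinates `(X, Y)` the line `X = D` of one region is the line `Y = D` of the next
(`chartPos_succ`).

Let `D = d - 1`. Each region receives a copy of one planar curve: a triangular piece of the square
grid whose two outer sides are bent along parabolas so that it balances. It has `D + 1` diagonal
ends of weight one and only two other ends, one to the left and one downwards, each of weight `D +
1`. Its genus is `D (D - 1) / 2`. The downward end of each copy is cut and becomes the left end of
the next, so that the `n - 1` copies form a chain. The genera add up, since a connecting edge counts
once whatever its weight. The only end with a positive coordinate is the left end of the first copy,
so the degree stays `D + 1`.

That the ambient set is a tropical plane is derived from the four properties in `IsPlaneSet`. They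
force each cell of codimension one to have exactly one block of coordinates that splits, and the
facets around the cell correspond to the parts of a partition of this block. The indicator functions
of the parts add up to that of the block, which is the balancing condition (`IsPlaneSet.variety`).
For the degree, intersecting with a translate by `v` of the standard linear space amounts to looking
for points of `L` below `v` that agree with `v` in three coordinates. Such a point exists by a
compactness argument, and for generic `v` it is the greatest point of `L` below `v`, hence unique;
it counts with index one (`IsPlaneSet.hasDegree_one`). The axioms hold for `planeSet` by
`isPlaneSet_planeSet`.

Embeddedness of the chain rests on `Located.unique`, balancing on `curve_balanced`, and the genus on
the Euler characteristic, `TropicalCurve.genus_add_card`. -/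

/-- The homogeneous coordinates `(0, y₁, …, yₙ)` of a point of `ℝⁿ`. -/
def hat (y : Fin n → ℝ) : Fin (n + 1) → ℝ := Fin.cons 0 y

@[simp] lemma hat_zero (y : Fin n → ℝ) : hat y 0 = 0 := rfl

@[simp] lemma hat_succ (y : Fin n → ℝ) (j : Fin n) : hat y j.succ = y j := rfl

lemma hat_add (x y : Fin n → ℝ) (i : Fin (n + 1)) : hat (x + y) i = hat x i + hat y i := by
  cases i using Fin.cases <;> simp

lemma hat_sub (x y : Fin n → ℝ) (i : Fin (n + 1)) : hat (x - y) i = hat x i - hat y i := by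
  cases i using Fin.cases <;> simp

lemma hat_smul (t : ℝ) (y : Fin n → ℝ) (i : Fin (n + 1)) : hat (t • y) i = t * hat y i := by
  cases i using Fin.cases <;> simp

/-- The point of `ℝⁿ` with given homogeneous coordinates. -/
def dehom (x : Fin (n + 1) → ℝ) : Fin n → ℝ := fun j => x j.succ - x 0

lemma hat_dehom (x : Fin (n + 1) → ℝ) (i : Fin (n + 1)) : hat (dehom x) i = x i - x 0 := by
  cases i using Fin.cases <;> simp [dehom]

lemma hat_eq_sum (y : Fin n → ℝ) (a : Fin (n + 1)) :
    hat y a = ∑ j : Fin n, ((if a = j.succ then 1 else 0 : ℤ) : ℝ) * y j := by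
  cases a using Fin.cases with
  | zero => simp [Fin.succ_ne_zero, eq_comm]
  | succ i => simp

/-! ### Faces of the arrangement of the hyperplanes `x a - x b = c` -/

/-- `y` satisfies all the weak inequalities `x a - x b ≤ c`, with `c` an integer of absolute value
at most `B`, that `x` satisfies. -/
def Spec (B : ℕ) (x y : Fin (n + 1) → ℝ) : Prop :=
  ∀ (a b : Fin (n + 1)) (c : ℤ), |c| ≤ B → x a - x b ≤ c → y a - y b ≤ c

lemma Spec.refl (x : Fin (n + 1) → ℝ) : Spec B x x := fun _ _ _ _ h => h

lemma Spec.trans {x y z : Fin (n + 1) → ℝ} (h : Spec B x y) (h' : Spec B y z) : Spec B x z :=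
  fun a b c hc hx => h' a b c hc (h a b c hc hx)

lemma Spec.of_sub_eq {x y : Fin (n + 1) → ℝ} (h : ∀ a b, x a - x b = y a - y b) :
    Spec B x y := fun a b c _ hx => by rw [← h]; exact hx

lemma spec_hat_dehom (x : Fin (n + 1) → ℝ) : Spec B x (hat (dehom x)) :=
  Spec.of_sub_eq fun a b => by simp [hat_dehom]

lemma hat_dehom_spec (x : Fin (n + 1) → ℝ) : Spec B (hat (dehom x)) x :=
  Spec.of_sub_eq fun a b => by simp [hat_dehom]

lemma Spec.ge {x y : Fin (n + 1) → ℝ} (h : Spec B x y) {a b : Fin (n + 1)} {c : ℤ}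
    (hc : |c| ≤ B) (hx : (c : ℝ) ≤ x a - x b) : (c : ℝ) ≤ y a - y b := by
  have := h b a (-c) (by simpa using hc) (by push_cast; linarith)
  push_cast at this
  linarith

/-- The coordinates `a` and `b` of `x` differ by an integer of absolute value at most `B`. -/
def Tie (B : ℕ) (x : Fin (n + 1) → ℝ) (a b : Fin (n + 1)) : Prop :=
  ∃ c : ℤ, |c| ≤ B ∧ x a - x b = c

/-- The equivalence relation generated by the ties of `x`. -/
def blk (B : ℕ) (x : Fin (n + 1) → ℝ) : Setoid (Fin (n + 1)) := Relation.EqvGen.setoid (Tie B x)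

lemma Tie.blk {x : Fin (n + 1) → ℝ} {a b : Fin (n + 1)} (h : Tie B x a b) : blk B x a b :=
  Relation.EqvGen.rel _ _ h

/-- Functions that agree along ties agree along blocks. -/
lemma blk_induction {x : Fin (n + 1) → ℝ} {r : Setoid (Fin (n + 1))}
    (h : ∀ a b, Tie B x a b → r a b) {a b : Fin (n + 1)} (hab : blk B x a b) : r a b := by
  induction hab with
  | rel _ _ h' => exact h _ _ h'
  | refl _ => exact r.refl _
  | symm _ _ _ ih => exact r.symm ih
  | trans _ _ _ _ _ ih ih' => exact r.trans ih ih'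

lemma blk_const {x : Fin (n + 1) → ℝ} {α : Type*} {w : Fin (n + 1) → α}
    (h : ∀ a b, Tie B x a b → w a = w b) {a b : Fin (n + 1)} (hab : blk B x a b) : w a = w b :=
  blk_induction (r := Setoid.ker w) h hab

/-- A tie is a pair of opposite weak inequalities of the arrangement, and both are inherited. -/
lemma Spec.tie_sub {x y : Fin (n + 1) → ℝ} (h : Spec B x y) {a b : Fin (n + 1)}
    (hab : Tie B x a b) : y a - y b = x a - x b := by
  obtain ⟨c, hc, e⟩ := hab
  rw [e]
  exact le_antisymm (h a b c hc e.le) (h.ge hc e.ge)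

lemma Spec.tie {x y : Fin (n + 1) → ℝ} (h : Spec B x y) {a b : Fin (n + 1)}
    (hab : Tie B x a b) : Tie B y a b := by
  have := h.tie_sub hab
  obtain ⟨c, hc, e⟩ := hab
  exact ⟨c, hc, this.trans e⟩

lemma Spec.blk {x y : Fin (n + 1) → ℝ} (h : Spec B x y) {a b : Fin (n + 1)}
    (hab : blk B x a b) : blk B y a b :=
  blk_induction (fun _ _ h' => (h.tie h').blk) hab

/-- `ε` is so small that moving from `x` by `ε w` preserves all strict inequalities. -/
def Small (B : ℕ) (x w : Fin (n + 1) → ℝ) (ε : ℝ) : Prop :=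
  0 < ε ∧ ∀ (a b : Fin (n + 1)) (c : ℤ), |c| ≤ B → x a - x b < c →
    (x + ε • w) a - (x + ε • w) b < c

lemma finite_abs_le (B : ℕ) : {c : ℤ | |c| ≤ B}.Finite :=
  (Set.finite_Icc (-(B : ℤ)) B).subset fun _ h => abs_le.1 h

lemma eventually_small (x w : Fin (n + 1) → ℝ) : ∀ᶠ ε in 𝓝[>] (0 : ℝ), Small B x w ε := by
  refine (eventually_mem_nhdsWithin).and ?_
  refine eventually_all.2 fun a => eventually_all.2 fun b =>
    ((finite_abs_le B).eventually_all (p := fun c ε => x a - x b < c → (x + ε • w) a - (x + ε • w) b < c)).2 fun c _ => ?_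
  by_cases h : x a - x b < c
  · have : Tendsto (fun ε : ℝ => (x + ε • w) a - (x + ε • w) b) (𝓝[>] 0) (𝓝 (x a - x b)) := by
      have : Continuous fun ε : ℝ => (x + ε • w) a - (x + ε • w) b := by
        simp only [Pi.add_apply, Pi.smul_apply, smul_eq_mul]; fun_prop
      simpa using (this.tendsto 0).mono_left nhdsWithin_le_nhds
    filter_upwards [this.eventually_lt_const h] with ε hε _ using hε
  · simp [h]

/-- Inequalities that are strict at `x`, in either direction, survive a small motion; those that are
equalities at `x` are decided by the order of `w` along ties. Hence the face reached depends only on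
that order. -/
lemma Small.spec {x w w' : Fin (n + 1) → ℝ} {ε ε' : ℝ} (h : Small B x w ε)
    (h' : Small B x w' ε') (hw : ∀ a b, Tie B x a b → w a ≤ w b → w' a ≤ w' b) :
    Spec B (x + ε • w) (x + ε' • w') := by
  intro a b c hc hle
  rcases lt_trichotomy (x a - x b) c with hlt | heq | hgt
  · exact (h'.2 a b c hc hlt).le
  · have h1 : w a ≤ w b := by
      simp only [Pi.add_apply, Pi.smul_apply, smul_eq_mul] at hle
      have : ε * w a ≤ ε * w b := by linarith
      exact le_of_mul_le_mul_left this h.1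
    have := mul_le_mul_of_nonneg_left (hw a b ⟨c, hc, heq⟩ h1) h'.1.le
    simp only [Pi.add_apply, Pi.smul_apply, smul_eq_mul]
    linarith
  · have := h.2 b a (-c) (by simpa using hc) (by push_cast; linarith)
    push_cast at this
    linarith

lemma Small.spec_base {x w : Fin (n + 1) → ℝ} {ε : ℝ} (h : Small B x w ε) :
    Spec B (x + ε • w) x := by
  have : Small B x 0 1 := ⟨one_pos, fun a b c _ h => by simpa using h⟩
  simpa using h.spec this (fun _ _ _ _ => le_rfl)

lemma Small.tie {x w : Fin (n + 1) → ℝ} {ε : ℝ} (h : Small B x w ε) {a b : Fin (n + 1)}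
    (hab : Tie B (x + ε • w) a b) : Tie B x a b ∧ w a = w b := by
  refine ⟨h.spec_base.tie hab, ?_⟩
  have := h.spec_base.tie_sub hab
  simp only [Pi.add_apply, Pi.smul_apply, smul_eq_mul] at this
  have : ε * w a = ε * w b := by linarith
  exact mul_left_cancel₀ h.1.ne' this

lemma Small.blk {x w : Fin (n + 1) → ℝ} {ε : ℝ} (h : Small B x w ε) {a b : Fin (n + 1)}
    (hab : blk B (x + ε • w) a b) : blk B x a b ∧ w a = w b :=
  ⟨h.spec_base.blk hab, blk_const (fun _ _ h' => (h.tie h').2) hab⟩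

/-- The cell of `x`: the closed face of the arrangement of the hyperplanes `x a - x b = c`
that contains `x` in its relative interior. -/
def cell (B : ℕ) (x : Fin (n + 1) → ℝ) : Set (Fin n → ℝ) := {y | Spec B x (hat y)}

lemma mem_cell {x : Fin (n + 1) → ℝ} {y : Fin n → ℝ} : y ∈ cell B x ↔ Spec B x (hat y) := Iff.rfl

lemma dehom_mem_cell {x y : Fin (n + 1) → ℝ} : dehom y ∈ cell B x ↔ Spec B x y :=
  ⟨fun h => h.trans (hat_dehom_spec y), fun h => h.trans (spec_hat_dehom y)⟩

lemma cell_subset {x y : Fin (n + 1) → ℝ} : cell B y ⊆ cell B x ↔ Spec B x y :=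
  ⟨fun h => dehom_mem_cell.1 (h (dehom_mem_cell.2 (Spec.refl y))), fun h _ hz => h.trans hz⟩

lemma cell_congr {x y : Fin (n + 1) → ℝ} (h : Spec B x y) (h' : Spec B y x) :
    cell B x = cell B y :=
  (cell_subset.2 h').antisymm (cell_subset.2 h)

/-- A cell is determined by which of the finitely many inequalities hold at the point. -/
lemma finite_cells (B : ℕ) : (Set.range (cell (n := n) B)).Finite := by
  let T : (Fin (n + 1) → ℝ) → Set (Fin (n + 1) × Fin (n + 1) × {c : ℤ | |c| ≤ B}) := fun x =>
    {h | x h.1 - x h.2.1 ≤ (h.2.2 : ℤ)}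
  have : Finite {c : ℤ | |c| ≤ (B : ℤ)} := (finite_abs_le B).to_subtype
  have key : ∀ x y, T x = T y → cell B x = cell B y := by
    intro x y h
    have h' : ∀ a b (c : ℤ), |c| ≤ B → (x a - x b ≤ c ↔ y a - y b ≤ c) := fun a b c hc =>
      Set.ext_iff.1 h (a, b, ⟨c, hc⟩)
    exact cell_congr (fun a b c hc => (h' a b c hc).1) (fun a b c hc => (h' a b c hc).2)
  have hfin : (Set.range T).Finite := Set.toFinite _
  refine (hfin.image (fun t => cell B (Function.invFun T t))).subset ?_
  rintro _ ⟨x, rfl⟩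
  exact ⟨T x, ⟨x, rfl⟩, key _ _ (Function.invFun_eq ⟨x, rfl⟩)⟩

lemma isRationalPolyhedron_cell (x : Fin (n + 1) → ℝ) : IsRationalPolyhedron (cell B x) := by
  refine ⟨⟨dehom x, dehom_mem_cell.2 (Spec.refl x)⟩, ?_⟩
  let H := {h : Fin (n + 1) × Fin (n + 1) × {c : ℤ | |c| ≤ B} // x h.1 - x h.2.1 ≤ (h.2.2 : ℤ)}
  have : Finite {c : ℤ | |c| ≤ (B : ℤ)} := (finite_abs_le B).to_subtype
  let e := Finite.equivFin H
  refine ⟨Nat.card H, fun i j => (if (e.symm i).1.1 = j.succ then 1 else 0)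
    - (if (e.symm i).1.2.1 = j.succ then 1 else 0), fun i => ((e.symm i).1.2.2 : ℤ), ?_⟩
  have hs : ∀ (y : Fin n → ℝ) (a b : Fin (n + 1)),
      ∑ j : Fin n, (((if a = j.succ then 1 else 0) - (if b = j.succ then 1 else 0) : ℤ) : ℝ) * y j
        = hat y a - hat y b := by
    intro y a b
    rw [hat_eq_sum y a, hat_eq_sum y b, ← Finset.sum_sub_distrib]
    refine Finset.sum_congr rfl fun j _ => ?_
    push_cast
    ring
  ext y
  simp only [hs, Set.mem_ofPred_eq]
  constructor
  · intro h i
    exact h _ _ _ (e.symm i).1.2.2.2 (e.symm i).2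
  · intro h a b c hc hx
    have := h (e ⟨(a, b, ⟨c, hc⟩), hx⟩)
    simpa using this

/-- The segment from a point of a cell towards another point of the cell stays in the cell. -/
lemma Spec.combo {x y z : Fin (n + 1) → ℝ} (hy : Spec B x y) (hz : Spec B x z) {t : ℝ}
    (ht : 0 ≤ t) (ht' : t ≤ 1) : Spec B x (y + t • (z - y)) := by
  intro a b c hc hx
  have h1 := hy a b c hc hx
  have h2 := hz a b c hc hx
  simp only [Pi.add_apply, Pi.smul_apply, Pi.sub_apply, smul_eq_mul]
  nlinarith

/-- Each hyperplane in `T` has the first cell weakly on one side and the second weakly on the other.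
The sum of the corresponding linear forms is therefore maximal on the first cell exactly where all
these hyperplanes are met, and this locus is the intersection. -/
lemma isExposed_cell_inter (x x' : Fin (n + 1) → ℝ) :
    IsExposed ℝ (cell B x) (cell B x ∩ cell B x') := by
  classical
  rintro ⟨y₀, hy₀, hy₀'⟩
  let T : Finset (Fin (n + 1) × Fin (n + 1) × ℤ) :=
    (Finset.univ ×ˢ Finset.univ ×ˢ Finset.Icc (-(B : ℤ)) B).filter fun h =>
      x' h.1 - x' h.2.1 ≤ h.2.2 ∧ (h.2.2 : ℝ) < x h.1 - x h.2.1
  have hT : ∀ h ∈ T, |h.2.2| ≤ B ∧ x' h.1 - x' h.2.1 ≤ h.2.2 ∧ (h.2.2 : ℝ) < x h.1 - x h.2.1 := by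
    intro h hh
    simp only [T, Finset.mem_filter, Finset.mem_product, Finset.mem_univ, true_and,
      Finset.mem_Icc] at hh
    exact ⟨abs_le.2 hh.1, hh.2⟩
  let l : (Fin n → ℝ) →ₗ[ℝ] ℝ :=
    { toFun := fun y => ∑ h ∈ T, (hat y h.2.1 - hat y h.1)
      map_add' := fun y z => by
        rw [← Finset.sum_add_distrib]
        exact Finset.sum_congr rfl fun h _ => by rw [hat_add, hat_add]; ring
      map_smul' := fun t y => by
        rw [RingHom.id_apply, smul_eq_mul, Finset.mul_sum]
        exact Finset.sum_congr rfl fun h _ => by rw [hat_smul, hat_smul]; ring }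
  have hpos : ∀ y ∈ cell B x, ∀ h ∈ T, hat y h.2.1 - hat y h.1 ≤ -(h.2.2 : ℝ) := by
    intro y hy h hh
    have := Spec.ge hy (hT h hh).1 (hT h hh).2.2.le
    linarith
  have heq : ∀ y ∈ cell B x', ∀ h ∈ T, -(h.2.2 : ℝ) ≤ hat y h.2.1 - hat y h.1 := by
    intro y hy h hh
    have := hy _ _ _ (hT h hh).1 (hT h hh).2.1
    linarith
  refine ⟨LinearMap.toContinuousLinearMap l, ?_⟩
  ext y
  simp only [Set.mem_inter_iff, Set.mem_ofPred_eq, LinearMap.coe_toContinuousLinearMap']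
  constructor
  · rintro ⟨hy, hy'⟩
    refine ⟨hy, fun z hz => Finset.sum_le_sum fun h hh => ?_⟩
    exact (hpos z hz h hh).trans (heq y hy' h hh)
  · rintro ⟨hy, hmax⟩
    refine ⟨hy, fun a b c hc hx' => ?_⟩
    by_cases hx : x a - x b ≤ c
    · exact hy a b c hc hx
    · have hmem : (a, b, c) ∈ T := by
        simp only [T, Finset.mem_filter, Finset.mem_product, Finset.mem_univ, true_and,
          Finset.mem_Icc]
        exact ⟨abs_le.1 hc, hx', not_le.1 hx⟩
      have h1 : ∑ h ∈ T, -(h.2.2 : ℝ) ≤ ∑ h ∈ T, (hat y h.2.1 - hat y h.1) :=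
        (Finset.sum_le_sum fun h hh => heq y₀ hy₀' h hh).trans (hmax y₀ hy₀)
      have h2 := (Finset.sum_eq_sum_iff_of_le (fun h hh => hpos y hy h hh)).1
        (le_antisymm (Finset.sum_le_sum fun h hh => hpos y hy h hh) h1) _ hmem
      simp only at h2
      linarith

/-- Every nonempty exposed face of a cell is a cell. -/
lemma exists_cell_of_isExposed {x : Fin (n + 1) → ℝ} {G : Set (Fin n → ℝ)}
    (hG : IsExposed ℝ (cell B x) G) (hne : G.Nonempty) : ∃ y, Spec B x y ∧ G = cell B y := by
  classical
  obtain ⟨l, hl⟩ := hG hne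
  have hsub : ∀ y ∈ G, Spec B x (hat y) := fun y hy => by
    rw [hl] at hy; exact hy.1
  let Z : (Fin n → ℝ) → Finset (Fin (n + 1) × Fin (n + 1) × ℤ) := fun y =>
    (Finset.univ ×ˢ Finset.univ ×ˢ Finset.Icc (-(B : ℤ)) B).filter fun h =>
      hat y h.1 - hat y h.2.1 ≠ h.2.2
  have hZ : ∀ y a b (c : ℤ), (a, b, c) ∈ Z y ↔ |c| ≤ B ∧ hat y a - hat y b ≠ c := by
    intro y a b c
    simp [Z, abs_le]
  have hbdd : BddAbove ((fun y => (Z y).card) '' G) :=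
    ⟨((Finset.univ : Finset (Fin (n+1))) ×ˢ (Finset.univ : Finset (Fin (n+1))) ×ˢ
      Finset.Icc (-(B : ℤ)) B).card, by
        rintro _ ⟨y, _, rfl⟩; exact Finset.card_le_card (Finset.filter_subset _ _)⟩
  -- A point of `G` off as many hyperplanes as possible is in the relative interior of `G`: if its
  -- cell missed some `y ∈ G`, the midpoint with `y` would be off one more hyperplane.
  obtain ⟨x₀, hx₀, hmax⟩ := Nat.sSup_mem (hne.image fun y => (Z y).card) hbdd
  have hmax' : ∀ y ∈ G, (Z y).card ≤ (Z x₀).card := fun y hy => by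
    rw [show (Z x₀).card = _ from hmax]; exact le_csSup hbdd ⟨y, hy, rfl⟩
  refine ⟨hat x₀, hsub x₀ hx₀, Set.Subset.antisymm ?_ ?_⟩
  · intro y hy
    by_contra hcon
    simp only [mem_cell, Spec, not_forall, not_le] at hcon
    obtain ⟨a, b, c, hc, hx0, hyc⟩ := hcon
    have hxc : (c : ℝ) < x a - x b := by
      by_contra hle
      exact absurd (hsub y hy a b c hc (not_lt.1 hle)) (not_le.2 hyc)
    have hx0' := (hsub x₀ hx₀).ge hc hxc.le
    have hmid : x₀ + (1 / 2 : ℝ) • (y - x₀) ∈ G := by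
      rw [hl] at hx₀ hy ⊢
      refine ⟨?_, fun z hz => ?_⟩
      · have := Spec.combo hx₀.1 hy.1 (t := 1 / 2) (by norm_num) (by norm_num)
        refine this.trans (Spec.of_sub_eq fun a b => ?_)
        simp [hat_add, hat_smul, hat_sub]
      · have h1 := hx₀.2 z hz
        have h2 := hy.2 z hz
        simp only [map_add, map_smul, map_sub, smul_eq_mul]
        linarith
    have hhat : ∀ i, hat (x₀ + (1 / 2 : ℝ) • (y - x₀)) i = (hat x₀ i + hat y i) / 2 := by
      intro i; rw [hat_add, hat_smul, hat_sub]; ring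
    have hss : Z x₀ ⊂ Z (x₀ + (1 / 2 : ℝ) • (y - x₀)) := by
      refine Finset.ssubset_iff_subset_ne.2 ⟨?_, ?_⟩
      · rintro ⟨a', b', c'⟩ h'
        rw [hZ] at h' ⊢
        refine ⟨h'.1, ?_⟩
        rw [hhat, hhat]
        rcases le_or_gt (x a' - x b') c' with h | h
        · have h1 := lt_of_le_of_ne (hsub x₀ hx₀ a' b' c' h'.1 h) h'.2
          have h2 := hsub y hy a' b' c' h'.1 h
          intro h3; linarith
        · have h1 := lt_of_le_of_ne ((hsub x₀ hx₀).ge h'.1 h.le) h'.2.symm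
          have h2 := (hsub y hy).ge h'.1 h.le
          intro h3; linarith
      · intro h
        have : (a, b, c) ∈ Z (x₀ + (1 / 2 : ℝ) • (y - x₀)) := by
          rw [hZ, hhat, hhat]
          exact ⟨hc, fun h3 => by linarith⟩
        rw [← h, hZ] at this
        exact this.2 (le_antisymm hx0 hx0')
    exact absurd (hmax' _ hmid) (not_le.2 (Finset.card_lt_card hss))
  · intro y hy
    -- The segment from `y` to `x₀` can be prolonged slightly beyond `x₀` inside the cell of `x`. As
    -- `l` is maximal at `x₀`, it cannot be smaller at `y`.
    obtain ⟨ε, hε⟩ := (eventually_small (B := B) (hat x₀) (hat x₀ - hat y)).exists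
    have hz : x₀ + ε • (x₀ - y) ∈ cell B x := by
      intro a b c hc hx
      have h0 := hsub x₀ hx₀ a b c hc hx
      simp only [hat_add, hat_smul, hat_sub]
      rcases h0.lt_or_eq with h | h
      · have := hε.2 a b c hc h
        simp only [Pi.add_apply, Pi.smul_apply, Pi.sub_apply, smul_eq_mul] at this
        exact this.le
      · have := Spec.tie_sub hy ⟨c, hc, h⟩
        have h4 : hat y a - hat y b = hat x₀ a - hat x₀ b := this
        have h5 : hat x₀ a + ε * (hat x₀ a - hat y a) - (hat x₀ b + ε * (hat x₀ b - hat y b))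
          = hat x₀ a - hat x₀ b + ε * ((hat x₀ a - hat x₀ b) - (hat y a - hat y b)) := by ring
        rw [h5, h4, h]
        simp
    have hyF : y ∈ cell B x := (hsub x₀ hx₀).trans hy
    have hx₀' := hx₀
    rw [hl] at hx₀' ⊢
    have h1 := hx₀'.2 _ hz
    simp only [map_add, map_smul, map_sub, smul_eq_mul] at h1
    have h2 : l x₀ ≤ l y := by
      have : ε * (l x₀ - l y) ≤ ε * 0 := by linarith
      linarith [le_of_mul_le_mul_left this hε.1]
    exact ⟨hyF, fun z hz' => (hx₀'.2 z hz').trans h2⟩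

/-- The vectors whose homogeneous coordinates are constant on the classes of `r`. -/
def constOn (r : Setoid (Fin (n + 1))) : Submodule ℝ (Fin n → ℝ) where
  carrier := {w | ∀ a b, r a b → hat w a = hat w b}
  add_mem' h h' a b hab := by rw [hat_add, hat_add, h a b hab, h' a b hab]
  zero_mem' a b _ := by cases a using Fin.cases <;> cases b using Fin.cases <;> simp
  smul_mem' t w h a b hab := by rw [hat_smul, hat_smul, h a b hab]

lemma mem_constOn {r : Setoid (Fin (n + 1))} {w : Fin n → ℝ} :
    w ∈ constOn r ↔ ∀ a b, r a b → hat w a = hat w b := Iff.rfl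

/-- Differences of points of a cell vanish along ties; conversely a small motion constant on blocks
changes no tie and preserves every strict inequality. -/
lemma cellSpan_cell (x : Fin (n + 1) → ℝ) : cellSpan (cell B x) = constOn (blk B x) := by
  apply le_antisymm
  · refine Submodule.span_le.2 ?_
    rintro _ ⟨y, hy, z, hz, rfl⟩ a b hab
    refine blk_const (w := hat (y - z)) (fun a b hab => ?_) hab
    have h1 := Spec.tie_sub hy hab
    have h2 := Spec.tie_sub hz hab
    rw [hat_sub, hat_sub]
    linarith
  · intro w hw
    obtain ⟨ε, hε⟩ := (eventually_small (B := B) x (hat w)).exists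
    have h1 : dehom x + ε • w ∈ cell B x := by
      have h0 : Small B x 0 1 := ⟨one_pos, fun a b c _ h => by simpa using h⟩
      have := h0.spec hε (fun a b hab _ => (hw a b hab.blk).le)
      simp only [smul_zero, add_zero] at this
      refine this.trans (Spec.of_sub_eq fun a b => ?_)
      simp only [Pi.add_apply, Pi.smul_apply, smul_eq_mul, hat_add, hat_smul, hat_dehom]
      ring
    have h2 : w = ε⁻¹ • (dehom x + ε • w - dehom x) := by
      rw [add_sub_cancel_left, smul_smul, inv_mul_cancel₀ hε.1.ne', one_smul]
    rw [h2]
    exact Submodule.smul_mem _ _ (Submodule.subset_span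
      ⟨_, h1, _, dehom_mem_cell.2 (Spec.refl x), rfl⟩)

/-- The functions on the classes map onto this space by dehomogenizing; the kernel consists of the
constants and accounts for the extra `1`. -/
lemma finrank_constOn (r : Setoid (Fin (n + 1))) :
    Module.finrank ℝ (constOn r) + 1 = Nat.card (Quotient r) := by
  classical
  have : Fintype (Quotient r) := Fintype.ofFinite _
  let T : (Quotient r → ℝ) →ₗ[ℝ] (Fin n → ℝ) :=
    { toFun := fun f => dehom fun i => f (Quotient.mk r i)
      map_add' := fun f g => by ext j; simp [dehom]; ring
      map_smul' := fun t f => by ext j; simp [dehom]; ring }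
  have hr : LinearMap.range T = constOn r := by
    apply le_antisymm
    · rintro _ ⟨f, rfl⟩ a b hab
      simp only [T, LinearMap.coe_mk, AddHom.coe_mk, hat_dehom]
      rw [Quotient.sound (s := r) hab]
    · intro w hw
      refine ⟨Quotient.lift (hat w) hw, ?_⟩
      ext j
      change hat w j.succ - hat w 0 = w j
      simp
  have hk : LinearMap.ker T = Submodule.span ℝ {fun _ => (1 : ℝ)} := by
    ext f
    rw [LinearMap.mem_ker, Submodule.mem_span_singleton]
    constructor
    · intro h
      refine ⟨f (Quotient.mk r 0), ?_⟩
      ext q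
      induction q using Quotient.inductionOn with
      | h i =>
        cases i using Fin.cases with
        | zero => simp
        | succ j =>
          have := congrFun h j
          simp only [T, LinearMap.coe_mk, AddHom.coe_mk, dehom, Pi.zero_apply] at this
          simp only [Pi.smul_apply, smul_eq_mul, mul_one]
          linarith
    · rintro ⟨t, rfl⟩
      ext j
      simp [T, dehom]
  have h1 : Module.finrank ℝ (LinearMap.ker T) = 1 := by
    rw [hk]
    exact finrank_span_singleton fun h => one_ne_zero (congrFun h (Quotient.mk r 0))
  have := T.finrank_range_add_finrank_ker
  rw [h1, hr, Module.finrank_pi] at this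
  rw [this, Nat.card_eq_fintype_card]

lemma cellDim_cell (x : Fin (n + 1) → ℝ) :
    cellDim (cell B x) + 1 = Nat.card (Quotient (blk B x)) := by
  rw [cellDim, cellSpan_cell, finrank_constOn]

/-! ### Local structure of a plane set -/

/-- The properties of a set `L` of homogeneous coordinates from which it follows that `L` is a
tropical plane: it is a union of faces of the arrangement, it is tropically convex, it has no
point with four pairwise untied coordinates, and it contains points two prescribed coordinates of
which are arbitrarily low, some other coordinate being bounded below. -/
structure IsPlaneSet (B : ℕ) (L : Set (Fin (n + 1) → ℝ)) : Prop where
  spec : ∀ {x y}, x ∈ L → Spec B x y → y ∈ L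
  sup : ∀ {x y}, x ∈ L → y ∈ L → x ⊔ y ∈ L
  four : ∀ {x}, x ∈ L → ∀ i j k l, ¬ Tie B x i j → ¬ Tie B x i k → ¬ Tie B x i l →
    ¬ Tie B x j k → ¬ Tie B x j l → ¬ Tie B x k l → False
  low : ∀ e f, ∃ k, ∃ b : ℝ, ∀ Q : ℝ, ∃ z ∈ L, z e ≤ Q ∧ z f ≤ Q ∧ b ≤ z k

/-- The indicator function of a set of coordinates. -/
def ind (A : Finset (Fin (n + 1))) : Fin (n + 1) → ℝ := fun i => if i ∈ A then 1 else 0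

lemma ind_of_mem {A : Finset (Fin (n + 1))} {i : Fin (n + 1)} (h : i ∈ A) : ind A i = 1 :=
  if_pos h

lemma ind_of_notMem {A : Finset (Fin (n + 1))} {i : Fin (n + 1)} (h : i ∉ A) : ind A i = 0 :=
  if_neg h

/-- The set `L` contains the points close to `x` in the direction `w`. -/
def Germ (L : Set (Fin (n + 1) → ℝ)) (x w : Fin (n + 1) → ℝ) : Prop :=
  ∀ᶠ ε in 𝓝[>] (0 : ℝ), x + ε • w ∈ L

lemma Germ.sup {L : Set (Fin (n + 1) → ℝ)} (hL : IsPlaneSet B L) {x w w' : Fin (n + 1) → ℝ}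
    (h : Germ L x w) (h' : Germ L x w') : Germ L x (w ⊔ w') := by
  filter_upwards [h, h', eventually_mem_nhdsWithin] with ε h1 h2 h3
  have : x + ε • (w ⊔ w') = (x + ε • w) ⊔ (x + ε • w') := by
    ext i
    simp only [Pi.add_apply, Pi.smul_apply, Pi.sup_apply, smul_eq_mul]
    rw [mul_max_of_nonneg _ _ (le_of_lt h3), max_add_add_left]
  rw [this]
  exact hL.sup h1 h2

/-- Only the order of the coordinates of `w` along ties of `x` matters, so a direction may be
rescaled or shifted by constants on blocks. -/
lemma Germ.congr {L : Set (Fin (n + 1) → ℝ)} (hL : IsPlaneSet B L) {x w w' : Fin (n + 1) → ℝ}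
    (h : Germ L x w) (hw : ∀ a b, Tie B x a b → w a ≤ w b → w' a ≤ w' b) : Germ L x w' := by
  obtain ⟨ε, h1, h2⟩ := (h.and (eventually_small (B := B) x w)).exists
  filter_upwards [eventually_small (B := B) x w'] with ε' h'
  exact hL.spec h1 (h2.spec h' hw)

lemma germ_zero {L : Set (Fin (n + 1) → ℝ)} {x : Fin (n + 1) → ℝ} (hx : x ∈ L) : Germ L x 0 := by
  simp [Germ, hx]

lemma Germ.four {L : Set (Fin (n + 1) → ℝ)} (hL : IsPlaneSet B L) {x w : Fin (n + 1) → ℝ}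
    (h : Germ L x w) (i j k l : Fin (n + 1)) (hij : blk B x i j → w i ≠ w j)
    (hik : blk B x i k → w i ≠ w k) (hil : blk B x i l → w i ≠ w l)
    (hjk : blk B x j k → w j ≠ w k) (hjl : blk B x j l → w j ≠ w l)
    (hkl : blk B x k l → w k ≠ w l) : False := by
  obtain ⟨ε, h1, h2⟩ := (h.and (eventually_small (B := B) x w)).exists
  have key : ∀ {a b}, (blk B x a b → w a ≠ w b) → ¬ Tie B (x + ε • w) a b := fun hab ht =>
    hab (h2.tie ht).1.blk (h2.tie ht).2
  exact hL.four h1 i j k l (key hij) (key hik) (key hil) (key hjk) (key hjl) (key hkl)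

/-- A point of `L` that is not the maximum of `L` can be raised along some coordinates. -/
lemma exists_raise {L : Set (Fin (n + 1) → ℝ)} (hL : IsPlaneSet B L) {x z : Fin (n + 1) → ℝ}
    (hx : x ∈ L) (hz : z ∈ L) {k : Fin (n + 1)} (hk : x k < z k) :
    ∃ K : Finset (Fin (n + 1)), K.Nonempty ∧ (∀ i ∈ K, x i < z i) ∧ Germ L x (ind K) := by
  classical
  obtain ⟨i₀, -, hi₀⟩ := Finset.exists_max_image Finset.univ (fun i => z i - x i) ⟨k, by simp⟩
  set M := z i₀ - x i₀ with hM
  have hMpos : 0 < M := lt_of_lt_of_le (sub_pos.2 hk) (hi₀ k (by simp))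
  refine ⟨Finset.univ.filter fun i => z i - x i = M, ⟨i₀, by simp [hM]⟩, ?_, ?_⟩
  · intro i hi
    have : z i - x i = M := by simpa using hi
    linarith
  · have h1 : ∀ᶠ ε in 𝓝[>] (0 : ℝ), ∀ i, z i - x i < M → ε < M - (z i - x i) := by
      refine eventually_all.2 fun i => ?_
      by_cases h : z i - x i < M
      · filter_upwards [Ioo_mem_nhdsGT (sub_pos.2 h)] with ε hε _ using hε.2
      · simp [h]
    filter_upwards [h1, eventually_mem_nhdsWithin] with ε h2 h3
    have h3 : 0 < ε := h3
    -- Translated down this far, `z` exceeds `x` only where `z - x` is maximal, and by exactly `ε`.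
    -- Taking the supremum with `x` raises these coordinates and no others.
    have h4 : (fun i => z i - M + ε) ∈ L := hL.spec hz (Spec.of_sub_eq fun a b => by ring)
    convert hL.sup hx h4 using 1
    ext i
    simp only [Pi.add_apply, Pi.smul_apply, smul_eq_mul, Pi.sup_apply]
    by_cases h : z i - x i = M
    · rw [ind_of_mem (by simpa using h), max_eq_right] <;> linarith
    · rw [ind_of_notMem (by simpa using h), max_eq_left]
      · simp
      · linarith [h2 i (lt_of_le_of_ne (hi₀ i (by simp)) h)]

lemma exists_raise_off {L : Set (Fin (n + 1) → ℝ)} (hL : IsPlaneSet B L)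
    (x : Fin (n + 1) → ℝ) (e f : Fin (n + 1)) :
    ∃ z ∈ L, z e ≤ x e ∧ z f ≤ x f ∧ ∃ k, x k < z k := by
  obtain ⟨k, b, hb⟩ := hL.low e f
  obtain ⟨z, hz, h1, h2, h3⟩ := hb (min (x e) (x f) - (x k - b + 1))
  refine ⟨fun i => z i + (x k - b + 1), hL.spec hz (Spec.of_sub_eq fun a b => by ring), ?_, ?_, k,
    ?_⟩
  · linarith [min_le_left (x e) (x f)]
  · linarith [min_le_right (x e) (x f)]
  · linarith [h3]

/-- This is the form in which the axiom `low` is used: no two coordinates can obstruct raising a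
point within `L`. -/
lemma exists_germ_off {L : Set (Fin (n + 1) → ℝ)} (hL : IsPlaneSet B L)
    {x : Fin (n + 1) → ℝ} (hx : x ∈ L) (e f : Fin (n + 1)) :
    ∃ K : Finset (Fin (n + 1)), K.Nonempty ∧ e ∉ K ∧ f ∉ K ∧ Germ L x (ind K) := by
  obtain ⟨z, hz, he, hf, k, hk⟩ := exists_raise_off hL x e f
  obtain ⟨K, hK, h1, h2⟩ := exists_raise hL hx hz hk
  exact ⟨K, hK, fun h => absurd (h1 e h) (not_lt.2 he), fun h => absurd (h1 f h) (not_lt.2 hf), h2⟩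

lemma card_quotient_lt {α : Type*} [Finite α] {r s : Setoid α} (h : ∀ a b, r a b → s a b) {a b : α}
    (hs : s a b) (hr : ¬ r a b) : Nat.card (Quotient s) < Nat.card (Quotient r) := by
  let f : Quotient r → Quotient s := Quotient.map id h
  have hf : Function.Surjective f := fun q => by
    induction q using Quotient.inductionOn with
    | h i => exact ⟨Quotient.mk r i, rfl⟩
  by_contra hle
  have hb := (Nat.bijective_iff_surjective_and_card f).2
    ⟨hf, le_antisymm (not_lt.1 hle) (Nat.card_le_card_of_surjective f hf)⟩
  exact hr (Quotient.exact (hb.1 (Quotient.sound hs : f (Quotient.mk r a) = f (Quotient.mk r b))))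

lemma card_quotient_le {α : Type*} [Finite α] {r s : Setoid α} (h : ∀ a b, r a b → s a b) :
    Nat.card (Quotient s) ≤ Nat.card (Quotient r) := by
  refine Nat.card_le_card_of_surjective (Quotient.map id h) fun q => ?_
  induction q using Quotient.inductionOn with
  | h i => exact ⟨Quotient.mk r i, rfl⟩

/-- If a setoid has more than `k` classes, then any `k` elements miss a class. -/
lemma exists_not_rel {α : Type*} [Finite α] (r : Setoid α) (S : Finset α)
    (h : S.card < Nat.card (Quotient r)) : ∃ i, ∀ j ∈ S, ¬ r i j := by
  classical
  have : Fintype (Quotient r) := Fintype.ofFinite _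
  rw [Nat.card_eq_fintype_card] at h
  obtain ⟨q, hq⟩ : ∃ q, q ∉ S.image (Quotient.mk r) := by
    by_contra! hcon
    have := Finset.card_le_card (fun q _ => hcon q : Finset.univ ⊆ S.image (Quotient.mk r))
    have := this.trans Finset.card_image_le
    rw [Finset.card_univ] at this
    omega
  induction q using Quotient.inductionOn with
  | h i =>
    exact ⟨i, fun j hj hij => hq (Finset.mem_image.2 ⟨j, hj, (Quotient.sound hij).symm⟩)⟩

lemma card_blk_le {L : Set (Fin (n + 1) → ℝ)} (hL : IsPlaneSet B L) {x : Fin (n + 1) → ℝ}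
    (hx : x ∈ L) : Nat.card (Quotient (blk B x)) ≤ 3 := by
  classical
  by_contra! h
  obtain ⟨i, -⟩ := exists_not_rel (blk B x) ∅ (by rw [Finset.card_empty]; omega)
  obtain ⟨j, hj⟩ := exists_not_rel (blk B x) {i} (by rw [Finset.card_singleton]; omega)
  obtain ⟨k, hk⟩ := exists_not_rel (blk B x) {i, j} (lt_of_le_of_lt Finset.card_le_two (by omega))
  obtain ⟨l, hl⟩ := exists_not_rel (blk B x) {i, j, k}
    (lt_of_le_of_lt Finset.card_le_three (by omega))
  simp only [Finset.mem_insert, Finset.mem_singleton, forall_eq_or_imp, forall_eq] at hj hk hl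
  exact hL.four hx l k j i (fun h => hl.2.2 h.blk) (fun h => hl.2.1 h.blk) (fun h => hl.1 h.blk)
    (fun h => hk.2 h.blk) (fun h => hk.1 h.blk) (fun h => hj h.blk)

lemma three_le_card_quotient {α : Type*} [Finite α] {r : Setoid α} {a b c : α} (hab : ¬ r a b)
    (hac : ¬ r a c) (hbc : ¬ r b c) : 3 ≤ Nat.card (Quotient r) := by
  have h0 : Function.Injective ![Quotient.mk r a, Quotient.mk r b, Quotient.mk r c] := by
    have h1 : Quotient.mk r a ≠ Quotient.mk r b := fun h => hab (Quotient.exact h)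
    have h2 : Quotient.mk r a ≠ Quotient.mk r c := fun h => hac (Quotient.exact h)
    have h3 : Quotient.mk r b ≠ Quotient.mk r c := fun h => hbc (Quotient.exact h)
    intro i j hij
    fin_cases i <;> fin_cases j <;> simp_all
  have := Nat.card_le_card_of_injective _ h0
  rwa [Nat.card_fin] at this

/-- If a setoid has at most two classes, these are the classes of some `e` and `f`. -/
lemma exists_pair_rel {α : Type*} [Finite α] [Nonempty α] (r : Setoid α)
    (h : Nat.card (Quotient r) ≤ 2) : ∃ e f, ∀ i, r i e ∨ r i f := by
  classical
  let e := Classical.arbitrary α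
  by_cases h1 : ∃ f, ¬ r f e
  · obtain ⟨f, hf⟩ := h1
    refine ⟨e, f, fun i => ?_⟩
    by_contra! hi
    have := three_le_card_quotient (fun h => hf (r.symm h)) (fun h => hi.1 (r.symm h))
      (fun h => hi.2 (r.symm h))
    omega
  · push Not at h1
    exact ⟨e, e, fun i => Or.inl (h1 i)⟩

/-- This gives purity. If there are at most two blocks, two coordinates `e`, `f` meet all of them;
raising a set that avoids both separates a part of some block from the rest. -/
lemma exists_spec_card_three {L : Set (Fin (n + 1) → ℝ)} (hL : IsPlaneSet B L)
    {x : Fin (n + 1) → ℝ} (hx : x ∈ L) :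
    ∃ y ∈ L, Spec B y x ∧ Nat.card (Quotient (blk B y)) = 3 := by
  obtain ⟨k, hk⟩ : ∃ k, 3 - Nat.card (Quotient (blk B x)) = k := ⟨_, rfl⟩
  induction k using Nat.strong_induction_on generalizing x with
  | _ k ih =>
    rcases (card_blk_le hL hx).lt_or_eq with hlt | heq
    · obtain ⟨e, f, hef⟩ := exists_pair_rel (blk B x) (by omega)
      obtain ⟨K, ⟨a, ha⟩, he, hf, hg⟩ := exists_germ_off hL hx e f
      obtain ⟨ε, h1, h2⟩ := (hg.and (eventually_small (B := B) x (ind K))).exists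
      have h3 : Nat.card (Quotient (blk B x)) < Nat.card (Quotient (blk B (x + ε • ind K))) := by
        have hne : ∀ b, b ∉ K → ¬ blk B (x + ε • ind K) a b := fun b hb hab => by
          have := (h2.blk hab).2
          rw [ind_of_mem ha, ind_of_notMem hb] at this
          exact one_ne_zero this
        rcases hef a with h | h
        · exact card_quotient_lt (fun _ _ h => (h2.blk h).1) h (hne _ he)
        · exact card_quotient_lt (fun _ _ h => (h2.blk h).1) h (hne _ hf)
      obtain ⟨y, hy, hs, hc⟩ := ih _ (by omega) h1 rfl
      exact ⟨y, hy, hs.trans h2.spec_base, hc⟩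
    · exact ⟨x, hx, Spec.refl x, heq⟩

/-- `A` is a nonempty proper part of a block of `x`, and lowering the coordinates in `A` gives
points of `L`. -/
structure Split (B : ℕ) (L : Set (Fin (n + 1) → ℝ)) (x : Fin (n + 1) → ℝ)
    (A : Finset (Fin (n + 1))) (i₀ j₀ : Fin (n + 1)) : Prop where
  mem : i₀ ∈ A
  notMem : j₀ ∉ A
  rel : ∀ i ∈ A, blk B x i i₀
  rel' : blk B x j₀ i₀
  germ : Germ L x (-ind A)

/-- The blocks after the motion are `A`, the rest of the block of `A`, and the other block of `x`.
Any further division would produce four pairwise untied coordinates. -/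
lemma Split.card {L : Set (Fin (n + 1) → ℝ)} (hL : IsPlaneSet B L) {x : Fin (n + 1) → ℝ}
    (hc : Nat.card (Quotient (blk B x)) = 2) {A : Finset (Fin (n + 1))} {i₀ j₀ : Fin (n + 1)}
    (h : Split B L x A i₀ j₀) :
    ∀ᶠ ε in 𝓝[>] (0 : ℝ), x + ε • (-ind A) ∈ L ∧ Small B x (-ind A) ε ∧
      Nat.card (Quotient (blk B (x + ε • (-ind A)))) = 3 ∧
      ∀ i j, blk B (x + ε • (-ind A)) i j ↔ blk B x i j ∧ (i ∈ A ↔ j ∈ A) := by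
  filter_upwards [h.germ, eventually_small (B := B) x (-ind A)] with ε h1 h2
  have hne : ∀ i j, blk B (x + ε • (-ind A)) i j → (i ∈ A ↔ j ∈ A) := fun i j hij => by
    have := (h2.blk hij).2
    simp only [Pi.neg_apply, ind] at this
    by_cases hi : i ∈ A <;> by_cases hj : j ∈ A <;> simp_all
  have h3 : ¬ blk B (x + ε • (-ind A)) j₀ i₀ := fun hb => h.notMem ((hne _ _ hb).2 h.mem)
  have h4 := card_quotient_lt (fun _ _ h => (h2.blk h).1) h.rel' h3
  have h5 := card_blk_le hL h1
  refine ⟨h1, h2, by omega, fun i j => ⟨fun hij => ⟨(h2.blk hij).1, hne i j hij⟩, ?_⟩⟩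
  rintro ⟨hij, hA⟩
  by_contra hcon
  obtain ⟨t, ht⟩ := exists_not_rel (blk B x) {i₀} (by rw [hc, Finset.card_singleton]; norm_num)
  simp only [Finset.mem_singleton, forall_eq] at ht
  have key : ∀ k l, ¬ blk B (x + ε • (-ind A)) i k → ¬ blk B (x + ε • (-ind A)) i l →
      ¬ blk B (x + ε • (-ind A)) j k → ¬ blk B (x + ε • (-ind A)) j l →
      ¬ blk B (x + ε • (-ind A)) k l → False := fun k l h6 h7 h8 h9 h10 =>
    hL.four h1 i j k l (fun h => hcon h.blk) (fun h => h6 h.blk) (fun h => h7 h.blk)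
      (fun h => h8 h.blk) (fun h => h9 h.blk) (fun h => h10 h.blk)
  have hnot : ∀ {a b}, ¬ blk B x a b → ¬ blk B (x + ε • (-ind A)) a b := fun hab h =>
    hab (h2.blk h).1
  by_cases hi : i ∈ A
  · have hi' := h.rel i hi
    have hj' := h.rel j (hA.1 hi)
    exact key j₀ t (fun h' => h.notMem ((hne _ _ h').1 hi))
      (hnot fun h' => ht ((blk B x).trans ((blk B x).symm h') hi'))
      (fun h' => h.notMem ((hne _ _ h').1 (hA.1 hi)))
      (hnot fun h' => ht ((blk B x).trans ((blk B x).symm h') hj'))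
      (hnot fun h' => ht ((blk B x).trans ((blk B x).symm h') h.rel'))
  · have hj : j ∉ A := fun h' => hi (hA.2 h')
    by_cases hb : blk B x i i₀
    · exact key i₀ t (fun h' => hi ((hne _ _ h').2 h.mem))
        (hnot fun h' => ht ((blk B x).trans ((blk B x).symm h') hb))
        (fun h' => hj ((hne _ _ h').2 h.mem))
        (hnot fun h' => ht ((blk B x).trans ((blk B x).symm h')
          ((blk B x).trans ((blk B x).symm hij) hb)))
        (hnot fun h' => ht ((blk B x).symm h'))
    · have hb' : ¬ blk B x j i₀ := fun h' => hb ((blk B x).trans hij h')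
      exact key i₀ j₀ (hnot hb) (hnot fun h' => hb ((blk B x).trans h' h.rel')) (hnot hb')
        (hnot fun h' => hb' ((blk B x).trans h' h.rel')) (fun h' => h3 ((blk B _).symm h'))

/-- Every facet containing the cell of `x` comes from a splitting. -/
lemma exists_split_of_facet {L : Set (Fin (n + 1) → ℝ)} (hL : IsPlaneSet B L)
    {x y : Fin (n + 1) → ℝ} (hc : Nat.card (Quotient (blk B x)) = 2)
    (hy : y ∈ L) (hyx : Spec B y x) (hcy : Nat.card (Quotient (blk B y)) = 3) :
    ∃ A i₀ j₀, Split B L x A i₀ j₀ ∧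
      ∀ᶠ ε in 𝓝[>] (0 : ℝ), cell B (x + ε • (-ind A)) = cell B y := by
  classical
  obtain ⟨a, b, htab, hab⟩ : ∃ a b, Tie B x a b ∧ ¬ blk B y a b := by
    by_contra! h
    have := card_quotient_le (r := blk B x) (s := blk B y) (fun a b hab => blk_induction h hab)
    omega
  set w : Fin (n + 1) → ℝ := y - x with hw
  have hwt : ∀ i j, Tie B y i j → w i = w j := fun i j h => by
    have := hyx.tie_sub h
    simp only [hw, Pi.sub_apply]; linarith
  have hwb : ∀ {i j}, blk B y i j → w i = w j := fun h => blk_const hwt h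
  have hne : w a ≠ w b := by
    intro h
    obtain ⟨c, hc, e⟩ := htab
    refine hab (Tie.blk ⟨c, hc, ?_⟩)
    simp only [hw, Pi.sub_apply] at h; linarith
  wlog hlt : w a < w b generalizing a b
  · refine this b a ?_ (fun h => hab ((blk B y).symm h)) hne.symm
      (lt_of_le_of_ne (not_lt.1 hlt) hne.symm)
    obtain ⟨c, hc, e⟩ := htab
    exact ⟨-c, by simpa using hc, by push_cast; linarith⟩
  obtain ⟨t, ht⟩ := exists_not_rel (blk B x) {a} (by rw [hc, Finset.card_singleton]; norm_num)
  simp only [Finset.mem_singleton, forall_eq] at ht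
  have hbx : blk B x b a := (blk B x).symm htab.blk
  have hcover : ∀ i, blk B y i a ∨ blk B y i b ∨ blk B y i t := by
    intro i
    by_contra! h
    exact hL.four hy i a b t (fun h' => h.1 h'.blk) (fun h' => h.2.1 h'.blk)
      (fun h' => h.2.2 h'.blk) (fun h' => hab h'.blk)
      (fun h' => ht ((blk B x).symm (hyx.blk h'.blk)))
      (fun h' => ht ((blk B x).trans ((blk B x).symm (hyx.blk h'.blk)) hbx))
  have hor : ∀ i, blk B x i a → blk B y i a ∨ blk B y i b := by
    intro i hi
    rcases hcover i with h | h | h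
    · exact Or.inl h
    · exact Or.inr h
    · exact absurd ((blk B x).trans ((blk B x).symm (hyx.blk h)) hi) ht
  -- The block of `x` containing `a` and `b` consists of the two `y`-blocks of `a` and `b`. Along
  -- ties of `x`, the motion `w` orders coordinates exactly as `-ind A` does, so both motions lead
  -- to the same cell.
  set A : Finset (Fin (n + 1)) := Finset.univ.filter fun i => blk B y i a with hA
  have hmem : ∀ {i}, i ∈ A ↔ blk B y i a := by simp [hA]
  have hbA : b ∉ A := fun h => hab ((blk B y).symm (hmem.1 h))
  have h1 : ∀ i j, Tie B x i j → w i ≤ w j → (-ind A) i ≤ (-ind A) j := by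
    intro i j hij hle
    simp only [Pi.neg_apply, neg_le_neg_iff]
    by_cases hj : j ∈ A
    · have hi : i ∈ A := by
        rw [hmem]
        refine (hor i ((blk B x).trans hij.blk (hyx.blk (hmem.1 hj)))).resolve_right fun h => ?_
        rw [hwb h, hwb (hmem.1 hj)] at hle
        exact absurd hlt (not_lt.2 hle)
      rw [ind_of_mem hi, ind_of_mem hj]
    · rw [ind_of_notMem hj]
      unfold ind; split_ifs <;> norm_num
  have h2 : ∀ i j, Tie B x i j → (-ind A) i ≤ (-ind A) j → w i ≤ w j := by
    intro i j hij hle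
    by_cases hi : blk B x i a
    · have hj : blk B x j a := (blk B x).trans ((blk B x).symm hij.blk) hi
      rcases hor i hi with hi' | hi' <;> rcases hor j hj with hj' | hj'
      · rw [hwb hi', hwb hj']
      · rw [hwb hi', hwb hj']; exact hlt.le
      · have : i ∉ A := fun h => hab ((blk B y).trans ((blk B y).symm (hmem.1 h)) hi')
        simp only [Pi.neg_apply, ind_of_mem (hmem.2 hj'), ind_of_notMem this] at hle
        norm_num at hle
      · rw [hwb hi', hwb hj']
    · have hj : ¬ blk B x j a := fun h => hi ((blk B x).trans hij.blk h)
      have : ∀ k, ¬ blk B x k a → blk B y k t := fun k hk => by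
        rcases hcover k with h | h | h
        · exact absurd (hyx.blk h) hk
        · exact absurd ((blk B x).trans (hyx.blk h) hbx) hk
        · exact h
      rw [hwb (this i hi), hwb (this j hj)]
  have h3 : ∀ᶠ ε in 𝓝[>] (0 : ℝ), Spec B y (x + ε • w) ∧ Spec B (x + ε • w) y := by
    filter_upwards [Ioo_mem_nhdsGT one_pos] with ε hε
    refine ⟨Spec.combo hyx (Spec.refl y) hε.1.le hε.2.le, fun i j c hcB hle => ?_⟩
    by_contra! hgt
    have := hyx.ge hcB hgt.le
    simp only [hw, Pi.add_apply, Pi.smul_apply, Pi.sub_apply, smul_eq_mul] at hle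
    nlinarith [hε.1, hε.2]
  have hg : Germ L x w := by
    filter_upwards [h3] with ε hε using hL.spec hy hε.1
  refine ⟨A, a, b, ⟨hmem.2 ((blk B y).refl a), hbA, fun i hi => hyx.blk (hmem.1 hi), hbx,
    hg.congr hL h1⟩, ?_⟩
  obtain ⟨ε', ⟨h4, h5⟩, h6⟩ := (h3.and (eventually_small (B := B) x w)).exists
  filter_upwards [eventually_small (B := B) x (-ind A)] with ε h7
  exact cell_congr ((h7.spec h6 h2).trans h5) (h4.trans (h6.spec h7 h1))

lemma germ_const {L : Set (Fin (n + 1) → ℝ)} (hL : IsPlaneSet B L) {x : Fin (n + 1) → ℝ}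
    (hx : x ∈ L) {w : Fin (n + 1) → ℝ} (hw : ∀ a b, Tie B x a b → w a = w b) : Germ L x w :=
  (germ_zero hx).congr hL fun a b hab _ => (hw a b hab).le

/-- Splittings take place in a single block. -/
lemma Split.rel_of_split {L : Set (Fin (n + 1) → ℝ)} (hL : IsPlaneSet B L)
    {x : Fin (n + 1) → ℝ}
    {A A' : Finset (Fin (n + 1))} {i₀ j₀ i₁ j₁ : Fin (n + 1)} (h : Split B L x A i₀ j₀)
    (h' : Split B L x A' i₁ j₁) : blk B x i₀ i₁ := by
  classical
  by_contra hcon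
  have hdisj : ∀ i, blk B x i i₀ → ¬ blk B x i i₁ := fun i hi hi' =>
    hcon ((blk B x).trans ((blk B x).symm hi) hi')
  let f : Fin (n + 1) → Fin (n + 1) → ℝ := fun k i => if blk B x i k then 2 else 0
  have hf : ∀ k a b, Tie B x a b → f k a = f k b := by
    intro k a b hab
    have : blk B x a k ↔ blk B x b k :=
      ⟨(blk B x).trans ((blk B x).symm hab.blk), (blk B x).trans hab.blk⟩
    simp only [f, this]
  -- Each direction is lowered by `2` on the block of the other splitting. The supremum is then
  -- `-ind A` on the first block and `-ind A'` on the second, and both blocks split at once.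
  have hg := (h.germ.congr hL (w' := -ind A - f i₁) (fun a b hab hle => by
      simp only [Pi.sub_apply, hf i₁ a b hab]; linarith)).sup hL
    (h'.germ.congr hL (w' := -ind A' - f i₀) (fun a b hab hle => by
      simp only [Pi.sub_apply, hf i₀ a b hab]; linarith))
  have hi₁ : i₁ ∉ A := fun hA => hcon ((blk B x).symm (h.rel _ hA))
  have hj₁ : j₁ ∉ A := fun hA => hdisj _ (h.rel _ hA) h'.rel'
  have hi₀ : i₀ ∉ A' := fun hA => hcon (h'.rel _ hA)
  have hj₀ : j₀ ∉ A' := fun hA => hdisj _ h.rel' (h'.rel _ hA)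
  have r0 : ¬ blk B x i₀ i₁ := hcon
  have r1 : ¬ blk B x i₁ i₀ := fun hh => hcon ((blk B x).symm hh)
  have r2 : ¬ blk B x j₀ i₁ := hdisj _ h.rel'
  have r3 : ¬ blk B x j₁ i₀ := fun hh => hdisj _ hh h'.rel'
  refine hg.four hL i₀ j₀ i₁ j₁ (fun _ => ?_) (fun hh => absurd hh r0) (fun hh => ?_)
    (fun hh => absurd hh r2) (fun hh => ?_) (fun _ => ?_)
  · simp [f, ind, h.mem, h.notMem, hi₀, hj₀, r0, r2, h.rel']
  · exact absurd ((blk B x).trans hh h'.rel') r0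
  · exact absurd ((blk B x).trans hh h'.rel') r2
  · simp [f, ind, h'.mem, h'.notMem, hi₁, hj₁, r1, r3, h'.rel']

/-- Two splittings with a common element are equal. -/
lemma Split.eq_of_mem {L : Set (Fin (n + 1) → ℝ)} (hL : IsPlaneSet B L) {x : Fin (n + 1) → ℝ}
    (hc : Nat.card (Quotient (blk B x)) = 2)
    {A A' : Finset (Fin (n + 1))} {i₀ j₀ i₁ j₁ : Fin (n + 1)} (h : Split B L x A i₀ j₀)
    (h' : Split B L x A' i₁ j₁) {i : Fin (n + 1)} (hi : i ∈ A) (hi' : i ∈ A') : A = A' := by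
  classical
  suffices key : ∀ {A A' : Finset (Fin (n + 1))} {i₀ j₀ i₁ j₁ : Fin (n + 1)},
      Split B L x A i₀ j₀ → Split B L x A' i₁ j₁ → i ∈ A → i ∈ A' → A ⊆ A' from
    (key h h' hi hi').antisymm (key h' h hi' hi)
  intro A A' i₀ j₀ i₁ j₁ h h' hi hi' k hk
  by_contra hk'
  have h1 := h.germ.sup hL h'.germ
  obtain ⟨t, ht⟩ := exists_not_rel (blk B x) {i₀} (by rw [hc, Finset.card_singleton]; norm_num)
  simp only [Finset.mem_singleton, forall_eq] at ht
  -- lower `A` once and `A ∩ A'` once more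
  have h4 : Germ L x ((fun i => 2 * (-ind A) i) ⊔ (fun i => ((-ind A) ⊔ (-ind A')) i - 1)) :=
    (h.germ.congr hL (w' := fun i => 2 * (-ind A) i) fun a b _ hle => by linarith).sup hL
      (h1.congr hL fun a b _ hle => by linarith)
  have hij := h.rel i hi
  have hkj := h.rel k hk
  refine h4.four hL i k j₀ t (fun _ => ?_) (fun _ => ?_)
    (fun hh => absurd ((blk B x).trans ((blk B x).symm hh) hij) ht) (fun _ => ?_)
    (fun hh => absurd ((blk B x).trans ((blk B x).symm hh) hkj) ht)
    (fun hh => absurd ((blk B x).trans ((blk B x).symm hh) h.rel') ht)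
  · simp [ind, hi, hi', hk, hk']
    norm_num
  · simp [ind, hi, hi', h.notMem]
    split_ifs <;> norm_num
  · simp [ind, hk, hk', h.notMem]
    split_ifs <;> norm_num

/-- By `Split.rel_of_split` only one of the two blocks can be split. Applying `exists_germ_off` to
an element of each block shows that every element of the splitting block lies in some part. -/
lemma exists_split {L : Set (Fin (n + 1) → ℝ)} (hL : IsPlaneSet B L)
    {x : Fin (n + 1) → ℝ} (hx : x ∈ L) (hc : Nat.card (Quotient (blk B x)) = 2) :
    ∃ r, ∀ j, (blk B x j r → ∃ A i₀ j₀, Split B L x A i₀ j₀ ∧ j ∈ A) ∧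
      (¬ blk B x j r → ∀ A i₀ j₀, Split B L x A i₀ j₀ → j ∉ A) := by
  classical
  have step : ∀ s t, ¬ blk B x s t → (∃ A j₀, Split B L x A s j₀) ∨
      ∃ A j₀, Split B L x A t j₀ := by
    intro s t hst
    obtain ⟨K, ⟨k, hk⟩, hs, ht, hg⟩ := exists_germ_off hL hx s t
    have key : ∀ u, u ∉ K → blk B x k u → ∃ A j₀, Split B L x A u j₀ := by
      intro u hu hku
      refine ⟨Finset.univ.filter fun i => blk B x i u ∧ i ∉ K, k, ?_, ?_, ?_, hku, ?_⟩
      · simp [hu]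
      · simp [hk]
      · intro i hi
        simp only [Finset.mem_filter, Finset.mem_univ, true_and] at hi
        exact hi.1
      -- Shifting all coordinates, or a whole block, leaves the germs at `x` in `L`. Off the block
      -- of `u` the second direction dominates with value `0`; on it the first one does, with value
      -- `-1` exactly off `K`.
      · have h1 : Germ L x (fun i => ind K i - 1) := hg.congr hL fun a b _ hle => by linarith
        have h2 : Germ L x (fun i => if blk B x i u then (-1 : ℝ) else 0) := by
          refine germ_const hL hx fun a b hab => ?_
          have : blk B x a u ↔ blk B x b u :=
            ⟨(blk B x).trans ((blk B x).symm hab.blk), (blk B x).trans hab.blk⟩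
          simp only [this]
        convert h1.sup hL h2 using 1
        ext i
        simp only [Pi.neg_apply, Pi.sup_apply, ind, Finset.mem_filter, Finset.mem_univ, true_and]
        by_cases h3 : blk B x i u <;> by_cases h4 : i ∈ K <;> simp [h3, h4]
    have : blk B x k s ∨ blk B x k t := by
      by_contra! hcon
      have := three_le_card_quotient hst (fun h => hcon.1 ((blk B x).symm h))
        (fun h => hcon.2 ((blk B x).symm h))
      omega
    exact this.imp (key s hs) (key t ht)
  have other : ∀ s, ∃ t, ¬ blk B x s t := fun s => by
    obtain ⟨t, ht⟩ := exists_not_rel (blk B x) {s} (by rw [hc, Finset.card_singleton]; norm_num)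
    simp only [Finset.mem_singleton, forall_eq] at ht
    exact ⟨t, fun h => ht ((blk B x).symm h)⟩
  obtain ⟨r, A₀, k₀, hr⟩ : ∃ r A₀ k₀, Split B L x A₀ r k₀ := by
    obtain ⟨t, ht⟩ := other 0
    rcases step 0 t ht with ⟨A, j, h⟩ | ⟨A, j, h⟩
    · exact ⟨_, A, j, h⟩
    · exact ⟨_, A, j, h⟩
  have hno : ∀ j, ¬ blk B x j r → ∀ A i₀ j₀, Split B L x A i₀ j₀ → j ∉ A :=
    fun j hj A i₀ j₀ h hjA =>
      hj ((blk B x).trans (h.rel j hjA) (h.rel_of_split hL hr))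
  refine ⟨r, fun j => ⟨fun hj => ?_, hno j⟩⟩
  obtain ⟨t, ht⟩ := other j
  rcases step j t ht with ⟨A, k, h⟩ | ⟨A, k, h⟩
  · exact ⟨A, j, k, h, h.mem⟩
  · exact absurd h.mem (hno t (fun h' => ht ((blk B x).trans hj ((blk B x).symm h'))) A t k h)

lemma hat_intCast (z : Fin n → ℤ) (i : Fin (n + 1)) :
    hat (intCast z) i = ((Fin.cons 0 z : Fin (n + 1) → ℤ) i : ℝ) := by
  cases i using Fin.cases <;> simp [intCast]

lemma mem_latticeOf {W : Submodule ℝ (Fin n → ℝ)} {z : Fin n → ℤ} :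
    z ∈ latticeOf W ↔ intCast z ∈ W := Iff.rfl

/-- The integer direction obtained by lowering the homogeneous coordinates in `A`. -/
def zdir (A : Finset (Fin (n + 1))) : Fin n → ℤ :=
  fun j => (if 0 ∈ A then 1 else 0) - (if j.succ ∈ A then 1 else 0)

lemma hat_zdir (A : Finset (Fin (n + 1))) (i : Fin (n + 1)) :
    hat (intCast (zdir A)) i = ind A 0 - ind A i := by
  cases i using Fin.cases <;> simp [intCast, zdir, ind]

/-- A lattice vector of the facet takes one value on `A` and one on the rest of the block. Since
`zdir A` separates these by exactly `1`, an integer multiple of it equalizes them. -/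
lemma Split.isPrimitiveNormal {L : Set (Fin (n + 1) → ℝ)} (hL : IsPlaneSet B L)
    {x : Fin (n + 1) → ℝ} (hc : Nat.card (Quotient (blk B x)) = 2) {A : Finset (Fin (n + 1))}
    {i₀ j₀ : Fin (n + 1)} (h : Split B L x A i₀ j₀) {F : Set (Fin n → ℝ)}
    (hF : ∀ᶠ ε in 𝓝[>] (0 : ℝ), cell B (x + ε • (-ind A)) = F) :
    IsPrimitiveNormal (cell B x) F (zdir A) := by
  obtain ⟨ε, ⟨-, hε, -, hblk⟩, rfl⟩ := ((h.card hL hc).and hF).exists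
  refine ⟨?_, ?_, dehom x, dehom_mem_cell.2 (Spec.refl x), ε, hε.1, ?_⟩
  · rw [cellSpan_cell]
    intro hcon
    have := hcon _ _ h.rel'
    rw [hat_zdir, hat_zdir, ind_of_mem h.mem, ind_of_notMem h.notMem] at this
    linarith
  · rw [cellSpan_cell, cellSpan_cell]
    ext w
    rw [AddSubgroup.mem_sup, mem_latticeOf, mem_constOn]
    constructor
    · intro hw
      set W : Fin (n + 1) → ℤ := Fin.cons 0 w with hW
      refine ⟨w - (W j₀ - W i₀) • zdir A, ?_, (W j₀ - W i₀) • zdir A,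
        AddSubgroup.mem_zmultiples_iff.2 ⟨_, rfl⟩, sub_add_cancel _ _⟩
      rw [mem_latticeOf, mem_constOn]
      have e : ∀ a, hat (intCast (w - (W j₀ - W i₀) • zdir A)) a
          = hat (intCast w) a - (hat (intCast w) j₀ - hat (intCast w) i₀) * (ind A 0 - ind A a) := by
        intro a
        have : intCast (w - (W j₀ - W i₀) • zdir A)
            = intCast w - ((W j₀ - W i₀ : ℤ) : ℝ) • intCast (zdir A) := by
          ext j; simp [intCast]
        rw [this, hat_sub, hat_smul, hat_zdir, hat_intCast, hat_intCast, hat_intCast]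
        push_cast
        ring
      have hin : ∀ a, blk B x a i₀ → hat (intCast w) a
          - (hat (intCast w) j₀ - hat (intCast w) i₀) * (ind A 0 - ind A a) =
          hat (intCast w) j₀ - (hat (intCast w) j₀ - hat (intCast w) i₀) * ind A 0 := by
        intro a ha
        by_cases haA : a ∈ A
        · rw [hw a i₀ ((hblk _ _).2 ⟨ha, by simp [haA, h.mem]⟩), ind_of_mem haA]
          ring
        · rw [hw a j₀ ((hblk _ _).2 ⟨(blk B x).trans ha ((blk B x).symm h.rel'), by
            simp [haA, h.notMem]⟩), ind_of_notMem haA]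
          ring
      intro a b hab
      rw [e, e]
      by_cases ha : blk B x a i₀
      · rw [hin a ha, hin b ((blk B x).trans ((blk B x).symm hab) ha)]
      · have haA : a ∉ A := fun h' => ha (h.rel a h')
        have hbA : b ∉ A := fun h' => ha ((blk B x).trans hab (h.rel b h'))
        rw [hw a b ((hblk _ _).2 ⟨hab, by simp [haA, hbA]⟩), ind_of_notMem haA,
          ind_of_notMem hbA]
    · rintro ⟨u, hu, v, hv, rfl⟩ a b hab
      obtain ⟨k, rfl⟩ := AddSubgroup.mem_zmultiples_iff.1 hv
      have e : intCast (u + k • zdir A) = intCast u + (k : ℝ) • intCast (zdir A) := by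
        ext j; simp [intCast]
      have hab' := (hblk _ _).1 hab
      have : ind A a = ind A b := by simp [ind, hab'.2]
      rw [e, hat_add, hat_add, hat_smul, hat_smul, hat_zdir, hat_zdir, this]
      exact congrArg (· + _) (hu a b hab'.1)
  · rw [mem_cell]
    refine Spec.of_sub_eq fun a b => ?_
    simp only [hat_add, hat_smul, hat_zdir, hat_dehom, Pi.add_apply, Pi.smul_apply, Pi.neg_apply,
      smul_eq_mul]
    ring

/-- The cell of a splitting determines the splitting. -/
lemma Split.mem_of_cell_eq {L : Set (Fin (n + 1) → ℝ)} {x : Fin (n + 1) → ℝ}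
    {A A' : Finset (Fin (n + 1))} {i₀ j₀ : Fin (n + 1)} (h : Split B L x A i₀ j₀) {ε ε' : ℝ}
    (hε : Small B x (-ind A) ε) (hε' : Small B x (-ind A') ε')
    (hcell : cell B (x + ε • (-ind A)) = cell B (x + ε' • (-ind A'))) {i : Fin (n + 1)}
    (hi : i ∈ A) : i ∈ A' := by
  have hs : ∀ a b, Tie B x a b → ind A b ≤ ind A a → ind A' b ≤ ind A' a := by
    rintro a b ⟨c, hc, e⟩ hle
    have h1 := cell_subset.1 hcell.ge a b c hc (by
      simp only [Pi.add_apply, Pi.smul_apply, Pi.neg_apply, smul_eq_mul]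
      nlinarith [hε.1])
    simp only [Pi.add_apply, Pi.smul_apply, Pi.neg_apply, smul_eq_mul] at h1
    have : ε' * ind A' b ≤ ε' * ind A' a := by linarith
    exact le_of_mul_le_mul_left this hε'.1
  have hs' : ∀ a b, Tie B x a b → ind A' b ≤ ind A' a → ind A b ≤ ind A a := by
    rintro a b ⟨c, hc, e⟩ hle
    have h1 := cell_subset.1 hcell.le a b c hc (by
      simp only [Pi.add_apply, Pi.smul_apply, Pi.neg_apply, smul_eq_mul]
      nlinarith [hε'.1])
    simp only [Pi.add_apply, Pi.smul_apply, Pi.neg_apply, smul_eq_mul] at h1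
    have : ε * ind A b ≤ ε * ind A a := by linarith
    exact le_of_mul_le_mul_left this hε.1
  have hconst : ∀ a b, Tie B x a b → ind A' a - ind A a = ind A' b - ind A b := by
    intro a b hab
    have hba : Tie B x b a := by
      obtain ⟨c, hc, e⟩ := hab
      exact ⟨-c, by simpa using hc, by push_cast; linarith⟩
    have h1 := hs a b hab
    have h2 := hs b a hba
    have h3 := hs' a b hab
    have h4 := hs' b a hba
    clear hs hs' hcell hε hε'
    by_cases p1 : a ∈ A <;> by_cases p2 : b ∈ A <;> by_cases p3 : a ∈ A' <;>
      by_cases p4 : b ∈ A' <;> simp only [ind, p1, p2, p3, p4, if_true, if_false] at h1 h2 h3 h4 ⊢ <;>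
      first
        | rfl
        | linarith only
        | linarith [h1 (by norm_num)]
        | linarith [h2 (by norm_num)]
        | linarith [h3 (by norm_num)]
        | linarith [h4 (by norm_num)]
  -- The difference of the indicators is constant on the block. It is nonnegative at `j₀`, which is
  -- not in `A`, but would be `-1` at an element of `A` missing from `A'`.
  have h1 := blk_const (w := fun a => ind A' a - ind A a) hconst h.rel'
  have h2 := blk_const (w := fun a => ind A' a - ind A a) hconst (h.rel i hi)
  by_contra hcon
  simp only [ind, h.mem, h.notMem, hi, hcon, if_true, if_false] at h1 h2
  split_ifs at h1 h2 <;> linarith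

/-! ### The tropical surface of a plane set -/

open Classical in
/-- The cells of the points of a set. -/
def cellsOf (B : ℕ) (L : Set (Fin (n + 1) → ℝ)) : Finset (Set (Fin n → ℝ)) :=
  ((finite_cells B).subset (Set.image_subset_range (cell B) L)).toFinset

lemma mem_cellsOf {L : Set (Fin (n + 1) → ℝ)} {F : Set (Fin n → ℝ)} :
    F ∈ cellsOf B L ↔ ∃ x ∈ L, cell B x = F := by
  simp [cellsOf]

lemma cell_dim_two_iff (x : Fin (n + 1) → ℝ) :
    cellDim (cell B x) = 2 ↔ Nat.card (Quotient (blk B x)) = 3 := by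
  rw [← cellDim_cell]; omega

/-- The tropical surface of the cells of the points of `L`, with weights `1`. -/
def IsPlaneSet.variety {L : Set (Fin (n + 1) → ℝ)} (hL : IsPlaneSet B L) :
    TropicalVariety n 2 where
  cells := cellsOf B L
  polyhedron F hF := by
    obtain ⟨x, -, rfl⟩ := mem_cellsOf.1 hF
    exact isRationalPolyhedron_cell x
  face_mem F hF G hG hne := by
    obtain ⟨x, hx, rfl⟩ := mem_cellsOf.1 hF
    obtain ⟨y, hy, rfl⟩ := exists_cell_of_isExposed hG hne
    exact mem_cellsOf.2 ⟨y, hL.spec hx hy, rfl⟩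
  inter_face F hF G hG := by
    obtain ⟨x, -, rfl⟩ := mem_cellsOf.1 hF
    obtain ⟨y, -, rfl⟩ := mem_cellsOf.1 hG
    exact isExposed_cell_inter x y
  pure F hF := by
    obtain ⟨x, hx, rfl⟩ := mem_cellsOf.1 hF
    obtain ⟨y, hy, hyx, hc⟩ := exists_spec_card_three hL hx
    exact ⟨_, mem_cellsOf.2 ⟨y, hy, rfl⟩, cell_subset.2 hyx, (cell_dim_two_iff y).2 hc⟩
  weight _ := 1
  weight_pos _ _ _ := one_pos
  balanced G hG hdim := by
    classical
    obtain ⟨x, hx, rfl⟩ := mem_cellsOf.1 hG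
    have hc : Nat.card (Quotient (blk B x)) = 2 := by rw [← cellDim_cell]; omega
    let P : Set (Fin n → ℝ) → Finset (Fin (n + 1)) → Prop := fun F A =>
      (∃ i₀ j₀, Split B L x A i₀ j₀) ∧
      ∀ᶠ ε in 𝓝[>] (0 : ℝ), cell B (x + ε • (-ind A)) = F
    let A : Set (Fin n → ℝ) → Finset (Fin (n + 1)) := fun F =>
      if h : ∃ A, P F A then h.choose else ∅
    have hA : ∀ F ∈ cellsOf B L, cellDim F = 2 → cell B x ⊆ F → P F (A F) := by
      intro F hF hF2 hGF
      obtain ⟨y, hy, rfl⟩ := mem_cellsOf.1 hF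
      obtain ⟨A', i₀, j₀, h1, h2⟩ := exists_split_of_facet hL hc hy (cell_subset.1 hGF)
        ((cell_dim_two_iff y).1 hF2)
      have h : ∃ A, P (cell B y) A := ⟨A', ⟨i₀, j₀, h1⟩, h2⟩
      simp only [A, dif_pos h]
      exact h.choose_spec
    refine ⟨fun F => zdir (A F), fun F hF hF2 hGF => ?_, ?_⟩
    · obtain ⟨⟨i₀, j₀, h1⟩, h2⟩ := hA F hF hF2 hGF
      exact h1.isPrimitiveNormal hL hc h2
    · obtain ⟨r, hr⟩ := exists_split hL hx hc
      set S := (cellsOf B L).filter fun F => cellDim F = 2 ∧ cell B x ⊆ F with hS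
      have hAS : ∀ F ∈ S, P F (A F) := fun F hF => by
        rw [hS, Finset.mem_filter] at hF
        exact hA F hF.1 hF.2.1 hF.2.2
      -- The sets `A F` partition the splitting block: existence is `exists_split`, uniqueness is
      -- `Split.eq_of_mem`. The sum of the normals is thus constant on blocks.
      have hsum : ∀ i, ∑ F ∈ S, ind (A F) i = if blk B x i r then 1 else 0 := by
        intro i
        split_ifs with hi
        · obtain ⟨A₀, i₀, j₀, hsp, hiA⟩ := (hr i).1 hi
          obtain ⟨ε, h1, hε, h3, -⟩ := (hsp.card hL hc).exists
          have huniq : ∀ F ∈ S, i ∈ A F → A F = A₀ := fun F hF hiF => by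
            obtain ⟨⟨i₁, j₁, h4⟩, -⟩ := hAS F hF
            exact h4.eq_of_mem hL hc hsp hiF hiA
          have hcong : ∀ᶠ ε' in 𝓝[>] (0 : ℝ), cell B (x + ε' • (-ind A₀)) =
              cell B (x + ε • (-ind A₀)) := by
            filter_upwards [eventually_small (B := B) x (-ind A₀)] with ε' h'
            exact cell_congr (h'.spec hε fun _ _ _ h => h) (hε.spec h' fun _ _ _ h => h)
          have hmem : cell B (x + ε • (-ind A₀)) ∈ S := by
            rw [hS, Finset.mem_filter]
            refine ⟨mem_cellsOf.2 ⟨_, h1, rfl⟩, (cell_dim_two_iff _).2 h3, cell_subset.2 ?_⟩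
            exact hε.spec_base
          have heq : i ∈ A (cell B (x + ε • (-ind A₀))) := by
            obtain ⟨ε', h5, h6⟩ :=
              ((hAS _ hmem).2.and (eventually_small (B := B) x (-ind (A _)))).exists
            exact hsp.mem_of_cell_eq hε h6 h5.symm hiA
          rw [Finset.sum_eq_single_of_mem _ hmem, ind_of_mem heq]
          intro F hF hne
          refine ind_of_notMem fun hiF => hne ?_
          have h6 := (hAS F hF).2
          rw [huniq F hF hiF] at h6
          obtain ⟨ε', h7, h8⟩ := (h6.and hcong).exists
          exact h7.symm.trans h8
        · refine Finset.sum_eq_zero fun F hF => ind_of_notMem ?_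
          obtain ⟨⟨i₁, j₁, h4⟩, -⟩ := hAS F hF
          exact (hr i).2 hi _ _ _ h4
      rw [cellSpan_cell, mem_constOn]
      have e : ∀ i, hat (intCast (∑ F ∈ S, ((1 : ℕ) : ℤ) • zdir (A F))) i
          = ∑ F ∈ S, (ind (A F) 0 - ind (A F) i) := by
        intro i
        simp only [← hat_zdir]
        cases i using Fin.cases <;> simp [intCast]
      intro a b hab
      rw [e, e, Finset.sum_sub_distrib, Finset.sum_sub_distrib, hsum a, hsum b]
      have : blk B x a r ↔ blk B x b r :=
        ⟨(blk B x).trans ((blk B x).symm hab), (blk B x).trans hab⟩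
      simp only [this]

/-! ### Intersection with a translated linear space: the degree -/

lemma hat_injective : Function.Injective (hat (n := n)) := fun x y h => by
  ext j
  exact congrFun h j.succ

lemma hat_sum {α : Type*} (s : Finset α) (f : α → Fin n → ℝ) (j : Fin (n + 1)) :
    hat (∑ i ∈ s, f i) j = ∑ i ∈ s, hat (f i) j := by
  cases j using Fin.cases <;> simp

lemma hat_stdRay (i j : Fin (n + 1)) :
    hat (intCast (stdRay i)) j = (if i = 0 then 1 else 0) - (if i = j then 1 else 0) := by
  cases i using Fin.cases with
  | zero => cases j using Fin.cases <;> simp [stdRay, intCast, Fin.succ_ne_zero, eq_comm]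
  | succ i =>
    cases j using Fin.cases with
    | zero => simp [Fin.succ_ne_zero]
    | succ j =>
      simp [stdRay, intCast, Fin.succ_ne_zero, Pi.single_apply, eq_comm]

lemma hat_sum_stdRay (I : Finset (Fin (n + 1))) (a : Fin (n + 1) → ℝ) (j : Fin (n + 1)) :
    hat (∑ i ∈ I, a i • intCast (stdRay i)) j =
      (if 0 ∈ I then a 0 else 0) - (if j ∈ I then a j else 0) := by
  rw [hat_sum]
  simp only [hat_smul, hat_stdRay, mul_sub, mul_ite, mul_one, mul_zero, Finset.sum_sub_distrib,
    Finset.sum_ite_eq']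

lemma mem_stdSpan {I : Finset (Fin (n + 1))} {w : Fin n → ℝ} {c : ℝ}
    (h : ∀ i ∉ I, hat w i = c) : w ∈ stdSpan I := by
  have : w = ∑ i ∈ I, (c - hat w i) • intCast (stdRay i) := by
    apply hat_injective
    ext j
    rw [hat_sum_stdRay]
    have h0 : (if 0 ∈ I then c - hat w 0 else 0) = c := by
      split_ifs with h0
      · simp
      · rw [← h 0 h0, hat_zero]
    rw [h0]
    split_ifs with hj
    · ring
    · rw [h j hj]; ring
  rw [this]
  exact Submodule.sum_mem _ fun i hi =>
    Submodule.smul_mem _ _ (Submodule.subset_span ⟨i, hi, rfl⟩)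

/-- In homogeneous coordinates the ray directions are the negated unit vectors, so the translated
cone consists of the points below `v` that agree with `v` off `I`. -/
lemma meets_iff {F : Set (Fin n → ℝ)} {v : Fin n → ℝ} {I : Finset (Fin (n + 1))} :
    TropicalVariety.Meets F v I ↔ ∃ a : Fin (n + 1) → ℝ, (∀ i, 0 ≤ a i) ∧ (∀ i ∉ I, a i = 0) ∧
      dehom (hat v - a) ∈ F := by
  constructor
  · rintro ⟨y, ⟨a, ha, rfl⟩, hy⟩
    refine ⟨fun i => if i ∈ I then a i else 0, fun i => ?_, fun i hi => if_neg hi, ?_⟩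
    · dsimp only
      split_ifs
      exacts [ha i, le_rfl]
    · convert hy using 1
      apply hat_injective
      ext j
      rw [hat_dehom, hat_add, hat_sum_stdRay]
      simp only [Pi.sub_apply, hat_zero]
      ring
  · rintro ⟨a, ha, h0, hy⟩
    refine ⟨_, ⟨a, ha, rfl⟩, ?_⟩
    convert hy using 1
    apply hat_injective
    ext j
    have e : ∀ i, (if i ∈ I then a i else 0) = a i := fun i => by
      split_ifs with hi
      exacts [rfl, (h0 i hi).symm]
    rw [hat_dehom, hat_add, hat_sum_stdRay, e, e]
    simp only [Pi.sub_apply, hat_zero]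
    ring

lemma dehom_ind_mem_stdSpan {K I : Finset (Fin (n + 1))} (h : K ⊆ I) :
    dehom (ind K) ∈ stdSpan I :=
  mem_stdSpan (c := - ind K 0) fun i hi => by
    rw [hat_dehom, ind_of_notMem fun h' => hi (h h')]; ring

lemma dehom_ind_ne_zero {K I : Finset (Fin (n + 1))} (h : K ⊆ I) (hK : K.Nonempty)
    (hI : I.card + 2 ≤ n) : dehom (ind K) ≠ 0 := by
  obtain ⟨k, hk⟩ := hK
  obtain ⟨i, hi⟩ : ∃ i, i ∉ I := by
    by_contra! hcon
    have := Finset.card_le_card (fun i _ => hcon i : Finset.univ ⊆ I)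
    simp at this
    omega
  intro h0
  have e : ∀ j, ind K j - ind K 0 = 0 := fun j => by
    rw [← hat_dehom, h0]
    cases j using Fin.cases <;> simp
  have h1 := e k
  have h2 := e i
  rw [ind_of_mem hk] at h1
  rw [ind_of_notMem fun h' => hi (h h')] at h2
  linarith

/-- A block of a cell that is transversal to `stdSpan I` is not contained in `I`. -/
lemma exists_notMem_of_isCompl {x : Fin (n + 1) → ℝ} {I : Finset (Fin (n + 1))}
    (hI : I.card + 2 ≤ n) (hc : IsCompl (constOn (blk B x)) (stdSpan I)) (q : Fin (n + 1)) :
    ∃ i ∉ I, blk B x q i := by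
  classical
  by_contra! hcon
  set K : Finset (Fin (n + 1)) := Finset.univ.filter fun i => blk B x q i with hK
  have hKI : K ⊆ I := fun i hi => by
    by_contra h
    exact hcon i h (by simpa [hK] using hi)
  have h1 : dehom (ind K) ∈ constOn (blk B x) := by
    intro a b hab
    have : blk B x q a ↔ blk B x q b :=
      ⟨fun h => (blk B x).trans h hab, fun h => (blk B x).trans h ((blk B x).symm hab)⟩
    simp [hat_dehom, ind, hK, this]
  exact dehom_ind_ne_zero hKI ⟨q, by simp [hK]⟩ hI
    (Submodule.disjoint_def.1 hc.disjoint _ h1 (dehom_ind_mem_stdSpan hKI))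

/-- There are three blocks and three indices outside `I`, and transversality puts one index in each
block. An integer vector can be replaced by its values at these representatives, spread over the
blocks; the difference lives on `I`. -/
lemma index_eq_one {x : Fin (n + 1) → ℝ} (hx : Nat.card (Quotient (blk B x)) = 3)
    {I : Finset (Fin (n + 1))} (hI : I.card + 2 = n)
    (hc : IsCompl (constOn (blk B x)) (stdSpan I)) :
    (latticeOf (constOn (blk B x)) ⊔ latticeOf (stdSpan I)).index = 1 := by
  classical
  rw [AddSubgroup.index_eq_one, eq_top_iff]
  choose ρ hρ hρ' using exists_notMem_of_isCompl hI.le hc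
  let f : {i // i ∉ I} → Quotient (blk B x) := fun i => Quotient.mk _ i.1
  have hf : Function.Bijective f := by
    refine (Nat.bijective_iff_surjective_and_card f).2 ⟨fun q => ?_, ?_⟩
    · induction q using Quotient.inductionOn with
      | h i => exact ⟨⟨ρ i, hρ i⟩, Quotient.sound ((blk B x).symm (hρ' i))⟩
    · rw [hx, Nat.card_eq_fintype_card, Fintype.card_subtype_compl, Fintype.card_fin,
        Fintype.card_coe]
      omega
  have hinj : ∀ i ∉ I, ∀ j ∉ I, blk B x i j → i = j := fun i hi j hj h =>
    congrArg Subtype.val (hf.1 (Quotient.sound h : f ⟨i, hi⟩ = f ⟨j, hj⟩))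
  have hρc : ∀ a b, blk B x a b → ρ a = ρ b := fun a b h => hinj _ (hρ a) _ (hρ b)
    ((blk B x).trans ((blk B x).symm (hρ' a)) ((blk B x).trans h (hρ' b)))
  have hρi : ∀ i ∉ I, ρ i = i := fun i hi => hinj _ (hρ i) _ hi ((blk B x).symm (hρ' i))
  intro z _
  set Z : Fin (n + 1) → ℤ := Fin.cons 0 z with hZ
  set u : Fin n → ℤ := fun j => Z (ρ j.succ) - Z (ρ 0) with hu
  have hatu : ∀ i, hat (intCast u) i = Z (ρ i) - Z (ρ 0) := fun i => by
    cases i using Fin.cases <;> simp [intCast, hu]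
  refine AddSubgroup.mem_sup.2 ⟨u, ?_, z - u, ?_, add_sub_cancel _ _⟩
  · rw [mem_latticeOf]
    intro a b hab
    rw [hatu, hatu, hρc a b hab]
  · rw [mem_latticeOf]
    refine mem_stdSpan (c := Z (ρ 0)) fun i hi => ?_
    have : intCast (z - u) = intCast z - intCast u := by ext j; simp [intCast]
    rw [this, hat_sub, hatu, hρi i hi, hat_intCast]
    ring

/-- A proper face has an additional tie between distinct blocks, hence fewer blocks. -/
lemma spec_symm_of_card {x y : Fin (n + 1) → ℝ} (h : Spec B x y)
    (hc : Nat.card (Quotient (blk B x)) = Nat.card (Quotient (blk B y))) : Spec B y x := by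
  intro a b c hcB hle
  by_contra! hgt
  have hy : y a - y b = c := le_antisymm hle (h.ge hcB hgt.le)
  have hab : blk B x a b := by
    by_contra hcon
    have := card_quotient_lt (fun _ _ h' => h.blk h') (Tie.blk ⟨c, hcB, hy⟩ : blk B y a b) hcon
    omega
  have := blk_const (w := fun i => y i - x i) (fun i j hij => by
    have := h.tie_sub hij
    linarith) hab
  linarith

lemma continuous_hat (i : Fin (n + 1)) : Continuous fun y : Fin n → ℝ => hat y i := by
  cases i using Fin.cases with
  | zero => simpa using continuous_const
  | succ j => simpa using continuous_apply j

lemma isClosed_cell (x : Fin (n + 1) → ℝ) : IsClosed (cell B x) := by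
  have : cell B x = ⋂ a, ⋂ b, ⋂ c : ℤ, {y | |c| ≤ B → x a - x b ≤ c → hat y a - hat y b ≤ c} := by
    ext y; simp [mem_cell, Spec]
  rw [this]
  refine isClosed_iInter fun a => isClosed_iInter fun b => isClosed_iInter fun c => ?_
  by_cases h : |c| ≤ B ∧ x a - x b ≤ c
  · simp only [h.1, h.2, true_imp_iff]
    exact isClosed_le ((continuous_hat a).sub (continuous_hat b)) continuous_const
  · convert isClosed_univ
    ext y
    simp only [Set.mem_ofPred_eq, Set.mem_univ, iff_true]
    exact fun h1 h2 => absurd ⟨h1, h2⟩ h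

lemma IsPlaneSet.mem_iff {L : Set (Fin (n + 1) → ℝ)} (hL : IsPlaneSet B L) {x : Fin (n + 1) → ℝ} :
    x ∈ L ↔ ∃ F ∈ cellsOf B L, dehom x ∈ F := by
  constructor
  · exact fun hx => ⟨_, mem_cellsOf.2 ⟨x, hx, rfl⟩, dehom_mem_cell.2 (Spec.refl x)⟩
  · rintro ⟨F, hF, hx⟩
    obtain ⟨y, hy, rfl⟩ := mem_cellsOf.1 hF
    exact hL.spec hy (dehom_mem_cell.1 hx)

lemma IsPlaneSet.isClosed {L : Set (Fin (n + 1) → ℝ)} (hL : IsPlaneSet B L) : IsClosed L := by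
  have : L = dehom ⁻¹' ⋃ F ∈ cellsOf B L, F := by
    ext x; simp [hL.mem_iff]
  rw [this]
  refine IsClosed.preimage (by unfold dehom; fun_prop) ?_
  refine (cellsOf B L).finite_toSet.isClosed_biUnion fun F hF => ?_
  obtain ⟨y, -, rfl⟩ := mem_cellsOf.1 hF
  exact isClosed_cell y

/-- The projection to a tropical plane: below every point `v` there is a point of `L` that agrees
with `v` in at least three coordinates. -/
lemma IsPlaneSet.exists_proj {L : Set (Fin (n + 1) → ℝ)} (hL : IsPlaneSet B L)
    (v : Fin (n + 1) → ℝ) :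
    ∃ y ∈ L, y ≤ v ∧ (Finset.univ.filter fun i => y i ≠ v i).card + 2 ≤ n := by
  classical
  obtain ⟨k, b, hb⟩ := hL.low 0 0
  obtain ⟨z, hz, -⟩ := hb 0
  obtain ⟨i₀, -, hi₀⟩ := Finset.exists_max_image Finset.univ (fun i => z i - v i) ⟨0, by simp⟩
  set y₀ : Fin (n + 1) → ℝ := fun i => z i - (z i₀ - v i₀) with hy₀
  have hy₀L : y₀ ∈ L := hL.spec hz (Spec.of_sub_eq fun a b => by simp [hy₀])
  have hy₀v : y₀ ≤ v := fun i => by have := hi₀ i (by simp); simp only [hy₀]; linarith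
  -- `y` has the largest coordinate sum among the points of `L` between `y₀` and `v`. If it agreed
  -- with `v` in at most two coordinates `e`, `f`, it could be raised off these and would still be
  -- below `v`.
  obtain ⟨y, ⟨hyL, hy⟩, hmax⟩ := (isCompact_Icc (a := y₀) (b := v)).inter_left hL.isClosed
    |>.exists_isMaxOn ⟨y₀, hy₀L, le_rfl, hy₀v⟩
    (f := fun y : Fin (n + 1) → ℝ => ∑ i, y i) (by fun_prop)
  refine ⟨y, hyL, hy.2, ?_⟩
  by_contra hcard
  have hcompl := Finset.card_filter_add_card_filter_not (s := (Finset.univ : Finset (Fin (n + 1))))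
    (fun i => y i ≠ v i)
  simp only [not_not, Finset.card_univ, Fintype.card_fin] at hcompl
  obtain ⟨e, f, hef⟩ : ∃ e f, ∀ i, y i = v i → i = e ∨ i = f := by
    have hle : (Finset.univ.filter fun i => y i = v i).card ≤ 2 := by omega
    have hm : ∀ i, y i = v i ↔ i ∈ Finset.univ.filter fun i => y i = v i := by simp
    interval_cases h : (Finset.univ.filter fun i => y i = v i).card
    · refine ⟨0, 0, fun i hi => ?_⟩
      rw [hm, Finset.card_eq_zero.1 h] at hi
      simp at hi
    · obtain ⟨e, he⟩ := Finset.card_eq_one.1 h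
      refine ⟨e, e, fun i hi => ?_⟩
      rw [hm, he] at hi
      simpa using hi
    · obtain ⟨e, f, -, he⟩ := Finset.card_eq_two.1 h
      refine ⟨e, f, fun i hi => ?_⟩
      rw [hm, he] at hi
      simpa using hi
  obtain ⟨K, ⟨k, hk⟩, he, hf, hg⟩ := exists_germ_off hL hyL e f
  have h1 : ∀ᶠ ε in 𝓝[>] (0 : ℝ), ∀ i, y i < v i → ε < v i - y i := by
    refine eventually_all.2 fun i => ?_
    by_cases h : y i < v i
    · filter_upwards [Ioo_mem_nhdsGT (sub_pos.2 h)] with ε hε _ using hε.2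
    · simp [h]
  obtain ⟨ε, ⟨h2, h3⟩, h4⟩ := ((hg.and h1).and eventually_mem_nhdsWithin).exists
  have h4 : 0 < ε := h4
  have h5 : y ≤ y + ε • ind K := fun i => by
    have : 0 ≤ ind K i := by unfold ind; split_ifs <;> norm_num
    simp only [Pi.add_apply, Pi.smul_apply, smul_eq_mul]
    nlinarith
  have h6 : y + ε • ind K ≤ v := fun i => by
    simp only [Pi.add_apply, Pi.smul_apply, smul_eq_mul]
    by_cases hi : i ∈ K
    · have hlt : y i < v i := lt_of_le_of_ne (hy.2 i) fun h => by
        rcases hef i h with rfl | rfl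
        exacts [he hi, hf hi]
      have := h3 i hlt
      rw [ind_of_mem hi]; linarith
    · rw [ind_of_notMem hi]
      simpa using hy.2 i
  have h7 := hmax (a := y + ε • ind K) ⟨h2, hy.1.trans h5, h6⟩
  have h8 : ∑ i, y i < ∑ i, (y + ε • ind K) i :=
    Finset.sum_lt_sum (fun i _ => h5 i) ⟨k, by simp, by simp [ind_of_mem hk, h4]⟩
  exact absurd h7 (not_le.2 h8)

/-- Otherwise `z` could be raised along some `K ⊆ I`. The cell of the raised point contains `z`, so
it meets the translated cone, while the nonzero direction `dehom (ind K)` lies in both spans,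
against transversality. -/
lemma IsPlaneSet.le_of_generic {L : Set (Fin (n + 1) → ℝ)} (hL : IsPlaneSet B L)
    {v : Fin n → ℝ} (hv : (hL.variety).IsGeneric v) {I : Finset (Fin (n + 1))}
    (hI : I.card + 2 ≤ n) {z z' : Fin (n + 1) → ℝ} (hz : z ∈ L) (hz' : z' ∈ L)
    (hzv : z ≤ hat v) (hzI : ∀ i ∉ I, z i = hat v i) (hzv' : z' ≤ hat v) : z' ≤ z := by
  intro k
  by_contra! hk
  obtain ⟨K, hK, h1, h2⟩ := exists_raise hL hz hz' hk
  have hKI : K ⊆ I := fun i hi => by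
    by_contra h
    have := h1 i hi
    rw [hzI i h] at this
    exact absurd (hzv' i) (not_le.2 this)
  obtain ⟨ε, h3, h4⟩ := (h2.and (eventually_small (B := B) z (ind K))).exists
  have h5 := (hv (cell B (z + ε • ind K)) (mem_cellsOf.2 ⟨_, h3, rfl⟩) I hI
    (meets_iff.2 ⟨hat v - z, fun i => sub_nonneg.2 (hzv i), fun i hi => by simp [hzI i hi], by
      rw [sub_sub_cancel, dehom_mem_cell]; exact h4.spec_base⟩)).2.2
  rw [cellSpan_cell] at h5
  refine dehom_ind_ne_zero hKI hK hI (Submodule.disjoint_def.1 h5.disjoint _ ?_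
    (dehom_ind_mem_stdSpan hKI))
  intro a b hab
  rw [hat_dehom, hat_dehom, (h4.blk hab).2]

/-- Every intersection point is the greatest point of `L` below `v`, so there is only one. This
point determines `I` as the set of coordinates where it differs from `v`, and the facet by
`spec_symm_of_card`. -/
lemma IsPlaneSet.hasDegree_one {L : Set (Fin (n + 1) → ℝ)} (hL : IsPlaneSet B L) :
    (hL.variety).HasDegree 1 := by
  classical
  intro v hv
  obtain ⟨z, hz, hzv, hI⟩ := hL.exists_proj (hat v)
  set I₀ := Finset.univ.filter fun i => z i ≠ hat v i with hI₀
  have hzI : ∀ i ∉ I₀, z i = hat v i := fun i hi => by simpa [hI₀] using hi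
  have hcells : ∀ {y}, y ∈ L → cell B y ∈ (hL.variety).cells := fun hy =>
    mem_cellsOf.2 ⟨_, hy, rfl⟩
  have hmeet : TropicalVariety.Meets (cell B z) v I₀ :=
    meets_iff.2 ⟨hat v - z, fun i => sub_nonneg.2 (hzv i), fun i hi => by simp [hzI i hi], by
      rw [sub_sub_cancel, dehom_mem_cell]; exact Spec.refl z⟩
  obtain ⟨hdim, hcard, -⟩ := hv _ (hcells hz) I₀ hI hmeet
  have huniq : ∀ x ∈ L, cellDim (cell B x) = 2 → ∀ I : Finset (Fin (n + 1)), I.card + 2 = n →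
      TropicalVariety.Meets (cell B x) v I → cell B x = cell B z ∧ I = I₀ := by
    intro x hx hxd I hIc hm
    obtain ⟨a, ha, haI, hax⟩ := meets_iff.1 hm
    rw [dehom_mem_cell] at hax
    have ha' := hL.spec hx hax
    have hle : hat v - a ≤ hat v := fun i => by simpa using ha i
    have heq : hat v - a = z := le_antisymm
      (hL.le_of_generic hv hI hz ha' hzv hzI hle)
      (hL.le_of_generic hv hIc.le ha' hz hle (fun i hi => by simp [haI i hi]) hzv)
    rw [heq] at hax
    refine ⟨cell_congr hax (spec_symm_of_card hax ?_), (Finset.eq_of_subset_of_card_le ?_ ?_).symm⟩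
    · rw [(cell_dim_two_iff x).1 hxd, (cell_dim_two_iff z).1 hdim]
    · intro i hi
      by_contra hcon
      have := congrFun heq i
      simp only [Pi.sub_apply, haI i hcon, sub_zero] at this
      simp only [hI₀, Finset.mem_filter, Finset.mem_univ, true_and] at hi
      exact hi this.symm
    · omega
  have hindex : ∀ x ∈ L, ∀ I : Finset (Fin (n + 1)), I.card + 2 = n →
      TropicalVariety.Meets (cell B x) v I →
      (latticeOf (cellSpan (cell B x)) ⊔ latticeOf (stdSpan I)).index = 1 := by
    intro x hx I hIc hm
    obtain ⟨h1, -, h2⟩ := hv _ (hcells hx) I hIc.le hm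
    rw [cellSpan_cell] at h2 ⊢
    exact index_eq_one ((cell_dim_two_iff x).1 h1) hIc h2
  unfold TropicalVariety.intersectionNumber
  rw [Finset.sum_eq_single_of_mem (cell B z), Finset.sum_eq_single_of_mem I₀,
    hindex z hz I₀ hcard hmeet]
  · rfl
  · simp only [Finset.mem_filter, Finset.mem_univ, true_and]
    exact ⟨hcard, hmeet⟩
  · intro I hI hne
    simp only [Finset.mem_filter, Finset.mem_univ, true_and] at hI
    exact absurd (huniq z hz hdim I hI.1 hI.2).2 hne
  · simp only [Finset.mem_filter]
    exact ⟨hcells hz, hdim⟩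
  · intro F hF hne
    simp only [Finset.mem_filter] at hF
    obtain ⟨x, hx, rfl⟩ := mem_cellsOf.1 hF.1
    refine Finset.sum_eq_zero fun I hI => ?_
    simp only [Finset.mem_filter, Finset.mem_univ, true_and] at hI
    exact absurd (huniq x hx hF.2 I hI.1 hI.2).1 hne

/-! ### The tropical plane of the caterpillar tree -/

/-- The maximum of four numbers is attained at least twice. -/
def Bend {α : Type*} [LE α] (p q r s : α) : Prop :=
  (p ≤ q ∨ p ≤ r ∨ p ≤ s) ∧ (q ≤ p ∨ q ≤ r ∨ q ≤ s) ∧ (r ≤ p ∨ r ≤ q ∨ r ≤ s) ∧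
    (s ≤ p ∨ s ≤ q ∨ s ≤ r)

/-- A term `max p p'` equals `p` or `p'`, and is dominated by whichever other term dominates that
number. This yields the tropical convexity of `planeSet`. -/
lemma Bend.sup {p q r s p' q' r' s' : ℝ} (h : Bend p q r s) (h' : Bend p' q' r' s') :
    Bend (max p p') (max q q') (max r r') (max s s') := by
  have key : ∀ {p q r s p' q' r' s' : ℝ}, (p ≤ q ∨ p ≤ r ∨ p ≤ s) → (p' ≤ q' ∨ p' ≤ r' ∨ p' ≤ s') →
      (max p p' ≤ max q q' ∨ max p p' ≤ max r r' ∨ max p p' ≤ max s s') := by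
    intro p q r s p' q' r' s' h h'
    rcases le_total p p' with hp | hp
    · rw [max_eq_right hp]
      exact h'.imp (le_max_of_le_right ·) (Or.imp (le_max_of_le_right ·) (le_max_of_le_right ·))
    · rw [max_eq_left hp]
      exact h.imp (le_max_of_le_left ·) (Or.imp (le_max_of_le_left ·) (le_max_of_le_left ·))
  exact ⟨key h.1 h'.1, key h.2.1 h'.2.1, key h.2.2.1 h'.2.2.1, key h.2.2.2 h'.2.2.2⟩

lemma not_bend {p q r s : ℝ} (h : Bend p q r s) (hpq : p ≠ q) (hpr : p ≠ r) (hps : p ≠ s)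
    (hqr : q ≠ r) (hqs : q ≠ s) (hrs : r ≠ s) : False := by
  obtain ⟨h1, h2, h3, h4⟩ := h
  rw [hpq.le_iff_lt, hpr.le_iff_lt, hps.le_iff_lt] at h1
  rw [hpq.symm.le_iff_lt, hqr.le_iff_lt, hqs.le_iff_lt] at h2
  rw [hpr.symm.le_iff_lt, hqr.symm.le_iff_lt, hrs.le_iff_lt] at h3
  rw [hps.symm.le_iff_lt, hqs.symm.le_iff_lt, hrs.symm.le_iff_lt] at h4
  rcases h1 with h1 | h1 | h1 <;> rcases h2 with h2 | h2 | h2 <;> rcases h3 with h3 | h3 | h3 <;>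
    rcases h4 with h4 | h4 | h4 <;> linarith

/-- A tropical plane adapted to the caterpillar tree with leaves `0, 1, …, n`: its Plücker
coordinates are `-N (2 a + b)` for `a < b < c`. -/
def planeSet (n N : ℕ) : Set (Fin (n + 1) → ℝ) :=
  {x | ∀ a b c d : Fin (n + 1), a < b → b < c → c < d →
    Bend (x a + ((N * (2 * a - b) : ℤ) : ℝ)) (x b + ((N * b : ℤ) : ℝ))
      (x c + ((N * c : ℤ) : ℝ)) (x d + ((N * c : ℤ) : ℝ))}

lemma Tie.symm {x : Fin (n + 1) → ℝ} {a b : Fin (n + 1)} (h : Tie B x a b) : Tie B x b a := by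
  obtain ⟨c, hc, e⟩ := h
  exact ⟨-c, by simpa using hc, by push_cast; linarith⟩

lemma abs_mul_sub_le {N : ℕ} {u w : ℤ} (h : |w - u| ≤ 2 * n) :
    |(N * w - N * u : ℤ)| ≤ (2 * N * n : ℕ) := by
  rw [← mul_sub, abs_mul, Nat.abs_cast]
  push_cast
  nlinarith

/-- Two shifts in a circuit relation differ by at most `2 * N * n`, so every comparison of terms is
an inequality of the arrangement with this bound. -/
lemma planeSet_spec {N : ℕ} {x y : Fin (n + 1) → ℝ} (hx : x ∈ planeSet n N)
    (h : Spec (2 * N * n) x y) : y ∈ planeSet n N := by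
  intro a b c d hab hbc hcd
  have key : ∀ (p q : Fin (n + 1)) (u w : ℤ), |w - u| ≤ 2 * n →
      x p + ((N * u : ℤ) : ℝ) ≤ x q + ((N * w : ℤ) : ℝ) →
      y p + ((N * u : ℤ) : ℝ) ≤ y q + ((N * w : ℤ) : ℝ) := by
    intro p q u w huw hle
    have := h p q _ (abs_mul_sub_le huw) (by push_cast at hle ⊢; linarith)
    push_cast at this ⊢
    linarith
  have h1 := d.is_lt
  have e : ∀ u w : ℤ, -(2 * n : ℤ) ≤ w - u ∧ w - u ≤ 2 * n → |w - u| ≤ 2 * n := fun u w h =>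
    abs_le.2 h
  obtain ⟨hp, hq, hr, hs⟩ := hx a b c d hab hbc hcd
  have hab' : (a : ℕ) < b := hab
  have hbc' : (b : ℕ) < c := hbc
  have hcd' : (c : ℕ) < d := hcd
  refine ⟨hp.imp (key _ _ _ _ (e _ _ ?_)) (Or.imp (key _ _ _ _ (e _ _ ?_)) (key _ _ _ _ (e _ _ ?_))),
    hq.imp (key _ _ _ _ (e _ _ ?_)) (Or.imp (key _ _ _ _ (e _ _ ?_)) (key _ _ _ _ (e _ _ ?_))),
    hr.imp (key _ _ _ _ (e _ _ ?_)) (Or.imp (key _ _ _ _ (e _ _ ?_)) (key _ _ _ _ (e _ _ ?_))),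
    hs.imp (key _ _ _ _ (e _ _ ?_)) (Or.imp (key _ _ _ _ (e _ _ ?_)) (key _ _ _ _ (e _ _ ?_)))⟩ <;>
  omega

/-- Sort the four indices. Untied coordinates make the four terms of their circuit relation
distinct, so the maximum would be attained only once. -/
lemma planeSet_four {N : ℕ} {x : Fin (n + 1) → ℝ} (hx : x ∈ planeSet n N) (i j k l : Fin (n + 1))
    (hij : ¬ Tie (2 * N * n) x i j) (hik : ¬ Tie (2 * N * n) x i k)
    (hil : ¬ Tie (2 * N * n) x i l) (hjk : ¬ Tie (2 * N * n) x j k)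
    (hjl : ¬ Tie (2 * N * n) x j l) (hkl : ¬ Tie (2 * N * n) x k l) : False := by
  classical
  have hrefl : ∀ a, Tie (2 * N * n) x a a := fun a => ⟨0, by simp; positivity, by simp⟩
  have hne : ∀ {a b}, ¬ Tie (2 * N * n) x a b → a ≠ b := fun h e => h (e ▸ hrefl _)
  set S : Finset (Fin (n + 1)) := {i, j, k, l} with hS
  have hcard : S.card = 4 := by
    rw [hS, Finset.card_insert_of_notMem, Finset.card_insert_of_notMem,
      Finset.card_insert_of_notMem, Finset.card_singleton]
    · simpa using hne hkl
    · simpa using ⟨hne hjk, hne hjl⟩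
    · simpa using ⟨hne hij, hne hik, hne hil⟩
  have hun : ∀ p ∈ S, ∀ q ∈ S, p ≠ q → ¬ Tie (2 * N * n) x p q := by
    simp only [hS, Finset.mem_insert, Finset.mem_singleton]
    have hs : ∀ {a b}, ¬ Tie (2 * N * n) x a b → ¬ Tie (2 * N * n) x b a := fun h h' => h h'.symm
    rintro p (rfl | rfl | rfl | rfl) q (rfl | rfl | rfl | rfl) hpq <;>
      first | exact absurd rfl hpq | assumption | (apply hs; assumption)
  let e := S.orderEmbOfFin hcard
  have hmem : ∀ t, e t ∈ S := fun t => S.orderEmbOfFin_mem hcard t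
  have hlt : ∀ {s t : Fin 4}, s < t → e s < e t := fun h => e.strictMono h
  have key : ∀ (s t : Fin 4) (u w : ℤ), s < t → -(2 * n : ℤ) ≤ w - u ∧ w - u ≤ 2 * n →
      x (e s) + ((N * u : ℤ) : ℝ) ≠ x (e t) + ((N * w : ℤ) : ℝ) := by
    intro s t u w hst huw heq
    refine hun _ (hmem s) _ (hmem t) (hlt hst).ne ⟨_, abs_mul_sub_le (abs_le.2 huw), ?_⟩
    push_cast at heq ⊢
    linarith
  have h1 : ((e 0 : Fin (n + 1)) : ℕ) < e 1 := hlt (by decide)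
  have h2 : ((e 1 : Fin (n + 1)) : ℕ) < e 2 := hlt (by decide)
  have h3 : ((e 2 : Fin (n + 1)) : ℕ) < e 3 := hlt (by decide)
  have h4 := (e 3).is_lt
  refine not_bend (hx (e 0) (e 1) (e 2) (e 3) h1 h2 h3) (key _ _ _ _ (by decide) ?_)
    (key _ _ _ _ (by decide) ?_) (key _ _ _ _ (by decide) ?_) (key _ _ _ _ (by decide) ?_)
    (key _ _ _ _ (by decide) ?_) (key _ _ _ _ (by decide) ?_) <;> omega

/-- The Plücker coordinates `-(2 a + b)`, `a < b < c`, of the triples containing `e` and `f`. -/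
def cocircuit (e f : ℕ) (q : ℤ) (k : ℕ) : ℤ :=
  if k = e ∨ k = f then -q else if k < e then -(2 * k + e) else if k < f then -(2 * e + k)
    else -(2 * e + f)

lemma cocircuit_cases {e f : ℕ} (q : ℤ) (k : ℕ) :
    (k < e ∧ k ≠ f ∧ cocircuit e f q k = -(2 * k + e)) ∨ (k = e ∧ cocircuit e f q k = -q) ∨
      (e < k ∧ k < f ∧ cocircuit e f q k = -(2 * e + k)) ∨ (k = f ∧ cocircuit e f q k = -q) ∨
      (e < k ∧ f < k ∧ cocircuit e f q k = -(2 * e + f)) := by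
  unfold cocircuit
  split_ifs <;> omega

/-- The value `-q` plays the role of `-∞`: the other entries are at least `-3 n` and the shifts lie
between `-n` and `2 n`, so `8 n` is large enough. What remains is a comparison for each position of
`e` and `f` among the indices. -/
lemma bend_cocircuit {e f a b c d : ℕ} {q : ℤ} (hef : e < f) (hf : f ≤ n) (hq : 8 * n ≤ q)
    (hab : a < b) (hbc : b < c) (hcd : c < d) (hd : d ≤ n) :
    Bend (cocircuit e f q a + (2 * a - b)) (cocircuit e f q b + b) (cocircuit e f q c + c)
      (cocircuit e f q d + c) := by
  rcases cocircuit_cases (e := e) (f := f) q b with h | h | h | h | h <;>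
  rcases cocircuit_cases (e := e) (f := f) q c with h' | h' | h' | h' | h' <;>
  first
  | (exfalso; omega)
  | skip
  all_goals
    rcases cocircuit_cases (e := e) (f := f) q a with h1 | h1 | h1 | h1 | h1 <;>
    first
    | (exfalso; omega)
    | skip
  all_goals
    rcases cocircuit_cases (e := e) (f := f) q d with h2 | h2 | h2 | h2 | h2 <;>
    first
    | (exfalso; omega)
    | (refine ⟨?_, ?_, ?_, ?_⟩ <;> omega)

lemma Bend.mul_cast {p q r s : ℤ} (h : Bend p q r s) (N : ℕ) :
    Bend ((N * p : ℤ) : ℝ) ((N * q : ℤ) : ℝ) ((N * r : ℤ) : ℝ) ((N * s : ℤ) : ℝ) := by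
  have key : ∀ {p q : ℤ}, p ≤ q → ((N * p : ℤ) : ℝ) ≤ ((N * q : ℤ) : ℝ) := fun h => by
    exact_mod_cast mul_le_mul_of_nonneg_left h (by positivity)
  exact ⟨h.1.imp key (Or.imp key key), h.2.1.imp key (Or.imp key key),
    h.2.2.1.imp key (Or.imp key key), h.2.2.2.imp key (Or.imp key key)⟩

/-- The points are the tropical cocircuits of the plane with their two infinite entries, at `e` and
`f`, replaced by a very negative number. The entry at any third index does not depend on that
number. -/
lemma planeSet_low {N : ℕ} (hN : 0 < N) (hn : 2 ≤ n) (e f : Fin (n + 1)) :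
    ∃ k, ∃ b : ℝ, ∀ Q : ℝ, ∃ z ∈ planeSet n N, z e ≤ Q ∧ z f ≤ Q ∧ b ≤ z k := by
  wlog hlt : e < f generalizing e f
  · rcases (not_lt.1 hlt).lt_or_eq with h | rfl
    · obtain ⟨k, b, hb⟩ := this f e h
      refine ⟨k, b, fun Q => ?_⟩
      obtain ⟨z, hz, h1, h2, h3⟩ := hb Q
      exact ⟨z, hz, h2, h1, h3⟩
    · by_cases h0 : f = 0
      · obtain ⟨k, b, hb⟩ := this f (Fin.last n) (by
          rw [h0, Fin.lt_def]; simp; omega)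
        refine ⟨k, b, fun Q => ?_⟩
        obtain ⟨z, hz, h1, h2, h3⟩ := hb Q
        exact ⟨z, hz, h1, h1, h3⟩
      · obtain ⟨k, b, hb⟩ := this 0 f (Fin.pos_iff_ne_zero.2 h0)
        refine ⟨k, b, fun Q => ?_⟩
        obtain ⟨z, hz, h1, h2, h3⟩ := hb Q
        exact ⟨z, hz, h2, h2, h3⟩
  obtain ⟨k, hke, hkf⟩ : ∃ k : Fin (n + 1), k ≠ e ∧ k ≠ f := by
    by_contra! hcon
    have h1 := Finset.card_le_card (s := Finset.univ) (t := {e, f}) (fun i _ => by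
      simp only [Finset.mem_insert, Finset.mem_singleton]
      by_cases h : i = e
      exacts [Or.inl h, Or.inr (hcon i h)])
    have := h1.trans Finset.card_le_two
    simp at this
    omega
  refine ⟨k, ((N * cocircuit e f 0 k : ℤ) : ℝ), fun Q => ?_⟩
  obtain ⟨m, hm⟩ := exists_nat_ge (-Q)
  refine ⟨fun i => ((N * cocircuit e f (8 * n + m : ℕ) i : ℤ) : ℝ), ?_, ?_, ?_, ?_⟩
  · intro a b c d hab hbc hcd
    have := (bend_cocircuit (n := n) (q := (8 * n + m : ℕ)) (Fin.lt_def.1 hlt)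
      (Nat.lt_succ_iff.1 f.is_lt) (by push_cast; omega) (Fin.lt_def.1 hab) (Fin.lt_def.1 hbc)
      (Fin.lt_def.1 hcd) (Nat.lt_succ_iff.1 d.is_lt)).mul_cast N
    simpa only [mul_add, Int.cast_add] using this
  · have h1 : (1 : ℝ) ≤ N := by exact_mod_cast hN
    simp only [cocircuit, true_or, if_true]
    push_cast
    nlinarith [(Nat.cast_nonneg n : (0 : ℝ) ≤ n), (Nat.cast_nonneg m : (0 : ℝ) ≤ m)]
  · have h1 : (1 : ℝ) ≤ N := by exact_mod_cast hN
    simp only [cocircuit, or_true, if_true]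
    push_cast
    nlinarith [(Nat.cast_nonneg n : (0 : ℝ) ≤ n), (Nat.cast_nonneg m : (0 : ℝ) ≤ m)]
  · have h1 : ¬ ((k : ℕ) = e ∨ (k : ℕ) = f) := by
      rintro (h | h)
      exacts [hke (Fin.ext h), hkf (Fin.ext h)]
    simp only [cocircuit, h1, if_false, le_refl]

lemma isPlaneSet_planeSet {N : ℕ} (hN : 0 < N) (hn : 2 ≤ n) :
    IsPlaneSet (2 * N * n) (planeSet n N) where
  spec := planeSet_spec
  sup {x y} hx hy a b c d hab hbc hcd := by
    simp only [Pi.sup_apply, ← max_add_add_right]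
    exact (hx a b c d hab hbc hcd).sup (hy a b c d hab hbc hcd)
  four := planeSet_four
  low := planeSet_low hN hn

/-- The flat region of the plane around the vertex number `i` of the caterpillar tree. -/
lemma mem_planeSet {N i : ℕ} {α β γ : ℝ}
    (hS : 2 ≤ i → β ≤ α + N ∧ γ ≤ α + N) (hT : i + 2 ≤ n → β ≤ γ + N ∧ α ≤ γ + N)
    {x : Fin (n + 1) → ℝ} (hlt : ∀ j : Fin (n + 1), (j : ℕ) < i → x j = -(2 * N * j) + α)
    (heq : ∀ j : Fin (n + 1), (j : ℕ) = i → x j = -(2 * N * j) + β)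
    (hgt : ∀ j : Fin (n + 1), i < (j : ℕ) → x j = -(2 * N * i) + γ) : x ∈ planeSet n N := by
  intro a b c d hab hbc hcd
  have hd := d.is_lt
  have hN : (0 : ℝ) ≤ N := Nat.cast_nonneg N
  have key : ∀ {p q : ℕ}, p < q → (N : ℝ) * p + N ≤ N * q := fun {p q} h => by
    have : (p : ℝ) + 1 ≤ q := by exact_mod_cast h
    nlinarith
  have hab' : (a : ℕ) < b := hab
  have hbc' : (b : ℕ) < c := hbc
  have hcd' : (c : ℕ) < d := hcd
  have k1 := key hab'
  have k2 := key hbc'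
  have k3 := key hcd'
  push_cast
  -- If `b < i` the terms of `a` and `b` agree; if `i < c` those of `c` and `d` agree. At least one
  -- of these holds, and the slack `N` allowed by the hypotheses is absorbed by the gap of `N`
  -- between distinct indices.
  rcases lt_trichotomy (d : ℕ) i with h | h | h
  · rw [hlt a (by omega), hlt b (by omega), hlt c (by omega), hlt d (by omega)]
    refine ⟨Or.inl (by linarith), Or.inl (by linarith), Or.inl (by linarith), Or.inl (by linarith)⟩
  · obtain ⟨h1, h2⟩ := hS (by omega)
    rw [hlt a (by omega), hlt b (by omega), hlt c (by omega), heq d h]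
    refine ⟨Or.inl (by linarith), Or.inl (by linarith), Or.inl (by linarith), Or.inl (by linarith)⟩
  rcases lt_trichotomy (c : ℕ) i with h' | h' | h'
  · obtain ⟨h1, h2⟩ := hS (by omega)
    have k4 := key h'
    rw [hlt a (by omega), hlt b (by omega), hlt c (by omega), hgt d h]
    refine ⟨Or.inl (by linarith), Or.inl (by linarith), Or.inl (by linarith), Or.inl (by linarith)⟩
  · obtain ⟨h1, h2⟩ := hS (by omega)
    rw [hlt a (by omega), hlt b (by omega), heq c h', hgt d h, ← h']
    refine ⟨Or.inl (by linarith), Or.inl (by linarith), Or.inl (by linarith), Or.inl (by linarith)⟩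
  obtain ⟨h1, h2⟩ := hT (by omega)
  have k4 := key h'
  rcases lt_trichotomy (b : ℕ) i with h'' | h'' | h''
  · rw [hlt a (by omega), hlt b (by omega), hgt c h', hgt d h]
    refine ⟨Or.inl (by linarith), Or.inl (by linarith), Or.inr (Or.inr (by linarith)),
      Or.inr (Or.inr (by linarith))⟩
  · rw [hlt a (by omega), heq b h'', hgt c h', hgt d h]
    rw [← h''] at k4 ⊢
    refine ⟨Or.inr (Or.inl (by linarith)), Or.inr (Or.inl (by linarith)),
      Or.inr (Or.inr (by linarith)), Or.inr (Or.inr (by linarith))⟩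
  have k5 := key h''
  have hcc : -(2 * (N : ℝ) * i) + γ + N * c ≤ -(2 * N * i) + γ + N * c := le_rfl
  rcases lt_trichotomy (a : ℕ) i with h3 | h3 | h3
  · rw [hlt a (by omega), hgt b h'', hgt c h', hgt d h]
    refine ⟨Or.inr (Or.inl (by linarith)), Or.inr (Or.inl (by linarith)),
      Or.inr (Or.inr (by linarith)), Or.inr (Or.inr (by linarith))⟩
  · rw [heq a h3, hgt b h'', hgt c h', hgt d h]
    rw [← h3] at k5 k4 ⊢
    refine ⟨Or.inr (Or.inl (by linarith)), Or.inr (Or.inl (by linarith)),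
      Or.inr (Or.inr (by linarith)), Or.inr (Or.inr (by linarith))⟩
  · rw [hgt a h3, hgt b h'', hgt c h', hgt d h]
    refine ⟨Or.inr (Or.inl (by linarith)), Or.inr (Or.inl (by linarith)),
      Or.inr (Or.inr (by linarith)), Or.inr (Or.inr (by linarith))⟩

/-! ### Lattice triangles and coordinates in the charts -/

/-- The lattice points of a triangle. -/
def triangle (D : ℕ) : Finset (ℕ × ℕ) := {p ∈ Finset.range D ×ˢ Finset.range D | p.1 + p.2 < D}

lemma mem_triangle {D : ℕ} {p : ℕ × ℕ} : p ∈ triangle D ↔ p.1 + p.2 < D := by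
  simp only [triangle, Finset.mem_filter, Finset.mem_product, Finset.mem_range]
  omega

lemma two_mul_card_triangle (D : ℕ) : 2 * (triangle D).card = D * (D + 1) := by
  induction D with
  | zero => simp [triangle]
  | succ D ih =>
    have h : triangle (D + 1) = triangle D ∪ Finset.HasAntidiagonal.antidiagonal D := by
      ext p
      simp only [Finset.mem_union, mem_triangle, Finset.HasAntidiagonal.mem_antidiagonal]
      omega
    rw [h, Finset.card_union_of_disjoint, mul_add, ih, Finset.Nat.card_antidiagonal]
    · ring
    · rw [Finset.disjoint_left]
      intro p hp hp'
      rw [mem_triangle] at hp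
      rw [Finset.HasAntidiagonal.mem_antidiagonal] at hp'
      omega

/-- The planar direction `(a, b)` in the chart number `g` of the plane. -/
def chartDir {m : ℕ} (g : ℕ) (a b : ℤ) : Fin (m + 2) → ℤ :=
  fun j => if (j : ℕ) < g then 0 else if (j : ℕ) = g then -a else b - a

/-- The planar point `(X, Y)` in the chart number `g` of the plane. -/
def chartPos {m : ℕ} (N D g : ℕ) (X Y : ℝ) : Fin (m + 2) → ℝ :=
  fun j => if (j : ℕ) < g then -(2 * N * ((j : ℕ) + 1)) else
    if (j : ℕ) = g then -(2 * N * (g + 1)) - (X - D) else -(2 * N * (g + 1)) + (Y - X)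

lemma chartPos_add {m N D g : ℕ} {X Y t : ℝ} {a b : ℤ} (j : Fin (m + 2)) :
    chartPos N D g X Y j + t * (chartDir g a b j : ℝ) =
      chartPos N D g (X + t * a) (Y + t * b) j := by
  unfold chartPos chartDir
  split_ifs
  · simp
  · push_cast; ring
  · push_cast; ring

lemma chartPos_last {m N D g : ℕ} {X Y : ℝ} (hg : g ≤ m) :
    chartPos N D g X Y (Fin.last (m + 1)) = -(2 * N * (g + 1)) + (Y - X) := by
  rw [chartPos, if_neg (by simp; omega), if_neg (by simp; omega)]

lemma chartPos_self {m N D g : ℕ} {X Y : ℝ} {j : Fin (m + 2)} (hj : (j : ℕ) = g) :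
    chartPos N D g X Y j = -(2 * N * (g + 1)) - (X - D) := by
  rw [chartPos, if_neg (by omega), if_pos hj]

/-- The horizontal edge leaving the chart `g` is the horizontal edge entering the chart `g + 1`. -/
lemma chartPos_succ {m N D g : ℕ} {Y : ℝ} :
    (chartPos N D g D Y : Fin (m + 2) → ℝ) = chartPos N D (g + 1) (2 * D - Y - 2 * N) D := by
  ext j
  unfold chartPos
  rcases lt_trichotomy (j : ℕ) g with h | h | h
  · rw [if_pos h, if_pos (by omega)]
  · rw [if_neg (by omega), if_pos h, if_pos (by omega), h]
    ring
  · rw [if_neg (by omega), if_neg (by omega), if_neg (by omega)]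
    split_ifs <;> push_cast <;> ring

/-- For `g ≤ m` both `-a` and `b - a` occur among the coordinates. -/
lemma gcd_chartDir {m g : ℕ} (hg : g ≤ m) {a b : ℤ} (h : IsCoprime a b) :
    Finset.univ.gcd (chartDir g a b : Fin (m + 2) → ℤ) = 1 := by
  rw [← Finset.normalize_gcd, normalize_eq_one]
  have h1 : Finset.univ.gcd (chartDir g a b : Fin (m + 2) → ℤ) ∣ -a := by
    have := Finset.gcd_dvd (f := (chartDir g a b : Fin (m + 2) → ℤ))
      (Finset.mem_univ ⟨g, by omega⟩)
    simpa [chartDir] using this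
  have h2 : Finset.univ.gcd (chartDir g a b : Fin (m + 2) → ℤ) ∣ b - a := by
    have := Finset.gcd_dvd (f := (chartDir g a b : Fin (m + 2) → ℤ))
      (Finset.mem_univ ⟨g + 1, by omega⟩)
    simpa [chartDir] using this
  rw [dvd_neg] at h1
  exact h.isUnit_of_dvd' h1 ((dvd_sub_left h1).1 h2)

/-! The planar pieces -/

/-- The planar position of the vertex `(i, k)`. -/
def planarX (i k : ℕ) : ℝ := i - if i = 0 then (k : ℝ) * (k + 1) / 2 else 0

/-- The lattice length of the edge from `(i + 1, k)` to `(i, k)`. -/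
def planarLen (i k : ℕ) : ℝ := 1 + if i = 0 then (k : ℝ) * (k + 1) / 2 else 0

/-- The slope of the edge from `(i + 1, k)` to `(i, k)`. -/
def planarSlope (i k : ℕ) : ℤ := if k = 0 then i + 1 else 0

lemma planarLen_pos (i k : ℕ) : 0 < planarLen i k := by
  unfold planarLen
  split_ifs <;> positivity

lemma planarX_succ (i k : ℕ) : planarX (i + 1) k = i + 1 := by
  simp [planarX]

lemma planarX_sub_planarLen (i k : ℕ) : planarX (i + 1) k - planarLen i k = planarX i k := by
  rw [planarX_succ]
  unfold planarX planarLen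
  ring

lemma planarX_add_planarSlope (i k : ℕ) :
    planarX k (i + 1) + planarLen i k * planarSlope i k = planarX k i := by
  unfold planarX planarLen planarSlope
  rcases k with _ | k
  · simp
    ring
  · simp

/-- The piecewise linear function interpolating the triangular numbers. -/
def triInterp (y : ℝ) : ℝ :=
  (⌊y⌋₊ : ℝ) * (⌊y⌋₊ + 1) / 2 + (⌊y⌋₊ + 1) * (y - ⌊y⌋₊)

lemma triInterp_add {k : ℕ} {s : ℝ} (h0 : 0 ≤ s) (h1 : s < 1) :
    triInterp (k + s) = k * (k + 1) / 2 + (k + 1) * s := by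
  have : ⌊(k : ℝ) + s⌋₊ = k := by
    rw [Nat.floor_eq_iff (by positivity)]
    constructor <;> linarith
  rw [triInterp, this]
  ring

lemma triInterp_natCast (k : ℕ) : triInterp k = k * (k + 1) / 2 := by
  simpa using triInterp_add (k := k) le_rfl one_pos

/-- The first coordinate after straightening the planar graph to a square grid. -/
def straight (X Y : ℝ) : ℝ :=
  -- At height `Y ≥ 0` the segment from the bent side `X = -triInterp Y` to `X = 1` is rescaled to
  -- the unit interval; everything else is left fixed.
  open Classical in if X < 1 ∧ 0 ≤ Y then (X + triInterp Y) / (1 + triInterp Y) else X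

lemma straight_vertex (i k : ℕ) : straight (planarX i k) (planarX k i) = i := by
  unfold straight planarX
  rcases i with _ | i
  · rcases k with _ | k
    · simp [triInterp]
    · rw [if_pos]
      · simp only [if_true, Nat.cast_zero]
        rw [if_neg (by omega), sub_zero, triInterp_natCast]
        simp
      · constructor
        · simp only [if_true, Nat.cast_zero]
          have : (0 : ℝ) ≤ ((k + 1 : ℕ) : ℝ) * (((k + 1 : ℕ) : ℝ) + 1) / 2 := by positivity
          linarith
        · simp
          positivity
  · rw [if_neg]
    · simp
    · rintro ⟨h, -⟩
      simp at h
      have : (0 : ℝ) ≤ i := by positivity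
      linarith

lemma straight_edge {i k : ℕ} {t : ℝ} (h0 : 0 < t) (h1 : t < planarLen i k) :
    i < straight (planarX (i + 1) k - t) (planarX k (i + 1) + t * planarSlope i k) ∧
    straight (planarX (i + 1) k - t) (planarX k (i + 1) + t * planarSlope i k) < i + 1 := by
  rw [planarX_succ]
  unfold straight planarX planarLen planarSlope at *
  rcases k with _ | k
  · rw [if_neg]
    · simp at h1
      constructor <;> linarith
    · rintro ⟨h2, h3⟩
      simp at h1 h2 h3
      have : (0 : ℝ) ≤ i := by positivity
      nlinarith
  · rcases i with _ | i
    · simp only [Nat.succ_ne_zero, if_false, if_true, Int.cast_zero, mul_zero, sub_zero, add_zero,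
        Nat.cast_zero, zero_add] at h1 ⊢
      rw [if_pos ⟨by linarith, by positivity⟩, triInterp_natCast]
      have hp : 0 < 1 + ((k + 1 : ℕ) : ℝ) * (((k + 1 : ℕ) : ℝ) + 1) / 2 := by positivity
      rw [lt_div_iff₀ hp, div_lt_iff₀ hp]
      constructor <;> linarith
    · have : (0 : ℝ) ≤ i := by positivity
      simp at h1
      rw [if_neg]
      · constructor <;> linarith
      · rintro ⟨h2, -⟩
        push_cast at h2
        linarith

/-- For `k > 0` the edge is horizontal at height `k`. For `k = 0` it lies on the bent side `Y =
-triInterp X`, which is straightened to height `0`. -/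
lemma straight_edge_swap {i k : ℕ} {t : ℝ} (h0 : 0 < t) (h1 : t < planarLen i k) :
    straight (planarX k (i + 1) + t * planarSlope i k) (planarX (i + 1) k - t) = k := by
  rw [planarX_succ]
  have hi : (0 : ℝ) ≤ i := by positivity
  unfold straight planarX planarLen planarSlope at *
  rcases k with _ | k
  · simp at h1
    have h2 := triInterp_add (k := i) (s := 1 - t) (by linarith) (by linarith)
    rw [add_sub_assoc, if_pos]
    · rw [h2]
      simp
      left
      ring
    · simp
      constructor <;> nlinarith
  · rw [if_neg]
    · simp
    · rintro ⟨h2, h3⟩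
      simp at h2
      have : (0 : ℝ) ≤ k := by positivity
      linarith

/-- The triangular number `D (D + 1) / 2`. -/
def triNum (D : ℕ) : ℝ := D * (D + 1) / 2

lemma triNum_nonneg (D : ℕ) : 0 ≤ triNum D := by
  unfold triNum
  positivity

lemma triNum_mono {k D : ℕ} (h : k ≤ D) : triNum k ≤ triNum D := by
  unfold triNum
  have h1 : (k : ℝ) ≤ D := by exact_mod_cast h
  have h2 : (0 : ℝ) ≤ k := by positivity
  nlinarith

lemma planarX_le (i k : ℕ) : planarX i k ≤ i := by
  unfold planarX
  split_ifs
  · have := triNum_nonneg k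
    unfold triNum at this
    linarith
  · simp

lemma neg_triNum_le_planarX {i k D : ℕ} (h : k ≤ D) : -triNum D ≤ planarX i k := by
  have h1 := triNum_mono h
  have h2 := triNum_nonneg D
  have h3 : (0 : ℝ) ≤ i := by positivity
  unfold planarX
  split_ifs
  · unfold triNum at *
    linarith
  · linarith

lemma planarX_lt {i k i' k' : ℕ} (h : i < i') : planarX i k < planarX i' k' := by
  refine (planarX_le i k).trans_lt ?_
  unfold planarX
  rw [if_neg (by omega), sub_zero]
  exact_mod_cast h

lemma planarX_zero (D : ℕ) : planarX 0 D = -triNum D := by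
  simp [planarX, triNum]

lemma planarX_zero_right (D : ℕ) : planarX D 0 = D := by
  simp [planarX]

/-- The region containing the vertices and the bounded edges of the planar graph. -/
def Inside (D : ℕ) (X Y : ℝ) : Prop :=
  (-triNum D ≤ X ∧ X ≤ D) ∧ (-triNum D ≤ Y ∧ Y ≤ D) ∧ (1 ≤ X → 1 ≤ Y → X + Y ≤ D)

/-- The region containing the diagonal rays of the planar graph. -/
def Outside (D : ℕ) (X Y : ℝ) : Prop :=
  -triNum D ≤ X ∧ -triNum D ≤ Y ∧ (D < X ∨ D < Y ∨ (1 ≤ X ∧ 1 ≤ Y ∧ D < X + Y))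

lemma Inside.symm {D : ℕ} {X Y : ℝ} (h : Inside D X Y) : Inside D Y X :=
  ⟨h.2.1, h.1, fun h1 h2 => by linarith [h.2.2 h2 h1]⟩

lemma Inside.not_outside {D : ℕ} {X Y : ℝ} (h : Inside D X Y) : ¬ Outside D X Y := by
  rintro ⟨-, -, h' | h' | ⟨h1, h2, h3⟩⟩
  · linarith [h.1.2]
  · linarith [h.2.1.2]
  · linarith [h.2.2 h1 h2]

lemma inside_vertex {D i k : ℕ} (h : i + k ≤ D) : Inside D (planarX i k) (planarX k i) := by
  have h1 : (i : ℝ) + k ≤ D := by exact_mod_cast h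
  have h2 : (0 : ℝ) ≤ i := by positivity
  have h3 : (0 : ℝ) ≤ k := by positivity
  have h4 := planarX_le i k
  have h5 := planarX_le k i
  exact ⟨⟨neg_triNum_le_planarX (by omega), by linarith⟩,
    ⟨neg_triNum_le_planarX (by omega), by linarith⟩, fun _ _ => by linarith⟩

lemma inside_edge {D i k : ℕ} {t : ℝ} (h : i + k < D) (h0 : 0 < t) (h1 : t < planarLen i k) :
    Inside D (planarX (i + 1) k - t) (planarX k (i + 1) + t * planarSlope i k) := by
  have a := inside_vertex (D := D) (i := i + 1) (k := k) (by omega)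
  have b := inside_vertex (D := D) (i := i) (k := k) (by omega)
  have e1 := planarX_sub_planarLen i k
  have e2 := planarX_add_planarSlope i k
  have hs : (0 : ℝ) ≤ planarSlope i k := by
    unfold planarSlope
    split_ifs <;> push_cast <;> positivity
  have hle : t * planarSlope i k ≤ planarLen i k * planarSlope i k := by gcongr
  have hle' : 0 ≤ t * planarSlope i k := by positivity
  refine ⟨⟨by linarith [b.1.1], by linarith [a.1.2]⟩, ⟨by linarith [a.2.1.1], by linarith [b.2.1.2]⟩,
    fun _ hY => ?_⟩
  have h2 := planarX_le k i
  have h3 : (i : ℝ) + 1 + k ≤ D := by exact_mod_cast (by omega : i + 1 + k ≤ D)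
  have h4 := planarX_le (i + 1) k
  push_cast at h4
  linarith

lemma outside_ray {D i : ℕ} {t : ℝ} (h : i ≤ D) (h0 : 0 < t) :
    Outside D (planarX i (D - i) + t) (planarX (D - i) i + t) := by
  have a := inside_vertex (D := D) (i := i) (k := D - i) (by omega)
  refine ⟨by linarith [a.1.1], by linarith [a.2.1.1], ?_⟩
  rcases Nat.eq_zero_or_pos i with rfl | hi
  · right; left
    rw [Nat.sub_zero, planarX_zero_right]
    linarith
  rcases h.lt_or_eq with hD | rfl
  · right; right
    unfold planarX
    rw [if_neg (by omega), if_neg (by omega), Nat.cast_sub h]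
    have h1 : (1 : ℝ) ≤ i := by exact_mod_cast hi
    have h2 : (i : ℝ) + 1 ≤ D := by exact_mod_cast hD
    refine ⟨by linarith, by linarith, by linarith⟩
  · left
    rw [Nat.sub_self, planarX_zero_right]
    linarith

/-- The open cells of the square grid. -/
def GridCell (i k : ℕ) (u w : ℝ) : Option Bool → Prop
  | none => u = i ∧ w = k
  | some true => (i < u ∧ u < i + 1) ∧ w = k
  | some false => u = i ∧ k < w ∧ w < k + 1

lemma GridCell.bounds {i k : ℕ} {u w : ℝ} {κ : Option Bool} (h : GridCell i k u w κ) :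
    (i ≤ u ∧ u < i + 1) ∧ k ≤ w ∧ w < k + 1 := by
  rcases κ with _ | _ | _
  · exact ⟨⟨h.1.ge, by linarith [h.1]⟩, h.2.ge, by linarith [h.2]⟩
  · exact ⟨⟨h.1.ge, by linarith [h.1]⟩, h.2.1.le, h.2.2⟩
  · exact ⟨⟨h.1.1.le, h.1.2⟩, h.2.ge, by linarith [h.2]⟩

lemma GridCell.unique {i k i' k' : ℕ} {u w : ℝ} {κ κ' : Option Bool} (h : GridCell i k u w κ)
    (h' : GridCell i' k' u w κ') : κ = κ' ∧ i = i' ∧ k = k' := by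
  have key : ∀ {a b : ℕ} {x : ℝ}, (a ≤ x ∧ x < a + 1) → (b ≤ x ∧ x < b + 1) → a = b := by
    intro a b x h h'
    have h1 : (a : ℝ) < b + 1 := by linarith
    have h2 : (b : ℝ) < a + 1 := by linarith
    norm_cast at h1 h2
    omega
  obtain rfl := key h.bounds.1 h'.bounds.1
  obtain rfl := key h.bounds.2 h'.bounds.2
  refine ⟨?_, rfl, rfl⟩
  rcases κ with _ | _ | _ <;> rcases κ' with _ | _ | _ <;> simp only [GridCell] at h h' <;>
    first | rfl | (exfalso; linarith [h.1, h.2, h'.1, h'.2])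

/-- The pieces of the planar graph: its vertices and bounded edges, and its diagonal rays. -/
def Piece (D : ℕ) (X Y : ℝ) : (Option Bool × ℕ × ℕ) ⊕ ℕ → Prop
  | Sum.inl p => Inside D X Y ∧ GridCell p.2.1 p.2.2 (straight X Y) (straight Y X) p.1
  | Sum.inr i => Outside D X Y ∧ i ≤ D ∧ X - Y = planarX i (D - i) - planarX (D - i) i

/-- Bounded pieces go to disjoint open cells of the grid. Rays all have slope one and are told apart
by `X - Y`, which increases with `i`; the regions `Inside` and `Outside` are disjoint. -/
lemma Piece.unique {D : ℕ} {X Y : ℝ} {j j' : (Option Bool × ℕ × ℕ) ⊕ ℕ} (h : Piece D X Y j)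
    (h' : Piece D X Y j') : j = j' := by
  have key : ∀ {i i' : ℕ}, i' ≤ D → i < i' →
      planarX i (D - i) - planarX (D - i) i < planarX i' (D - i') - planarX (D - i') i' := by
    intro i i' hD h
    have h1 := planarX_lt (k := D - i) (k' := D - i') h
    have h2 := planarX_lt (i := D - i') (i' := D - i) (k := i') (k' := i) (by omega)
    linarith
  rcases j with ⟨κ, i, k⟩ | i <;> rcases j' with ⟨κ', i', k'⟩ | i'
  · obtain ⟨rfl, h1, h2⟩ := h.2.unique h'.2
    simp only at h1 h2
    rw [h1, h2]
  · exact absurd h'.1 h.1.not_outside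
  · exact absurd h.1 h'.1.not_outside
  · rcases lt_trichotomy i i' with hl | rfl | hl
    · linarith [key h'.2.1 hl, h.2.2, h'.2.2]
    · rfl
    · linarith [key h.2.1 hl, h.2.2, h'.2.2]

lemma Piece.bounds {D : ℕ} {X Y : ℝ} {j : (Option Bool × ℕ × ℕ) ⊕ ℕ} (h : Piece D X Y j) :
    -triNum D ≤ X ∧ -triNum D ≤ Y ∧ |X - Y| ≤ D + triNum D := by
  rcases j with ⟨κ, i, k⟩ | i
  · obtain ⟨⟨⟨h1, h2⟩, ⟨h3, h4⟩, -⟩, -⟩ := h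
    exact ⟨h1, h3, abs_le.2 ⟨by linarith, by linarith⟩⟩
  · obtain ⟨⟨h1, h2, -⟩, hi, h3⟩ := h
    obtain ⟨⟨a1, a2⟩, ⟨a3, a4⟩, -⟩ := inside_vertex (D := D) (i := i) (k := D - i) (by omega)
    exact ⟨h1, h2, abs_le.2 ⟨by linarith, by linarith⟩⟩

lemma piece_vertex {D i k : ℕ} (h : i + k ≤ D) :
    Piece D (planarX i k) (planarX k i) (Sum.inl (none, i, k)) :=
  ⟨inside_vertex h, straight_vertex i k, straight_vertex k i⟩

lemma piece_horizontal {D i k : ℕ} {t : ℝ} (h : i + k < D) (h0 : 0 < t) (h1 : t < planarLen i k) :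
    Piece D (planarX (i + 1) k - t) (planarX k (i + 1) + t * planarSlope i k)
      (Sum.inl (some true, i, k)) :=
  ⟨inside_edge h h0 h1, straight_edge h0 h1, straight_edge_swap h0 h1⟩

lemma piece_vertical {D i k : ℕ} {t : ℝ} (h : i + k < D) (h0 : 0 < t) (h1 : t < planarLen k i) :
    Piece D (planarX i (k + 1) + t * planarSlope k i) (planarX (k + 1) i - t)
      (Sum.inl (some false, i, k)) :=
  ⟨(inside_edge (by omega) h0 h1).symm, straight_edge_swap h0 h1, straight_edge h0 h1⟩

lemma piece_ray {D i : ℕ} {t : ℝ} (h : i ≤ D) (h0 : 0 < t) :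
    Piece D (planarX i (D - i) + t) (planarX (D - i) i + t) (Sum.inr i) :=
  ⟨outside_ray h h0, h, by ring⟩

/-! Zones of the plane separating the charts -/

/-- A scale at which distinct charts are far apart. -/
def scale (D : ℕ) : ℕ := D + D * (D + 1) + 1

lemma lt_scale (D : ℕ) : D + triNum D < scale D := by
  unfold scale triNum
  push_cast
  have : (0 : ℝ) ≤ D := by positivity
  nlinarith

/-- The zone `2 g + 1` contains the planar graph of the chart `g`, and the zone `2 g` the edge
entering this chart. -/
def Zone (m D z : ℕ) (L : ℝ) : Prop :=
  ∀ g : ℕ, g ≤ m →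
    (z ≤ 2 * g → L < 2 * scale D * (g + 1) - (D + triNum D)) ∧
    (z ≤ 2 * g + 1 → L ≤ 2 * scale D * (g + 1) + (D + triNum D)) ∧
    (2 * g + 1 ≤ z → 2 * scale D * (g + 1) - (D + triNum D) ≤ L) ∧
    (2 * g + 2 ≤ z → 2 * scale D * (g + 1) + (D + triNum D) < L)

/-- If `z < z'`, the upper bound imposed by `z` at the chart `z / 2` contradicts the lower bound
imposed there by `z'`; the parity of `z` selects the pair of bounds. -/
lemma Zone.le {m D z z' : ℕ} {L : ℝ} (hz : Zone m D z L) (hz' : Zone m D z' L)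
    (hm : z' ≤ 2 * m + 2) : z' ≤ z := by
  by_contra! h
  rcases Nat.even_or_odd' z with ⟨g, rfl | rfl⟩
  · linarith [(hz g (by omega)).1 le_rfl, (hz' g (by omega)).2.2.1 h]
  · linarith [(hz g (by omega)).2.1 le_rfl, (hz' g (by omega)).2.2.2 h]

lemma Zone.unique {m D z z' : ℕ} {L : ℝ} (hz : Zone m D z L) (hz' : Zone m D z' L)
    (hm : z ≤ 2 * m + 2) (hm' : z' ≤ 2 * m + 2) : z = z' :=
  le_antisymm (hz'.le hz hm) (hz.le hz' hm')

lemma scale_gap (D : ℕ) {g g' : ℕ} (h : g < g') :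
    2 * (scale D : ℝ) * (g + 1) + 2 * scale D ≤ 2 * scale D * (g' + 1) := by
  have h1 : (g : ℝ) + 1 ≤ g' := by exact_mod_cast h
  have h2 : (0 : ℝ) ≤ scale D := by positivity
  nlinarith

lemma zone_odd {m D g : ℕ} {L : ℝ} (h : |L - 2 * scale D * (g + 1)| ≤ D + triNum D) :
    Zone m D (2 * g + 1) L := by
  intro g' _
  obtain ⟨h1, h2⟩ := abs_le.1 h
  have hs := lt_scale D
  rcases lt_trichotomy g g' with hl | rfl | hl
  · have := scale_gap D hl
    exact ⟨fun _ => by linarith, fun _ => by linarith, fun _ => by omega, fun _ => by omega⟩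
  · exact ⟨fun _ => by omega, fun _ => by linarith, fun _ => by linarith, fun _ => by omega⟩
  · have := scale_gap D hl
    exact ⟨fun _ => by omega, fun _ => by omega, fun _ => by linarith, fun _ => by linarith⟩

lemma zone_even {m D g : ℕ} {L : ℝ} (h : 2 * scale D * (g + 1) + (D + triNum D) < L)
    (h' : g < m → L < 2 * scale D * (g + 1) + 2 * scale D - (D + triNum D)) :
    Zone m D (2 * g + 2) L := by
  intro g' hg'
  have hs := lt_scale D
  have ht := triNum_nonneg D
  have hD : (0 : ℝ) ≤ D := by positivity
  rcases lt_or_ge g g' with hl | hl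
  · have := scale_gap D hl
    have := h' (by omega)
    exact ⟨fun _ => by linarith, fun _ => by linarith, fun _ => by omega, fun _ => by omega⟩
  · rcases hl.lt_or_eq with hl | rfl
    · have := scale_gap D hl
      exact ⟨fun _ => by omega, fun _ => by omega, fun _ => by linarith, fun _ => by linarith⟩
    · exact ⟨fun _ => by omega, fun _ => by omega, fun _ => by linarith, fun _ => by linarith⟩

lemma zone_zero {m D : ℕ} {L : ℝ} (h : L < 2 * scale D - (D + triNum D)) : Zone m D 0 L := by
  intro g _
  have hs := lt_scale D
  have ht := triNum_nonneg D
  have hD : (0 : ℝ) ≤ D := by positivity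
  have : 2 * (scale D : ℝ) ≤ 2 * scale D * (g + 1) := by
    have : (0 : ℝ) ≤ g := by positivity
    have : (0 : ℝ) ≤ scale D := by positivity
    nlinarith
  exact ⟨fun _ => by linarith, fun _ => by linarith, fun _ => by omega, fun _ => by omega⟩

/-! ### Combinatorial data of the chain of curves -/

/-- Vertices of the curve. -/
abbrev CV (m D : ℕ) : Type := Fin (m + 1) × triangle (D + 1)

/-- Bounded edges of the curve: horizontal ones, vertical ones, and those joining two charts. -/
abbrev CE (m D : ℕ) : Type := (Fin (m + 1) × triangle D) ⊕ (Fin (m + 1) × triangle D) ⊕ Fin m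

/-- Unbounded edges of the curve: diagonal ones, and the two ends of the chain of charts. -/
abbrev CR (m D : ℕ) : Type := (Fin (m + 1) × Fin (D + 1)) ⊕ Bool

/-- The vertex `(i, k)` of the chart `g`. -/
def vtx {m D : ℕ} (g : Fin (m + 1)) (i k : ℕ) (h : i + k ≤ D) : CV m D :=
  (g, ⟨(i, k), mem_triangle.2 (Nat.lt_succ_of_le h)⟩)

lemma vtx_eta {m D : ℕ} (v : CV m D) :
    v = vtx v.1 v.2.1.1 v.2.1.2 (Nat.le_of_lt_succ (mem_triangle.1 v.2.2)) := rfl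

/-- Positions of the vertices. -/
def cpos {m D : ℕ} (v : CV m D) : Fin (m + 2) → ℝ :=
  chartPos (scale D) D v.1 (planarX v.2.1.1 v.2.1.2) (planarX v.2.1.2 v.2.1.1)

/-- Sources of the bounded edges. -/
def csrc {m D : ℕ} : CE m D → CV m D
  | Sum.inl e => vtx e.1 (e.2.1.1 + 1) e.2.1.2 (by have := mem_triangle.1 e.2.2; omega)
  | Sum.inr (Sum.inl e) => vtx e.1 e.2.1.1 (e.2.1.2 + 1) (by have := mem_triangle.1 e.2.2; omega)
  | Sum.inr (Sum.inr g) => vtx g.castSucc D 0 le_rfl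

/-- Targets of the bounded edges. -/
def ctgt {m D : ℕ} : CE m D → CV m D
  | Sum.inl e => vtx e.1 e.2.1.1 e.2.1.2 (mem_triangle.1 e.2.2).le
  | Sum.inr (Sum.inl e) => vtx e.1 e.2.1.1 e.2.1.2 (mem_triangle.1 e.2.2).le
  | Sum.inr (Sum.inr g) => vtx g.succ 0 D (zero_add D).le

/-- Directions of the bounded edges. -/
def cdir {m D : ℕ} : CE m D → Fin (m + 2) → ℤ
  | Sum.inl e => chartDir e.1 (-1) (planarSlope e.2.1.1 e.2.1.2)
  | Sum.inr (Sum.inl e) => chartDir e.1 (planarSlope e.2.1.2 e.2.1.1) (-1)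
  | Sum.inr (Sum.inr g) => chartDir g 0 (-1)

/-- Lattice lengths of the bounded edges. -/
def clen {m D : ℕ} : CE m D → ℝ
  | Sum.inl e => planarLen e.2.1.1 e.2.1.2
  | Sum.inr (Sum.inl e) => planarLen e.2.1.2 e.2.1.1
  | Sum.inr (Sum.inr _) => 2 * scale D - 2 * (D + triNum D)

/-- Endpoints of the unbounded edges. -/
def cbase {m D : ℕ} : CR m D → CV m D
  | Sum.inl r => vtx r.1 r.2 (D - r.2) (by omega)
  | Sum.inr true => vtx 0 0 D (zero_add D).le
  | Sum.inr false => vtx (Fin.last m) D 0 le_rfl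

/-- Directions of the unbounded edges. -/
def crdir {m D : ℕ} : CR m D → Fin (m + 2) → ℤ
  | Sum.inl r => chartDir r.1 1 1
  | Sum.inr true => chartDir 0 (-1) 0
  | Sum.inr false => chartDir m 0 (-1)

/-- Weights of the bounded edges. -/
def cweight {m D : ℕ} (μ : ℕ) : CE m D → ℕ
  | Sum.inl _ => μ
  | Sum.inr (Sum.inl _) => μ
  | Sum.inr (Sum.inr _) => μ * (D + 1)

/-- Weights of the unbounded edges. -/
def crweight {m D : ℕ} (μ : ℕ) : CR m D → ℕ
  | Sum.inl _ => μ
  | Sum.inr _ => μ * (D + 1)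

/-- The zone containing a cell. -/
def czone {m D : ℕ} : CV m D ⊕ CE m D ⊕ CR m D → ℕ
  | Sum.inl v => 2 * v.1 + 1
  | Sum.inr (Sum.inl (Sum.inl e)) => 2 * e.1 + 1
  | Sum.inr (Sum.inl (Sum.inr (Sum.inl e))) => 2 * e.1 + 1
  | Sum.inr (Sum.inl (Sum.inr (Sum.inr g))) => 2 * g + 2
  | Sum.inr (Sum.inr (Sum.inl r)) => 2 * r.1 + 1
  | Sum.inr (Sum.inr (Sum.inr true)) => 0
  | Sum.inr (Sum.inr (Sum.inr false)) => 2 * m + 2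

/-- The planar piece corresponding to a cell. -/
def cpiece {m D : ℕ} : CV m D ⊕ CE m D ⊕ CR m D → (Option Bool × ℕ × ℕ) ⊕ ℕ
  | Sum.inl v => Sum.inl (none, v.2.1)
  | Sum.inr (Sum.inl (Sum.inl e)) => Sum.inl (some true, e.2.1)
  | Sum.inr (Sum.inl (Sum.inr (Sum.inl e))) => Sum.inl (some false, e.2.1)
  | Sum.inr (Sum.inl (Sum.inr (Sum.inr _))) => Sum.inr 0
  | Sum.inr (Sum.inr (Sum.inl r)) => Sum.inr r.2
  | Sum.inr (Sum.inr (Sum.inr _)) => Sum.inr 0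

lemma czone_le {m D : ℕ} (a : CV m D ⊕ CE m D ⊕ CR m D) : czone a ≤ 2 * m + 2 := by
  rcases a with v | (e | e | g) | r | (_ | _) <;> simp only [czone] <;> omega

/-! ### Disjointness of the cells and membership in the plane -/

/-- The points of the charts, of the edges leaving a chart, and of the first end of the chain. -/
inductive Located (m D : ℕ) (x : Fin (m + 2) → ℝ) : ℕ → (Option Bool × ℕ × ℕ) ⊕ ℕ → Prop
  | chart (g : ℕ) (hg : g ≤ m) (X Y : ℝ) (j) (hx : x = chartPos (scale D) D g X Y)
    (h : Piece D X Y j) : Located m D x (2 * g + 1) j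
  | leaving (g : ℕ) (hg : g ≤ m) (t : ℝ) (ht : 0 < t)
    (ht' : g < m → t < 2 * scale D - 2 * (D + triNum D))
    (hx : x = chartPos (scale D) D g D (-triNum D - t)) : Located m D x (2 * g + 2) (Sum.inr 0)
  | initial (t : ℝ) (ht : 0 < t) (hx : x = chartPos (scale D) D 0 (-triNum D - t) D) :
    Located m D x 0 (Sum.inr 0)

lemma located {m D : ℕ} {x : Fin (m + 2) → ℝ} {a : CV m D ⊕ CE m D ⊕ CR m D}
    (hx : x ∈ openCell cpos csrc cdir clen cbase crdir a) : Located m D x (czone a) (cpiece a) := by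
  rcases a with ⟨g, p, hp⟩ | (⟨g, p, hp⟩ | ⟨g, p, hp⟩ | g) | ⟨g, i⟩ | (_ | _)
  · rw [mem_triangle] at hp
    exact .chart g (by omega) _ _ _ hx (piece_vertex (Nat.le_of_lt_succ hp))
  · rw [mem_triangle] at hp
    obtain ⟨t, ⟨h0, h1⟩, rfl⟩ := hx
    refine .chart g (by omega) _ _ _ (funext fun j => chartPos_add j) ?_
    have := piece_horizontal hp h0 h1
    simpa [csrc, vtx, cpiece, sub_eq_add_neg] using this
  · rw [mem_triangle] at hp
    obtain ⟨t, ⟨h0, h1⟩, rfl⟩ := hx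
    refine .chart g (by omega) _ _ _ (funext fun j => chartPos_add j) ?_
    have := piece_vertical hp h0 h1
    simpa [csrc, vtx, cpiece, sub_eq_add_neg] using this
  · obtain ⟨t, ⟨h0, h1⟩, rfl⟩ := hx
    refine .leaving g (by omega) t h0 (fun _ => h1) ((funext fun j => chartPos_add j).trans ?_)
    simp [csrc, vtx, planarX_zero, planarX_zero_right, sub_eq_add_neg]
  · obtain ⟨t, h0, rfl⟩ := hx
    refine .chart g (by omega) _ _ _ (funext fun j => chartPos_add j) ?_
    have := piece_ray (D := D) (i := i) (by omega) h0
    simpa [cbase, vtx, cpiece] using this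
  · obtain ⟨t, h0, rfl⟩ := hx
    refine .leaving m le_rfl t h0 (fun h => absurd h (lt_irrefl m))
      ((funext fun j => chartPos_add j).trans ?_)
    simp [cbase, vtx, planarX_zero, planarX_zero_right, sub_eq_add_neg]
  · obtain ⟨t, h0, rfl⟩ := hx
    refine .initial t h0 ((funext fun j => chartPos_add j).trans ?_)
    simp [cbase, vtx, planarX_zero, planarX_zero_right, sub_eq_add_neg]

/-- In the chart `g` the negated last coordinate is `2 * scale D * (g + 1) + X - Y`, and `|X - Y|`
is bounded on the pieces. Along the edges between charts it moves from one band to the next. -/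
lemma Located.zone {m D z : ℕ} {x : Fin (m + 2) → ℝ} {j} (h : Located m D x z j) :
    Zone m D z (-x (Fin.last (m + 1))) := by
  rcases h with ⟨g, hg, X, Y, j, hx, h⟩ | ⟨g, hg, t, ht, ht', hx⟩ | ⟨t, ht, hx⟩
  · apply zone_odd
    rw [hx, chartPos_last hg, neg_add, neg_neg, neg_sub, add_sub_cancel_left]
    exact h.bounds.2.2
  · apply zone_even
    · rw [hx, chartPos_last hg]
      linarith
    · intro h
      rw [hx, chartPos_last hg]
      linarith [ht' h]
  · apply zone_zero
    rw [hx, chartPos_last (Nat.zero_le m)]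
    push_cast
    linarith

/-- The zone determines the chart, whose coordinates `X`, `Y` can be recovered from the entries `g`
and last, and `Piece.unique` applies. An even zone contains a single edge or end. -/
lemma Located.unique {m D z z' : ℕ} {x : Fin (m + 2) → ℝ} {j j'} (h : Located m D x z j)
    (h' : Located m D x z' j') (hz : z ≤ 2 * m + 2) (hz' : z' ≤ 2 * m + 2) : z = z' ∧ j = j' := by
  have e := h.zone.unique h'.zone hz hz'
  refine ⟨e, ?_⟩
  rcases h with ⟨g, hg, X, Y, j, hx, h⟩ | ⟨g, hg, t, ht, ht', hx⟩ | ⟨t, ht, hx⟩ <;>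
  rcases h' with ⟨g', hg', X', Y', j', hx', h'⟩ | ⟨g', hg', t', ht'', ht''', hx'⟩ | ⟨t', ht'', hx'⟩ <;>
  first | rfl | (exfalso; omega) | skip
  obtain rfl : g = g' := by omega
  have h1 := congrFun (hx.symm.trans hx') (Fin.last (m + 1))
  have h2 := congrFun (hx.symm.trans hx') ⟨g, by omega⟩
  rw [chartPos_last hg, chartPos_last hg] at h1
  rw [chartPos_self (g := g) rfl, chartPos_self (g := g) rfl] at h2
  obtain rfl : X = X' := by linarith
  obtain rfl : Y = Y' := by linarith
  exact h.unique h'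

lemma czone_cpiece_injective {m D : ℕ} {a b : CV m D ⊕ CE m D ⊕ CR m D} (h : czone a = czone b)
    (h' : cpiece a = cpiece b) : a = b := by
  rcases a with ⟨g, p⟩ | (⟨g, p⟩ | ⟨g, p⟩ | g) | ⟨g, i⟩ | (_ | _) <;>
  rcases b with ⟨g', p'⟩ | (⟨g', p'⟩ | ⟨g', p'⟩ | g') | ⟨g', i'⟩ | (_ | _) <;>
  simp only [czone, cpiece, Sum.inl.injEq, Sum.inr.injEq, Prod.mk.injEq, reduceCtorEq,
    Option.some.injEq, Bool.true_eq_false, Bool.false_eq_true, false_and, true_and] at h h' ⊢ <;>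
  first
  | omega
  | exact ⟨Fin.ext (by omega), Subtype.ext h'⟩

/-- Up to a common constant, the parameters `(α, β, γ)` of `mem_planeSet` at the tree vertex `g + 1`
are `(X, D, Y)`. -/
lemma mem_planeSet_chart {m D g : ℕ} {X Y : ℝ} (hS : g ≠ 0 → D - scale D ≤ X ∧ Y - X ≤ scale D)
    (hT : g < m → D - scale D ≤ Y ∧ X - Y ≤ scale D) :
    (Fin.cons 0 (chartPos (scale D) D g X Y) : Fin (m + 3) → ℝ) ∈ planeSet (m + 2) (scale D) := by
  refine mem_planeSet (i := g + 1) (α := 0) (β := D - X) (γ := Y - X) (fun h => ?_) (fun h => ?_)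
    (fun j h => ?_) (fun j h => ?_) (fun j h => ?_)
  · have := hS (by omega)
    constructor <;> linarith
  · have := hT (by omega)
    constructor <;> linarith
  all_goals
    refine Fin.cases (fun h => ?_) (fun j h => ?_) j h <;>
    simp at h ⊢
  · rw [chartPos, if_pos h]
  · rw [chartPos, if_neg (by omega), if_pos h, h]
    ring
  · rw [chartPos, if_neg (by omega), if_neg (by omega)]

lemma Located.mem_planeSet {m D z : ℕ} {x : Fin (m + 2) → ℝ} {j} (h : Located m D x z j) :
    (Fin.cons 0 x : Fin (m + 3) → ℝ) ∈ planeSet (m + 2) (scale D) := by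
  have hs := lt_scale D
  have ht := triNum_nonneg D
  have hD : (0 : ℝ) ≤ D := by positivity
  rcases h with ⟨g, hg, X, Y, j, hx, h⟩ | ⟨g, hg, t, ht, ht', hx⟩ | ⟨t, ht, hx⟩
  · obtain ⟨h1, h2, h3⟩ := h.bounds
    obtain ⟨h3, h4⟩ := abs_le.1 h3
    rw [hx]
    exact mem_planeSet_chart (fun _ => ⟨by linarith, by linarith⟩)
      (fun _ => ⟨by linarith, by linarith⟩)
  · by_cases hl : g < m → D + triNum D + t ≤ scale D
    · rw [hx]
      exact mem_planeSet_chart (fun _ => ⟨by linarith, by linarith⟩)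
        (fun h => ⟨by linarith [hl h], by linarith [hl h]⟩)
    · push Not at hl
      obtain ⟨h1, h2⟩ := hl
      have h3 := ht' h1
      rw [hx, chartPos_succ]
      exact mem_planeSet_chart (fun _ => ⟨by linarith, by linarith⟩)
        (fun _ => ⟨by linarith, by linarith⟩)
  · rw [hx]
    exact mem_planeSet_chart (fun h => absurd rfl h) (fun _ => ⟨by linarith, by linarith⟩)

/-! ### The balancing condition -/

lemma sum_filter_eq_ite {α M : Type*} [Fintype α] [AddCommMonoid M] {P : α → Prop}
    [DecidablePred P] {f : α → M} (c : M) (Q : Prop) [Decidable Q]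
    (h1 : ∀ a b, P a → P b → a = b) (h2 : Q → ∃ a, P a) (h3 : ∀ a, P a → Q ∧ f a = c) :
    ∑ a with P a, f a = if Q then c else 0 := by
  split_ifs with hQ
  · obtain ⟨a, ha⟩ := h2 hQ
    rw [Finset.sum_eq_single_of_mem a (by simpa using ha), (h3 a ha).2]
    intro b hb hne
    exact absurd (h1 b a (by simpa using hb) ha) hne
  · refine Finset.sum_eq_zero fun a ha => absurd (h3 a (by simpa using ha)).1 hQ

lemma sum_filter_sum {α β M : Type*} [Fintype α] [Fintype β] [AddCommMonoid M] {P : α ⊕ β → Prop}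
    [DecidablePred P] {f : α ⊕ β → M} :
    ∑ a with P a, f a = ∑ a with P (Sum.inl a), f (Sum.inl a) + ∑ b with P (Sum.inr b), f (Sum.inr b) := by
  simp only [Finset.sum_filter, Fintype.sum_sum_type]

lemma eq_vtx {m D : ℕ} {v : CV m D} {g : Fin (m + 1)} {i k : ℕ} {h : i + k ≤ D}
    (hg : (v.1 : ℕ) = g) (hi : v.2.1.1 = i) (hk : v.2.1.2 = k) : v = vtx g i k h := by
  exact Prod.ext (Fin.ext hg) (Subtype.ext (Prod.ext hi hk))

lemma of_eq_vtx {m D : ℕ} {v : CV m D} {g : Fin (m + 1)} {i k : ℕ} {h : i + k ≤ D}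
    (hv : v = vtx g i k h) : (v.1 : ℕ) = g ∧ v.2.1.1 = i ∧ v.2.1.2 = k := by
  rw [hv]
  exact ⟨rfl, rfl, rfl⟩

lemma chartDir_smul {m g : ℕ} (w a b : ℤ) :
    w • (chartDir g a b : Fin (m + 2) → ℤ) = chartDir g (w * a) (w * b) := by
  ext j
  simp only [Pi.smul_apply, chartDir, smul_eq_mul]
  split_ifs <;> ring

lemma chartDir_add {m g : ℕ} (a b a' b' : ℤ) :
    (chartDir g a b + chartDir g a' b' : Fin (m + 2) → ℤ) = chartDir g (a + a') (b + b') := by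
  ext j
  simp only [Pi.add_apply, chartDir]
  split_ifs <;> ring

lemma chartDir_neg {m g : ℕ} (a b : ℤ) :
    -(chartDir g a b : Fin (m + 2) → ℤ) = chartDir g (-a) (-b) := by
  ext j
  simp only [Pi.neg_apply, chartDir]
  split_ifs <;> ring

lemma chartDir_zero {m g : ℕ} : (chartDir g 0 0 : Fin (m + 2) → ℤ) = 0 := by
  ext j
  simp [chartDir]

lemma chartDir_succ {m g : ℕ} (b : ℤ) :
    (chartDir g 0 b : Fin (m + 2) → ℤ) = chartDir (g + 1) (-b) 0 := by
  ext j
  simp only [chartDir]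
  split_ifs <;> omega

lemma ite_chartDir {m g : ℕ} (Q : Prop) [Decidable Q] (a b : ℤ) :
    (if Q then chartDir g a b else 0 : Fin (m + 2) → ℤ) =
      chartDir g (if Q then a else 0) (if Q then b else 0) := by
  split_ifs
  · rfl
  · rw [chartDir_zero]

/-- This is balancing in the first planar coordinate; the second follows by exchanging `i` and `k`.
On the bent side consecutive slopes are `k` and `k + 1`, which leaves `-1` against the horizontal
edge; at the corner `(0, D)` the end of weight `D + 1` compensates. -/
lemma planar_balance {D i k : ℕ} (h : i + k ≤ D) :
    (if i ≠ 0 then (-1 : ℤ) else 0) + (if k ≠ 0 then planarSlope (k - 1) i else 0) +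
      (if i + k < D then 1 else 0) +
      (if i + k < D then -planarSlope k i else 0) + (if i + k = D then 1 else 0) +
      (if i = 0 ∧ k = D then -((D : ℤ) + 1) else 0) = 0 := by
  unfold planarSlope
  rcases i with _ | i
  · rcases k with _ | k
    · simp
      split_ifs <;> omega
    · simp
      split_ifs <;> omega
  · simp
    split_ifs <;> omega

section balance

variable {m D : ℕ} (μ : ℕ) {g : Fin (m + 1)} {i k : ℕ} (h : i + k ≤ D)

lemma sum_src_horizontal [DecidablePred fun e : Fin (m + 1) × triangle D => csrc (Sum.inl e) = vtx g i k h] :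
    ∑ e : Fin (m + 1) × triangle D with csrc (Sum.inl e) = vtx g i k h,
      (cweight μ (Sum.inl e : CE m D) : ℤ) • cdir (Sum.inl e) =
        if i ≠ 0 then chartDir g (μ * -1) (μ * planarSlope (i - 1) k) else 0 := by
  refine sum_filter_eq_ite _ _ ?_ (fun hi => ?_) ?_
  · rintro ⟨g1, ⟨i1, k1⟩, hp1⟩ ⟨g2, ⟨i2, k2⟩, hp2⟩ h1 h2
    obtain ⟨h3, h4, h5⟩ := of_eq_vtx h1
    obtain ⟨h6, h7, h8⟩ := of_eq_vtx h2
    obtain rfl : g1 = g2 := Fin.ext (h3.trans h6.symm)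
    obtain rfl : i1 = i2 := by simpa [csrc, ctgt, vtx] using h4.trans h7.symm
    obtain rfl : k1 = k2 := by simpa [csrc, ctgt, vtx] using h5.trans h8.symm
    rfl
  · exact ⟨(g, ⟨(i - 1, k), mem_triangle.2 (by simp; omega)⟩), eq_vtx rfl (Nat.sub_add_cancel (Nat.pos_of_ne_zero hi)) rfl⟩
  · rintro ⟨g1, ⟨i1, k1⟩, hp1⟩ h1
    obtain ⟨h3, rfl, rfl⟩ := of_eq_vtx h1
    obtain rfl : g1 = g := Fin.ext h3
    exact ⟨Nat.succ_ne_zero _, chartDir_smul _ _ _⟩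

lemma sum_src_vertical [DecidablePred fun e : Fin (m + 1) × triangle D => csrc (Sum.inr (Sum.inl e)) = vtx g i k h] :
    ∑ e : Fin (m + 1) × triangle D with csrc (Sum.inr (Sum.inl e)) = vtx g i k h,
      (cweight μ (Sum.inr (Sum.inl e) : CE m D) : ℤ) • cdir (Sum.inr (Sum.inl e)) =
        if k ≠ 0 then chartDir g (μ * planarSlope (k - 1) i) (μ * -1) else 0 := by
  refine sum_filter_eq_ite _ _ ?_ (fun hi => ?_) ?_
  · rintro ⟨g1, ⟨i1, k1⟩, hp1⟩ ⟨g2, ⟨i2, k2⟩, hp2⟩ h1 h2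
    obtain ⟨h3, h4, h5⟩ := of_eq_vtx h1
    obtain ⟨h6, h7, h8⟩ := of_eq_vtx h2
    obtain rfl : g1 = g2 := Fin.ext (h3.trans h6.symm)
    obtain rfl : i1 = i2 := by simpa [csrc, ctgt, vtx] using h4.trans h7.symm
    obtain rfl : k1 = k2 := by simpa [csrc, ctgt, vtx] using h5.trans h8.symm
    rfl
  · exact ⟨(g, ⟨(i, k - 1), mem_triangle.2 (by simp; omega)⟩), eq_vtx rfl rfl (Nat.sub_add_cancel (Nat.pos_of_ne_zero hi))⟩
  · rintro ⟨g1, ⟨i1, k1⟩, hp1⟩ h1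
    obtain ⟨h3, rfl, rfl⟩ := of_eq_vtx h1
    obtain rfl : g1 = g := Fin.ext h3
    exact ⟨Nat.succ_ne_zero _, chartDir_smul _ _ _⟩

lemma sum_tgt_horizontal [DecidablePred fun e : Fin (m + 1) × triangle D => ctgt (Sum.inl e) = vtx g i k h] :
    ∑ e : Fin (m + 1) × triangle D with ctgt (Sum.inl e) = vtx g i k h,
      (cweight μ (Sum.inl e : CE m D) : ℤ) • (-cdir (Sum.inl e)) =
        if i + k < D then chartDir g (μ * 1) (μ * -planarSlope i k) else 0 := by
  refine sum_filter_eq_ite _ _ ?_ (fun hi => ?_) ?_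
  · rintro ⟨g1, ⟨i1, k1⟩, hp1⟩ ⟨g2, ⟨i2, k2⟩, hp2⟩ h1 h2
    obtain ⟨h3, h4, h5⟩ := of_eq_vtx h1
    obtain ⟨h6, h7, h8⟩ := of_eq_vtx h2
    obtain rfl : g1 = g2 := Fin.ext (h3.trans h6.symm)
    obtain rfl : i1 = i2 := by simpa [csrc, ctgt, vtx] using h4.trans h7.symm
    obtain rfl : k1 = k2 := by simpa [csrc, ctgt, vtx] using h5.trans h8.symm
    rfl
  · exact ⟨(g, ⟨(i, k), mem_triangle.2 hi⟩), eq_vtx rfl rfl rfl⟩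
  · rintro ⟨g1, ⟨i1, k1⟩, hp1⟩ h1
    obtain ⟨h3, rfl, rfl⟩ := of_eq_vtx h1
    obtain rfl : g1 = g := Fin.ext h3
    exact ⟨mem_triangle.1 hp1, (congrArg _ (chartDir_neg _ _)).trans (chartDir_smul _ _ _)⟩

lemma sum_tgt_vertical [DecidablePred fun e : Fin (m + 1) × triangle D => ctgt (Sum.inr (Sum.inl e)) = vtx g i k h] :
    ∑ e : Fin (m + 1) × triangle D with ctgt (Sum.inr (Sum.inl e)) = vtx g i k h,
      (cweight μ (Sum.inr (Sum.inl e) : CE m D) : ℤ) • (-cdir (Sum.inr (Sum.inl e))) =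
        if i + k < D then chartDir g (μ * -planarSlope k i) (μ * 1) else 0 := by
  refine sum_filter_eq_ite _ _ ?_ (fun hi => ?_) ?_
  · rintro ⟨g1, ⟨i1, k1⟩, hp1⟩ ⟨g2, ⟨i2, k2⟩, hp2⟩ h1 h2
    obtain ⟨h3, h4, h5⟩ := of_eq_vtx h1
    obtain ⟨h6, h7, h8⟩ := of_eq_vtx h2
    obtain rfl : g1 = g2 := Fin.ext (h3.trans h6.symm)
    obtain rfl : i1 = i2 := by simpa [csrc, ctgt, vtx] using h4.trans h7.symm
    obtain rfl : k1 = k2 := by simpa [csrc, ctgt, vtx] using h5.trans h8.symm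
    rfl
  · exact ⟨(g, ⟨(i, k), mem_triangle.2 hi⟩), eq_vtx rfl rfl rfl⟩
  · rintro ⟨g1, ⟨i1, k1⟩, hp1⟩ h1
    obtain ⟨h3, rfl, rfl⟩ := of_eq_vtx h1
    obtain rfl : g1 = g := Fin.ext h3
    exact ⟨mem_triangle.1 hp1, (congrArg _ (chartDir_neg _ _)).trans (chartDir_smul _ _ _)⟩

lemma smul_chartDir_down {g : ℕ} : ((μ * (D + 1) : ℕ) : ℤ) • (chartDir g 0 (-1) : Fin (m + 2) → ℤ) =
    chartDir g (μ * 0) (μ * -(D + 1)) := by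
  rw [chartDir_smul]
  congr 1
  push_cast
  ring

lemma smul_chartDir_left {g : ℕ} : ((μ * (D + 1) : ℕ) : ℤ) • (chartDir g (-1) 0 : Fin (m + 2) → ℤ) =
    chartDir g (μ * -(D + 1)) (μ * 0) := by
  rw [chartDir_smul]
  congr 1
  push_cast
  ring

lemma sum_src_connecting [DecidablePred fun e : Fin m => csrc (Sum.inr (Sum.inr e)) = vtx g i k h] :
    ∑ e : Fin m with csrc (Sum.inr (Sum.inr e)) = vtx g i k h,
      (cweight μ (Sum.inr (Sum.inr e) : CE m D) : ℤ) • cdir (Sum.inr (Sum.inr e) : CE m D) =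
        if i = D ∧ k = 0 ∧ (g : ℕ) < m then chartDir g (μ * 0) (μ * -(D + 1)) else 0 := by
  refine sum_filter_eq_ite _ _ (fun g1 g2 h1 h2 => ?_) ?_ (fun g1 h1 => ?_)
  · exact Fin.castSucc_injective m (Fin.ext ((of_eq_vtx h1).1.trans (of_eq_vtx h2).1.symm))
  · rintro ⟨rfl, rfl, hg⟩
    exact ⟨⟨g, hg⟩, eq_vtx rfl rfl rfl⟩
  · obtain ⟨h3, rfl, rfl⟩ := of_eq_vtx h1
    replace h3 : (g1 : ℕ) = g := h3
    refine ⟨⟨rfl, rfl, by omega⟩, ?_⟩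
    rw [← h3]
    exact smul_chartDir_down μ

lemma sum_tgt_connecting [DecidablePred fun e : Fin m => ctgt (Sum.inr (Sum.inr e)) = vtx g i k h] :
    ∑ e : Fin m with ctgt (Sum.inr (Sum.inr e)) = vtx g i k h,
      (cweight μ (Sum.inr (Sum.inr e) : CE m D) : ℤ) • (-cdir (Sum.inr (Sum.inr e) : CE m D)) =
        if i = 0 ∧ k = D ∧ (g : ℕ) ≠ 0 then chartDir g (μ * -(D + 1)) (μ * 0) else 0 := by
  refine sum_filter_eq_ite _ _ (fun g1 g2 h1 h2 => ?_) ?_ (fun g1 h1 => ?_)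
  · exact Fin.succ_injective m (Fin.ext ((of_eq_vtx h1).1.trans (of_eq_vtx h2).1.symm))
  · rintro ⟨rfl, rfl, hg⟩
    exact ⟨⟨g - 1, by omega⟩, eq_vtx (Nat.sub_add_cancel (Nat.pos_of_ne_zero hg)) rfl rfl⟩
  · obtain ⟨h3, rfl, rfl⟩ := of_eq_vtx h1
    replace h3 : (g1 : ℕ) + 1 = g := h3
    refine ⟨⟨rfl, rfl, by omega⟩, ?_⟩
    rw [cdir, chartDir_succ, chartDir_neg, h3]
    exact smul_chartDir_left μ

lemma sum_base_diagonal
    [DecidablePred fun r : Fin (m + 1) × Fin (D + 1) => cbase (Sum.inl r) = vtx g i k h] :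
    ∑ r : Fin (m + 1) × Fin (D + 1) with cbase (Sum.inl r) = vtx g i k h,
      (crweight μ (Sum.inl r : CR m D) : ℤ) • crdir (Sum.inl r : CR m D) =
        if i + k = D then chartDir g (μ * 1) (μ * 1) else 0 := by
  refine sum_filter_eq_ite _ _ ?_ (fun hi => ?_) ?_
  · rintro ⟨g1, i1⟩ ⟨g2, i2⟩ h1 h2
    obtain ⟨h3, h4, h5⟩ := of_eq_vtx h1
    obtain ⟨h6, h7, h8⟩ := of_eq_vtx h2
    exact Prod.ext (Fin.ext (h3.trans h6.symm)) (Fin.ext (h4.trans h7.symm))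
  · exact ⟨(g, ⟨i, by omega⟩), eq_vtx rfl rfl (Nat.sub_eq_of_eq_add' hi.symm)⟩
  · rintro ⟨g1, i1⟩ h1
    obtain ⟨h3, rfl, rfl⟩ := of_eq_vtx h1
    obtain rfl : g1 = g := Fin.ext h3
    exact ⟨Nat.add_sub_cancel' (Nat.le_of_lt_succ i1.2), chartDir_smul _ _ _⟩

lemma sum_base_end [DecidablePred fun r : Bool => cbase (Sum.inr r) = vtx g i k h] :
    ∑ r : Bool with cbase (Sum.inr r) = vtx g i k h,
      (crweight μ (Sum.inr r : CR m D) : ℤ) • crdir (Sum.inr r : CR m D) =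
        (if i = 0 ∧ k = D ∧ (g : ℕ) = 0 then chartDir g (μ * -(D + 1)) (μ * 0) else 0) +
        (if i = D ∧ k = 0 ∧ (g : ℕ) = m then chartDir g (μ * 0) (μ * -(D + 1)) else 0) := by
  rw [Finset.sum_filter, Fintype.sum_bool]
  congr 1
  · by_cases hq : i = 0 ∧ k = D ∧ (g : ℕ) = 0
    · rw [if_pos hq, if_pos (eq_vtx hq.2.2.symm hq.1.symm hq.2.1.symm), hq.2.2]
      exact smul_chartDir_left μ
    · rw [if_neg hq, if_neg]
      intro h1
      obtain ⟨h3, h4, h5⟩ := of_eq_vtx h1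
      exact hq ⟨h4.symm, h5.symm, h3.symm⟩
  · by_cases hq : i = D ∧ k = 0 ∧ (g : ℕ) = m
    · rw [if_pos hq, if_pos (eq_vtx hq.2.2.symm hq.1.symm hq.2.1.symm), hq.2.2]
      exact smul_chartDir_down μ
    · rw [if_neg hq, if_neg]
      intro h1
      obtain ⟨h3, h4, h5⟩ := of_eq_vtx h1
      exact hq ⟨h4.symm, h5.symm, h3.symm⟩

lemma curve_balanced (v : CV m D) [DecidablePred fun e : CE m D => csrc e = v]
    [DecidablePred fun e : CE m D => ctgt e = v] [DecidablePred fun r : CR m D => cbase r = v] :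
    (∑ e with csrc e = v, (cweight μ e : ℤ) • cdir e)
      + (∑ e with ctgt e = v, (cweight μ e : ℤ) • (-cdir e))
      + (∑ r with cbase r = v, (crweight μ r : ℤ) • crdir r) = 0 := by
  obtain ⟨g, i, k, h, rfl⟩ : ∃ g i k h, v = vtx g i k h := ⟨_, _, _, _, vtx_eta v⟩
  have hgm := g.is_lt
  simp only [sum_filter_sum]
  rw [sum_src_horizontal, sum_src_vertical, sum_src_connecting, sum_tgt_horizontal,
    sum_tgt_vertical, sum_tgt_connecting, sum_base_diagonal, sum_base_end]
  have e1 := planar_balance h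
  have e2 := planar_balance (D := D) (i := k) (k := i) (by omega)
  -- At the corner `(0, D)` the heavy edge is the first end if `g = 0` and the edge from the
  -- previous chart otherwise; both have the same direction and weight. The corner `(D, 0)` is
  -- analogous.
  have hl : (if i = 0 ∧ k = D ∧ (g : ℕ) ≠ 0 then -((D : ℤ) + 1) else 0) +
      (if i = 0 ∧ k = D ∧ (g : ℕ) = 0 then -((D : ℤ) + 1) else 0) =
      if i = 0 ∧ k = D then -((D : ℤ) + 1) else 0 := by
    split_ifs <;> omega
  have hr : (if i = D ∧ k = 0 ∧ (g : ℕ) < m then -((D : ℤ) + 1) else 0) +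
      (if i = D ∧ k = 0 ∧ (g : ℕ) = m then -((D : ℤ) + 1) else 0) =
      if k = 0 ∧ i = D then -((D : ℤ) + 1) else 0 := by
    split_ifs <;> omega
  rw [← hl] at e1
  rw [← hr] at e2
  replace e1 := congrArg ((μ : ℤ) * ·) e1
  replace e2 := congrArg ((μ : ℤ) * ·) e2
  simp only [mul_add, mul_ite, mul_zero, add_comm k i] at e1 e2
  simp only [ite_chartDir, chartDir_add, mul_zero, ite_self, add_zero, zero_add]
  rw [← chartDir_zero (g := g)]
  congr 1 <;> linarith

end balance

/-! ### The chain of curves, its planarity and degree -/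

lemma isCoprime_neg_one_left (b : ℤ) : IsCoprime (-1) b := ⟨-1, 0, by ring⟩

lemma isCoprime_neg_one_right (a : ℤ) : IsCoprime a (-1) := ⟨0, -1, by ring⟩

/-- A chain of `m + 1` planar curves of genus `D (D - 1) / 2`. -/
def chainCurve (m D μ : ℕ) (hμ : 0 < μ) : TropicalCurve (m + 2) where
  V := CV m D
  E := CE m D
  R := CR m D
  pos := cpos
  src := csrc
  tgt := ctgt
  dir := cdir
  dir_primitive e := by
    rcases e with e | e | g
    · exact gcd_chartDir (by omega) (isCoprime_neg_one_left _)
    · exact gcd_chartDir (by omega) (isCoprime_neg_one_right _)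
    · exact gcd_chartDir (by omega) (isCoprime_neg_one_right _)
  len := clen
  len_pos e := by
    rcases e with e | e | g
    · exact planarLen_pos _ _
    · exact planarLen_pos _ _
    · have := lt_scale D
      simp only [clen]
      linarith
  tgt_eq e j := by
    rcases e with e | e | g <;> refine Eq.trans ?_ (chartPos_add j).symm
    · simp [cpos, csrc, ctgt, vtx, clen, planarX_add_planarSlope, ← sub_eq_add_neg,
        planarX_sub_planarLen]
    · simp [cpos, csrc, ctgt, vtx, clen, planarX_add_planarSlope, ← sub_eq_add_neg,
        planarX_sub_planarLen]
    · simp only [cpos, csrc, ctgt, vtx, clen, planarX_zero, planarX_zero_right, Fin.val_castSucc,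
        Fin.val_succ, Int.cast_zero, mul_zero, add_zero]
      -- The length of a connecting edge is chosen so that `Y = -triNum D - clen` in the chart `g`
      -- is `X = -triNum D` in the chart `g + 1`.
      rw [chartPos_succ]
      congr 1
      push_cast
      ring
  base := cbase
  rdir := crdir
  rdir_primitive r := by
    rcases r with r | _ | _
    · exact gcd_chartDir (by omega) isCoprime_one_left
    · exact gcd_chartDir (by omega) (isCoprime_neg_one_right _)
    · exact gcd_chartDir (by omega) (isCoprime_neg_one_left _)
  weight := cweight μ
  weight_pos e := by rcases e with e | e | g <;> simp [cweight, hμ]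
  rweight := crweight μ
  rweight_pos r := by rcases r with r | r <;> simp [crweight, hμ]
  embedded a b hab := by
    refine Set.disjoint_left.2 fun x ha hb => ?_
    obtain ⟨h1, h2⟩ := (located ha).unique (located hb) (czone_le a) (czone_le b)
    exact hab (czone_cpiece_injective h1 h2)
  not_isolated v := by
    obtain ⟨g, ⟨i, k⟩, h⟩ := v
    rcases (Nat.le_of_lt_succ (mem_triangle.1 h)).lt_or_eq with h' | h'
    · exact Or.inr (Or.inl ⟨Sum.inl (g, ⟨(i, k), mem_triangle.2 h'⟩), rfl⟩)
    · refine Or.inr (Or.inr ⟨Sum.inl (g, ⟨i, by simp at h'; omega⟩), ?_⟩)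
      exact (eq_vtx (h := h'.le) rfl rfl (Nat.sub_eq_of_eq_add' h'.symm))
  balanced v := @curve_balanced m D μ v (fun _ => Classical.propDecidable _)
    (fun _ => Classical.propDecidable _) (fun _ => Classical.propDecidable _)

lemma chainCurve_isPlanar (m D μ : ℕ) (hμ : 0 < μ) : (chainCurve m D μ hμ).IsPlanar := by
  have hL : IsPlaneSet (2 * scale D * (m + 2)) (planeSet (m + 2) (scale D)) :=
    isPlaneSet_planeSet (by simp [scale]) (by omega)
  refine ⟨hL.variety, hL.hasDegree_one, fun x hx => ?_⟩
  obtain ⟨a, ha⟩ := Set.mem_iUnion.1 hx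
  have e : dehom (Fin.cons 0 x : Fin (m + 3) → ℝ) = x := by
    ext j
    simp [dehom]
  have := hL.mem_iff.1 (located ha).mem_planeSet
  rw [e] at this
  exact this

/-- The diagonal ends and the last end have no positive coordinate. The first end has direction `(1,
…, 1)` and contributes its weight. -/
lemma chainCurve_degree (m D μ : ℕ) (hμ : 0 < μ) : (chainCurve m D μ hμ).degree = μ * (D + 1) := by
  have key : ∀ (g : ℕ) (a b : ℤ), 0 ≤ a → b ≤ a →
      Finset.univ.sup (fun j : Fin (m + 2) => (chartDir g a b j).toNat) = 0 := by
    intro g a b ha hb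
    rw [← Nat.bot_eq_zero, Finset.sup_eq_bot_iff]
    intro j _
    rw [Nat.bot_eq_zero, Int.toNat_eq_zero, chartDir]
    split_ifs <;> omega
  have hl : Finset.univ.sup (fun j : Fin (m + 2) => (chartDir 0 (-1) 0 j).toNat) = 1 := by
    have : ∀ j : Fin (m + 2), (chartDir 0 (-1) 0 j).toNat = 1 := fun j => by
      simp [chartDir]
    simp only [this]
    exact Finset.sup_const Finset.univ_nonempty 1
  change ∑ r : CR m D, crweight μ r * Finset.univ.sup (fun j => (crdir r j).toNat) = _
  rw [Fintype.sum_sum_type, Fintype.sum_bool]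
  simp only [crweight, crdir]
  rw [hl, key m 0 (-1) le_rfl (by norm_num)]
  simp only [key _ 1 1 zero_le_one le_rfl]
  simp

/-! ### The genus -/

/-- Two vertices are adjacent if they are the source and the target of a bounded edge. -/
def TropicalCurve.Adjacent (C : TropicalCurve n) (v w : C.V) : Prop := ∃ e, C.src e = v ∧ C.tgt e = w

section genus

variable {K : Type*} [Field K] (C : TropicalCurve n)

open Classical in
lemma TropicalCurve.boundary_single (e : C.E) :
    C.boundary K (Pi.single e 1) = Pi.single (C.tgt e) 1 - Pi.single (C.src e) 1 := by
  ext v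
  simp [boundary, Pi.single_apply, eq_comm (a := v)]

open Classical in
lemma TropicalCurve.sum_boundary (c : C.E → K) : ∑ v, C.boundary K c v = 0 := by
  simp only [boundary, LinearMap.coe_mk, AddHom.coe_mk, Finset.sum_sub_distrib, Finset.sum_filter]
  rw [Finset.sum_comm, Finset.sum_comm (f := fun v e => if C.src e = v then c e else 0)]
  simp

open Classical in
lemma TropicalCurve.single_sub_single_mem {v w : C.V} (h : Relation.EqvGen C.Adjacent v w) :
    (Pi.single w 1 - Pi.single v 1 : C.V → K) ∈ LinearMap.range (C.boundary K) := by
  induction h with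
  | rel v w h =>
    obtain ⟨e, rfl, rfl⟩ := h
    exact ⟨_, C.boundary_single e⟩
  | refl v => simp
  | symm v w _ ih => simpa using Submodule.neg_mem _ ih
  | trans u v w _ _ ih ih' => simpa using Submodule.add_mem _ ih' ih

/-- The Euler characteristic of a connected graph. -/
lemma TropicalCurve.genus_add_card (v : C.V) (h : ∀ w, Relation.EqvGen C.Adjacent v w) :
    C.genus K + Fintype.card C.V = Fintype.card C.E + 1 := by
  classical
  let φ : (C.V → K) →ₗ[K] K := ∑ w, LinearMap.proj w
  have hφ : ∀ f, φ f = ∑ w, f w := fun f => by simp [φ]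
  have hr : LinearMap.range (C.boundary K) = LinearMap.ker φ := by
    apply le_antisymm
    · rintro _ ⟨c, rfl⟩
      rw [LinearMap.mem_ker, hφ, C.sum_boundary]
    · intro f hf
      rw [LinearMap.mem_ker, hφ] at hf
      -- A function of total sum zero is a combination of differences of vertices with `v`, and by
      -- connectedness each of these is a boundary.
      have e : f = ∑ w, f w • (Pi.single w 1 - Pi.single v 1 : C.V → K) := by
        ext u
        simp [Finset.sum_apply, mul_sub, Finset.sum_sub_distrib, hf,
          Pi.single_apply]
      rw [e]
      exact Submodule.sum_mem _ fun w _ => Submodule.smul_mem _ _ (C.single_sub_single_mem (h w))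
  have hs : LinearMap.range φ = ⊤ := by
    rw [LinearMap.range_eq_top]
    intro a
    exact ⟨Pi.single v a, by rw [hφ]; simp⟩
  have h1 := LinearMap.finrank_range_add_finrank_ker (C.boundary K)
  have h2 := LinearMap.finrank_range_add_finrank_ker φ
  rw [hs, finrank_top, Module.finrank_self, Module.finrank_fintype_fun_eq_card] at h2
  rw [hr, Module.finrank_fintype_fun_eq_card] at h1
  unfold genus
  omega

end genus

lemma chainCurve_adjacent {m D μ : ℕ} (hμ : 0 < μ) (g : Fin (m + 1)) (i k : ℕ) (h : i + k ≤ D) :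
    Relation.EqvGen (chainCurve m D μ hμ).Adjacent (vtx g 0 0 (Nat.zero_le D)) (vtx g i k h) := by
  induction i with
  | zero =>
    induction k with
    | zero => exact .refl _
    | succ k ih =>
      refine (ih (by omega)).trans _ _ _ (.symm _ _ (.rel _ _ ?_))
      exact ⟨Sum.inr (Sum.inl (g, ⟨(0, k), mem_triangle.2 (by simp; omega)⟩)), rfl, rfl⟩
  | succ i ih =>
    refine (ih (by omega)).trans _ _ _ (.symm _ _ (.rel _ _ ?_))
    exact ⟨Sum.inl (g, ⟨(i, k), mem_triangle.2 (by simp; omega)⟩), rfl, rfl⟩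

lemma chainCurve_connected {m D μ : ℕ} (hμ : 0 < μ) (w : CV m D) :
    Relation.EqvGen (chainCurve m D μ hμ).Adjacent (vtx 0 0 0 (Nat.zero_le D)) w := by
  have key : ∀ g : Fin (m + 1), Relation.EqvGen (chainCurve m D μ hμ).Adjacent
      (vtx 0 0 0 (Nat.zero_le D)) (vtx g 0 0 (Nat.zero_le D)) := by
    intro g
    induction g using Fin.induction with
    | zero => exact .refl _
    | succ g ih =>
      refine .trans _ _ _ (.trans _ _ _ (.trans _ _ _ ih
        (chainCurve_adjacent hμ _ D 0 le_rfl)) (.rel _ _ ⟨Sum.inr (Sum.inr g), rfl, rfl⟩))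
        (.symm _ _ (chainCurve_adjacent hμ _ 0 D (zero_add D).le))
  exact .trans _ _ _ (key w.1) (vtx_eta w ▸ chainCurve_adjacent hμ _ _ _ _)

/-- The curve is connected, so the Euler characteristic suffices. The `m` connecting edges are just
enough to join the `m + 1` charts and create no further cycle. -/
lemma chainCurve_genus {K : Type*} [Field K] {m D μ : ℕ} (hμ : 0 < μ) :
    2 * (chainCurve m D μ hμ).genus K + (m + 1) * D = (m + 1) * (D * D) := by
  have h := (chainCurve m D μ hμ).genus_add_card (K := K) _ (chainCurve_connected hμ)
  have hV : Fintype.card (chainCurve m D μ hμ).V = (m + 1) * (triangle (D + 1)).card := by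
    change Fintype.card (CV m D) = _
    simp
  have hE : Fintype.card (chainCurve m D μ hμ).E =
      (m + 1) * (triangle D).card + ((m + 1) * (triangle D).card + m) := by
    change Fintype.card (CE m D) = _
    simp
  rw [hV, hE] at h
  have h1 := two_mul_card_triangle D
  have h2 := two_mul_card_triangle (D + 1)
  zify at *
  linear_combination 2 * h - (m + 1 : ℤ) * h2 + 2 * (m + 1 : ℤ) * h1

end Tropical

end

theorem mainTheorem4 (K : Type*) [Field K] :
    (∀ d n : ℕ, 1 ≤ d → 2 ≤ n → ∃ C : Tropical.TropicalCurve n, C.IsPlanar ∧ C.degree = d ∧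
      (C.genus K : ℚ) = ((n : ℚ) - 1) * (((d : ℚ) - 1) * ((d : ℚ) - 2) / 2)) ∧
    (∀ g : ℕ, ∃ n : ℕ, 2 ≤ n ∧ ∃ C : Tropical.TropicalCurve n, C.IsPlanar ∧ C.degree = 3 ∧
      C.genus K = g) ∧
    (∀ d : ℕ, 3 ≤ d → ∀ B : ℕ, ∃ n : ℕ, 2 ≤ n ∧ ∃ C : Tropical.TropicalCurve n,
      C.IsPlanar ∧ C.degree = d ∧ B < C.genus K) := by
  open Tropical in
  refine ⟨fun d n hd hn => ?_, fun g => ?_, fun d hd B => ?_⟩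
  · obtain ⟨D, rfl⟩ := Nat.exists_eq_add_of_le' hd
    obtain ⟨m, rfl⟩ := Nat.exists_eq_add_of_le' hn
    refine ⟨chainCurve m D 1 one_pos, chainCurve_isPlanar m D 1 one_pos, ?_, ?_⟩
    · rw [chainCurve_degree, one_mul]
    · have h := chainCurve_genus (K := K) (m := m) (D := D) one_pos
      have h' : 2 * ((chainCurve m D 1 one_pos).genus K : ℚ) + (m + 1) * D = (m + 1) * (D * D) := by
        exact_mod_cast h
      push_cast
      linear_combination h' / 2
  · rcases g with _ | g
    -- Genus zero: a tropical line with all weights equal to `3`. For positive genus, each chart of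
    -- a chain of cubics contributes `1`.
    · refine ⟨2, le_rfl, chainCurve 0 0 3 three_pos, chainCurve_isPlanar 0 0 3 three_pos,
        chainCurve_degree 0 0 3 three_pos, ?_⟩
      have h := chainCurve_genus (K := K) (m := 0) (D := 0) three_pos
      omega
    · refine ⟨g + 2, by omega, chainCurve g 2 1 one_pos, chainCurve_isPlanar g 2 1 one_pos,
        chainCurve_degree g 2 1 one_pos, ?_⟩
      have h := chainCurve_genus (K := K) (m := g) (D := 2) one_pos
      omega
  · obtain ⟨D, rfl⟩ := Nat.exists_eq_add_of_le' (Nat.le_of_succ_le hd)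
    -- Here `d = D + 2` with `D ≥ 1`, so each of the `B + 1` charts has genus at least one.
    refine ⟨B + 2, by omega, chainCurve B (D + 1) 1 one_pos,
      chainCurve_isPlanar B (D + 1) 1 one_pos, ?_, ?_⟩
    · rw [chainCurve_degree, one_mul]
    · have h := chainCurve_genus (K := K) (m := B) (D := D + 1) one_pos
      have hD : 1 ≤ D := by omega
      have : (B + 1) * ((D + 1) * (D + 1)) = (B + 1) * (D + 1) + (B + 1) * (D * (D + 1)) := by ring
      have h2 : (B + 1) * 2 ≤ (B + 1) * (D * (D + 1)) := by gcongr; nlinarith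
      omega
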